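/- Let $d\ge 1$ be an integer, $1\le p<\infty$, $-1<\alpha<p-1$ and $s:=1-(\alpha+1)/p\in(0,1)$. Functions are complex-valued. **Notation.** For $k\in\mathbb Z$ let $\mathscr Q_{d,k}$ be the set of the dyadic cubes $Q=2^{-k}((0,1]^d+m)$, $m\in\mathbb Z^d$, with edge length $\ell(Q)=2^{-k}$, and write $f_Q$ for the mean of $f$ over $Q$ with respect to Lebesgue measure $m_d$. Write $Q\sim Q'$ if $\frac12\le \ell(Q)/\ell(Q')\le 2$ and $\overline Q\cap\overline{Q'}\ne\emptyset$. The Besov space $B^{s}_{p,p}(\mathbb R^d)$ consists of the $f\in L^1_{loc}(\mathbb R^d)$ with $$\|f\|_{B^s_{p,p}}:=\|f\|_{L^p(\mathbb R^d)}+\Big(\sum_{k\ge 0}2^{ksp}\sum_{Q\in\mathscr Q_{d,k}}m_d(Q)\sum_{Q'\sim Q}|f_Q-f_{Q'}|^p\Big)^{1/p}<\infty .$$ Let $\mathbb R^{d+1}_+=\mathbb R^d\times(0,\infty)$ and $d\mu_\alpha(x)=\min(1,|x_{d+1}|)^\alpha\,dx$ on $\mathbb R^{d+1}_+$. The space $W^{1,p}(\mathbb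 R^{d+1}_+,\mu_\alpha)$ consists of the functions $f$ which, together with their first-order distributional derivatives in $\mathbb R^{d+1}_+$, are functions integrable over bounded subsets of $\mathbb R^{d+1}_+$, and for which $\|f\|_{W^{1,p}}:=\|f\|_{L^p(\mu_\alpha)}+\|\nabla f\|_{L^p(\mu_\alpha)}<\infty$. Let $\mathscr Q^0_d=\bigcup_{k\ge0}\mathscr Q_{d,k}$ and $\mathscr W(Q)=Q\times(\ell(Q),2\ell(Q)]$. A *Whitney family* is a family of smooth functions $\psi_Q:\mathbb R^{d+1}_+\to[0,1]$, $Q\in\mathscr Q^0_d$, such that, with constants $C<\infty$, $c>0$ independent of $Q$, $\psi_Q$ is $C/\ell(Q)$-Lipschitz, $\psi_Q\ge c$ on $\mathscr W(Q)$, $\operatorname{supp}\psi_Q$ is contained in the $\ell(Q)/4$-neighborhood of $\mathscr W(Q)$, and $\sum_Q\psi_Q=1$ on $\bigcup_{Q}\mathscr W(Q)$. The *Whitney extension* of $f\in L^1_{loc}(\mathbb R^d)$ is $\mathcal E f=\sum_{Q\in\mathscr Q^0_d}f_Q\,\psi_Q$. The *trace* of a function $f$ on $\mathbb R^{d+1}_+$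 is $$\mathcal R f(x)=\lim_{r\to0^+}\frac1{\mu_\alpha(B((x,0),r)\cap\mathbb R^{d+1}_+)}\int_{B((x,0),r)\cap\mathbb R^{d+1}_+}f\,d\mu_\alpha .$$ **Theorem.** Whitney families exist, and for every Whitney family $(\psi_Q)$ the pair $\big(B^{1-(\alpha+1)/p}_{p,p}(\mathbb R^d),\,W^{1,p}(\mathbb R^{d+1}_+,\mu_\alpha)\big)$ is a Whitney trace-extension pair, that is: 1. $\mathcal E$ is a bounded linear operator from $B^{1-(\alpha+1)/p}_{p,p}(\mathbb R^d)$ to $W^{1,p}(\mathbb R^{d+1}_+,\mu_\alpha)$; 2. for every $f\in W^{1,p}(\mathbb R^{d+1}_+,\mu_\alpha)$ the function $f$ is $\mu_\alpha$-integrable over the half-balls above, the limit $\mathcal Rf(x)$ exists for almost every $x\in\mathbb R^d$, and $\mathcal Rf\in L^1_{loc}(\mathbb R^d)$; 3. $\mathcal R$ is a bounded linear operator from $W^{1,p}(\mathbb R^{d+1}_+,\mu_\alpha)$ to $B^{1-(\alpha+1)/p}_{p,p}(\mathbb R^d)$; 4. $\mathcal R(\mathcal E f)=f$ almost everywhere for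 every $f\in B^{1-(\alpha+1)/p}_{p,p}(\mathbb R^d)$. -/

import Mathlib

open MeasureTheory Filter Topology Set
open scoped ENNReal NNReal ContDiff

namespace WhitneyTrace

/-- Euclidean space `ℝᵈ`. -/
abbrev Eucl (d : ℕ) : Type := EuclideanSpace ℝ (Fin d)

/-- The open half-space `ℝ^{d+1}₊ = ℝᵈ × (0, ∞)`. Functions on the half-space are represented by
functions on `ℝ^{d+1}` whose values outside the half-space play no role. -/
def halfSpace (d : ℕ) : Set (Eucl (d + 1)) := {x | 0 < x (Fin.last d)}

/-- The first `d` coordinates of a point of `ℝ^{d+1}`. -/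
noncomputable def horizontal {d : ℕ} (x : Eucl (d + 1)) : Eucl d :=
  WithLp.toLp 2 (fun i : Fin d => x i.castSucc)

/-- The boundary point `(x, 0)`. -/
noncomputable def boundaryPoint {d : ℕ} (x : Eucl d) : Eucl (d + 1) :=
  WithLp.toLp 2 (Fin.snoc (α := fun _ => ℝ) (fun i : Fin d => x i) 0)

/-- The measure `μ_α` on the half-space, with density `min(1, |x_{d+1}|)^α`. -/
noncomputable def weightMeasure (d : ℕ) (α : ℝ) : Measure (Eucl (d + 1)) :=
  (volume.restrict (halfSpace d)).withDensity
    (fun x => ENNReal.ofReal ((min 1 |x (Fin.last d)|) ^ α))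

/-! ### Dyadic cubes and Besov spaces -/

/-- The edge length `2^{-k}` of the dyadic cubes of level `k`. -/
noncomputable def edge (k : ℤ) : ℝ := (2 : ℝ) ^ (-k)

/-- The semi-open dyadic cube `2^{-k} ((0,1]ᵈ + m)`. -/
def dyadicCube {d : ℕ} (k : ℤ) (m : Fin d → ℤ) : Set (Eucl d) :=
  {x | ∀ i, edge k * (m i : ℝ) < x i ∧ x i ≤ edge k * ((m i : ℝ) + 1)}

/-- The neighbor relation on dyadic cubes, each given by its level and its position. -/
def Neighbor {d : ℕ} (Q Q' : ℤ × (Fin d → ℤ)) : Prop :=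
  1 / 2 ≤ edge Q.1 / edge Q'.1 ∧ edge Q.1 / edge Q'.1 ≤ 2 ∧
    (closure (dyadicCube Q.1 Q.2) ∩ closure (dyadicCube Q'.1 Q'.2)).Nonempty

/-- The mean value of `f` over a dyadic cube. -/
noncomputable def cubeAverage {d : ℕ} (f : Eucl d → ℂ) (Q : ℤ × (Fin d → ℤ)) : ℂ :=
  ⨍ x in dyadicCube Q.1 Q.2, f x

/-- The dyadic (quasi-)norm of the Besov space `B^s_{p,q}(ℝᵈ)`, for finite `p` and `q`. -/
noncomputable def besovNorm {d : ℕ} (s p q : ℝ) (f : Eucl d → ℂ) : ℝ≥0∞ :=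
  eLpNorm f (ENNReal.ofReal p) volume +
    (∑' k : ℕ, ENNReal.ofReal ((2 : ℝ) ^ ((k : ℝ) * s * q)) *
      (∑' m : Fin d → ℤ, volume (dyadicCube (k : ℤ) m) *
        ∑' Q' : {Q' : ℤ × (Fin d → ℤ) // Neighbor ((k : ℤ), m) Q'},
          ‖cubeAverage f ((k : ℤ), m) - cubeAverage f Q'.1‖ₑ ^ p) ^ (q / p)) ^ (1 / q)

/-- The Besov space `B^s_{p,q}(ℝᵈ)`, as a set of functions. -/
def besovSpace (d : ℕ) (s p q : ℝ) : Set (Eucl d → ℂ) :=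
  {f | LocallyIntegrable f volume ∧ besovNorm s p q f < ⊤}

/-! ### Weighted Sobolev spaces on the half-space -/

/-- Integrability on the bounded subsets of the half-space. -/
def LocIntegrableHalf {d : ℕ} {F : Type*} [NormedAddCommGroup F] (f : Eucl (d + 1) → F) : Prop :=
  ∀ S : Set (Eucl (d + 1)), Bornology.IsBounded S → IntegrableOn f (S ∩ halfSpace d) volume

/-- `g` is the distributional gradient of `f` in the half-space, and is integrable on bounded
subsets of the half-space. -/
def IsWeakGradient {d : ℕ} (f : Eucl (d + 1) → ℂ)
    (g : Eucl (d + 1) → EuclideanSpace ℂ (Fin (d + 1))) : Prop :=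
  LocIntegrableHalf g ∧
    ∀ φ : Eucl (d + 1) → ℝ, ContDiff ℝ ∞ φ → HasCompactSupport φ → tsupport φ ⊆ halfSpace d →
      ∀ i : Fin (d + 1),
        ∫ x in halfSpace d, (fderiv ℝ φ x (EuclideanSpace.single i (1 : ℝ))) • f x =
          - ∫ x in halfSpace d, φ x • g x i

/-- The norm `‖f‖_{L^p(μ)} + ‖∇f‖_{L^p(μ)}`. The distributional gradient of a locally integrable
function is unique almost everywhere, so for `μ` absolutely continuous the infimum is over a
single value; it is `⊤` if there is no distributional gradient. -/
noncomputable def sobolevNorm {d : ℕ} (p : ℝ) (μ : Measure (Eucl (d + 1)))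
    (f : Eucl (d + 1) → ℂ) : ℝ≥0∞ :=
  eLpNorm f (ENNReal.ofReal p) μ +
    ⨅ (g : Eucl (d + 1) → EuclideanSpace ℂ (Fin (d + 1))) (_ : IsWeakGradient f g),
      eLpNorm g (ENNReal.ofReal p) μ

/-- The weighted Sobolev space `W^{1,p}(ℝ^{d+1}₊, μ)`, as a set of functions. -/
def sobolevSpace (d : ℕ) (p : ℝ) (μ : Measure (Eucl (d + 1))) : Set (Eucl (d + 1) → ℂ) :=
  {f | LocIntegrableHalf f ∧ sobolevNorm p μ f < ⊤}

/-! ### Whitney extension and trace -/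

/-- The Whitney box `W(Q) = Q × (2^{-k}, 2^{-k+1}]` over a dyadic cube `Q` of level `k`. -/
def whitneyBox {d : ℕ} (k : ℤ) (m : Fin d → ℤ) : Set (Eucl (d + 1)) :=
  {x | horizontal x ∈ dyadicCube k m ∧ edge k < x (Fin.last d) ∧ x (Fin.last d) ≤ 2 * edge k}

/-- A family of bump functions `ψ_Q`, where `Q` runs over the dyadic cubes of level `k ≥ 0`, adapted
to the Whitney boxes `W(Q)`. As the support of `ψ_Q` has positive distance to the boundary of
the half-space, `ψ_Q` is identified with its extension by zero to `ℝ^{d+1}`. -/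
structure IsWhitneyFamily {d : ℕ} (ψ : ℕ → (Fin d → ℤ) → Eucl (d + 1) → ℝ) : Prop where
  smooth : ∀ k m, ContDiff ℝ ∞ (ψ k m)
  mem_Icc : ∀ k m x, ψ k m x ∈ Icc (0 : ℝ) 1
  lipschitz : ∃ C : ℝ≥0, ∀ k m, LipschitzWith (C * 2 ^ k) (ψ k m)
  lower_bound : ∃ c : ℝ, 0 < c ∧ ∀ (k : ℕ) (m), ∀ x ∈ whitneyBox (k : ℤ) m, c ≤ ψ k m x
  support_subset : ∀ (k : ℕ) (m),
    tsupport (ψ k m) ⊆ Metric.thickening (edge (k : ℤ) / 4) (whitneyBox (k : ℤ) m)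
  sum_eq_one : ∀ x ∈ ⋃ Q : ℕ × (Fin d → ℤ), whitneyBox (Q.1 : ℤ) Q.2,
    ∑ᶠ Q : ℕ × (Fin d → ℤ), ψ Q.1 Q.2 x = 1

/-- The Whitney extension `Ext f = ∑_Q (⨍_Q f) ψ_Q`; at each point only finitely many terms of the
sum are nonzero. -/
noncomputable def whitneyExt {d : ℕ} (ψ : ℕ → (Fin d → ℤ) → Eucl (d + 1) → ℝ)
    (f : Eucl d → ℂ) (x : Eucl (d + 1)) : ℂ :=
  ∑ᶠ Q : ℕ × (Fin d → ℤ), ψ Q.1 Q.2 x • cubeAverage f ((Q.1 : ℤ), Q.2)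

/-- The part `B((x,0), r) ∩ ℝ^{d+1}₊` of a ball centred at a boundary point. -/
def halfBall {d : ℕ} (x : Eucl d) (r : ℝ) : Set (Eucl (d + 1)) :=
  Metric.ball (boundaryPoint x) r ∩ halfSpace d

/-- The trace of `f` at `x` is well defined, with value `c`: the averages of `f` over the half-balls
at `(x,0)` make sense and converge to `c`. -/
def HasTraceAt {d : ℕ} (μ : Measure (Eucl (d + 1))) (f : Eucl (d + 1) → ℂ) (x : Eucl d)
    (c : ℂ) : Prop :=
  (∀ r : ℝ, 0 < r → IntegrableOn f (halfBall x r) μ) ∧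
    Tendsto (fun r : ℝ => ⨍ y in halfBall x r, f y ∂μ) (𝓝[>] 0) (𝓝 c)

/-- The trace function of `f`, the limit of the averages over half-balls where it exists (and
a meaningless value elsewhere). -/
noncomputable def trace {d : ℕ} (μ : Measure (Eucl (d + 1))) (f : Eucl (d + 1) → ℂ)
    (x : Eucl d) : ℂ :=
  limUnder (𝓝[>] (0 : ℝ)) (fun r : ℝ => ⨍ y in halfBall x r, f y ∂μ)

/-- `(X, Y)` is a Whitney trace-extension pair, where `X` is a function space on `ℝᵈ` with norm `NX`
and `Y` is a function space on the half-space with measure `μ` and norm `NY`. Continuity of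
the extension and the trace is expressed as linearity and boundedness. -/
structure IsWhitneyTraceExtensionPair {d : ℕ} (ψ : ℕ → (Fin d → ℤ) → Eucl (d + 1) → ℝ)
    (X : Set (Eucl d → ℂ)) (NX : (Eucl d → ℂ) → ℝ≥0∞)
    (Y : Set (Eucl (d + 1) → ℂ)) (NY : (Eucl (d + 1) → ℂ) → ℝ≥0∞)
    (μ : Measure (Eucl (d + 1))) : Prop where
  ext_linear : ∀ f ∈ X, ∀ g ∈ X, ∀ a b : ℂ, ∀ x ∈ halfSpace d,
    whitneyExt ψ (a • f + b • g) x = a * whitneyExt ψ f x + b * whitneyExt ψ g x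
  ext_bounded : ∃ C : ℝ≥0, ∀ f ∈ X, whitneyExt ψ f ∈ Y ∧ NY (whitneyExt ψ f) ≤ C * NX f
  trace_exists : ∀ f ∈ Y, (∀ᵐ x : Eucl d, ∃ c : ℂ, HasTraceAt μ f x c) ∧
    LocallyIntegrable (trace μ f) volume
  trace_linear : ∀ f ∈ Y, ∀ g ∈ Y, ∀ a b : ℂ, ∀ᵐ x : Eucl d,
    trace μ (a • f + b • g) x = a * trace μ f x + b * trace μ g x
  trace_bounded : ∃ C : ℝ≥0, ∀ f ∈ Y, trace μ f ∈ X ∧ NX (trace μ f) ≤ C * NY f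
  trace_ext : ∀ f ∈ X, ∀ᵐ x : Eucl d, trace μ (whitneyExt ψ f) x = f x

end WhitneyTrace

/-!
# Traces and Whitney extensions for weighted Sobolev functions on the half-space

**Traces.** By duality with test functions, a weakly differentiable function `f` satisfies
`f (x + v) - f x = ∫₀¹ ∂ᵥ f (x + s v) ds` for almost every `x`, for each fixed `v` which does not
point towards the boundary (`ae_sub_eq_integral_segment`). For vertical `v` this shows that
`f (y, t) - ∫₀ᵗ ∂_{d+1} f (y, s) ds` does not depend on `t`; its value `bdry f g y`, where `g` is
the weak gradient, is the boundary value of `f` at `y` (`IsNormalPair.ae_eq_bdry_add`). Thus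
`|f (y, t) - bdry f g y|` is at most `column g r y = ∫₀ʳ |g (y, s)| ds` for `t < r`. A half-ball of
radius `r` is comparable to the cylinder of height `r` over its base, so Lebesgue's differentiation
theorem, for the boundary values and for the columns of a fixed small height, shows that the
averages of `f` over half-balls converge to the boundary values (`IsNormalPair.ae_hasTraceAt`).

To compare boundary values at `y` and `y + h` with `|h| ≲ r = 2^{-k}`, one goes up to a height
below `r`, moves horizontally, and goes down again; averaging over the height gives
`‖bdry f g (· + h) - bdry f g‖_p ≲ ‖column g r‖_p` (`IsNormalPair.lintegral_bdry_sub_le`). The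
terms of level `k` in the Besov norm are controlled by this modulus of continuity
(`tsum_level_le`), and the sum over `k`, with weights `2^{ksp} = 2^{k(p-1-α)}`, is bounded by
`∫ |g|^p t^α` through a dyadic Hardy inequality (`exists_hardy`), which holds as `α < p - 1`. This
gives `exists_besovNorm_trace_le`.

**Extensions.** If `ψ_Q` does not vanish near a point above `R`, at a height of the Whitney box
over `R`, then `Q` is a neighbor of `R` (`IsWhitneyFamily.neighbor_of_mem_tsupport`). Since the
bump functions sum to one at heights up to `2`, their gradients sum to zero below that height, and
`|∇ Ext f| ≲ 2^k ∑_{Q ∼ R} |f_Q - f_R|` over a cube `R` of level `k ≥ 1`; in the top layer `f_R`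
itself enters (`IsWhitneyFamily.enorm_fderiv_whitneyExt_le`). The layer of level `k` has weighted
height `≲ 2^{-k(α+1)}`, so that integrating the `p`-th power produces exactly the Besov norm, while
`Ext f` itself is summable over the layers because `α > -1` (`exists_eLpNorm_le_besovNorm`,
`IsWhitneyFamily.exists_bounded`).

**Trace of the extension.** At a Lebesgue point `y` of `f` the extension converges to `f y` along
the vertical line, being near the boundary a convex combination of averages of `f` over cubes close
to `y` (`IsWhitneyFamily.ae_tendsto_whitneyExt`). It also converges to its trace along almost every
vertical line, hence the two agree (`IsWhitneyFamily.ae_trace_whitneyExt`).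

**Whitney families.** They are products of differences of smooth steps, one in each horizontal
coordinate and one in the height, so that the sum over all cubes telescopes (`finsum_whitneyBump`,
`exists_isWhitneyFamily`).
-/

namespace WhitneyTrace

/-! ### Product coordinates on the half-space -/

section HalfSpace

/-- The identification of `ℝᵈ × ℝ` with `ℝ^{d+1}`, the real factor being the last coordinate. -/
noncomputable def glue {d : ℕ} : Eucl d × ℝ ≃ᵐ Eucl (d + 1) :=
  (MeasurableEquiv.prodCongr (MeasurableEquiv.toLp 2 (Fin d → ℝ)).symm
    (MeasurableEquiv.refl ℝ)).trans (MeasurableEquiv.prodComm.trans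
      ((MeasurableEquiv.piFinSuccAbove (fun _ : Fin (d + 1) => ℝ) (Fin.last d)).symm.trans
        (MeasurableEquiv.toLp 2 (Fin (d + 1) → ℝ))))

variable {d : ℕ}

theorem glue_last (z : Eucl d × ℝ) : glue z (Fin.last d) = z.2 := by
  simp [glue, MeasurableEquiv.piFinSuccAbove_symm_apply]
  rfl

theorem glue_castSucc (z : Eucl d × ℝ) (i : Fin d) : glue z i.castSucc = z.1 i := by
  simp [glue, MeasurableEquiv.piFinSuccAbove_symm_apply]
  rfl

theorem horizontal_glue (z : Eucl d × ℝ) : horizontal (glue z) = z.1 := by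
  ext i
  simp [horizontal, glue_castSucc]

theorem glue_horizontal (x : Eucl (d + 1)) : glue (horizontal x, x (Fin.last d)) = x := by
  ext i
  refine Fin.lastCases ?_ (fun i => ?_) i
  · rw [glue_last]
  · rw [glue_castSucc]; rfl

theorem glue_ext {x x' : Eucl (d + 1)} (h1 : ∀ i : Fin d, x i.castSucc = x' i.castSucc)
    (h2 : x (Fin.last d) = x' (Fin.last d)) : x = x' := by
  ext i
  exact Fin.lastCases h2 h1 i

theorem boundaryPoint_eq_glue (y : Eucl d) : boundaryPoint y = glue (y, 0) := by
  apply glue_ext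
  · intro i; rw [glue_castSucc]; simp [boundaryPoint]
  · rw [glue_last]; simp [boundaryPoint]

theorem glue_add (y h : Eucl d) (t u : ℝ) : glue (y + h, t + u) = glue (y, t) + glue (h, u) := by
  apply glue_ext
  · intro i; simp [glue_castSucc]
  · simp [glue_last]

theorem glue_smul (s : ℝ) (y : Eucl d) (t : ℝ) : glue (s • y, s * t) = s • glue (y, t) := by
  apply glue_ext
  · intro i; simp [glue_castSucc]
  · simp [glue_last]

theorem dist_glue_sq (z z' : Eucl d × ℝ) :
    dist (glue z) (glue z') ^ 2 = dist z.1 z'.1 ^ 2 + dist z.2 z'.2 ^ 2 := by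
  rw [EuclideanSpace.dist_eq, EuclideanSpace.dist_eq, Real.sq_sqrt (by positivity),
    Real.sq_sqrt (by positivity), Fin.sum_univ_castSucc]
  simp [glue_last, glue_castSucc]

theorem glue_mem_halfSpace (z : Eucl d × ℝ) : glue z ∈ halfSpace d ↔ 0 < z.2 := by
  simp [halfSpace, glue_last]

theorem isOpen_halfSpace : IsOpen (halfSpace d) :=
  isOpen_lt continuous_const (by fun_prop)

theorem measurableSet_halfSpace : MeasurableSet (halfSpace d) :=
  isOpen_halfSpace.measurableSet

theorem measurePreserving_glue :
    MeasurePreserving (glue (d := d)) (volume.prod volume) volume := by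
  have h1 : MeasurePreserving (MeasurableEquiv.prodCongr (MeasurableEquiv.toLp 2 (Fin d → ℝ)).symm
      (MeasurableEquiv.refl ℝ)) (volume.prod volume) (volume.prod volume) :=
    (EuclideanSpace.volume_preserving_symm_measurableEquiv_toLp (Fin d)).prod
      (MeasurePreserving.id _)
  have h2 : MeasurePreserving (MeasurableEquiv.prodComm (α := Fin d → ℝ) (β := ℝ))
      (volume.prod volume) (volume.prod volume) := Measure.measurePreserving_swap
  have h3 := (volume_preserving_piFinSuccAbove (fun _ : Fin (d + 1) => ℝ) (Fin.last d)).symm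
  have h4 := (EuclideanSpace.volume_preserving_symm_measurableEquiv_toLp (Fin (d + 1))).symm
  exact h4.comp (h3.comp (h2.comp h1))

theorem measurePreserving_glue_halfSpace :
    MeasurePreserving (glue (d := d)) (volume.prod (volume.restrict (Ioi (0 : ℝ))))
      (volume.restrict (halfSpace d)) := by
  have h := (measurePreserving_glue (d := d)).restrict_preimage measurableSet_halfSpace
  have h2 : glue ⁻¹' (halfSpace d) = (univ : Set (Eucl d)) ×ˢ Ioi (0 : ℝ) := by
    ext z; simp [glue_mem_halfSpace]
  rwa [h2, ← Measure.prod_restrict, Measure.restrict_univ] at h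

theorem lintegral_halfSpace {F : Eucl (d + 1) → ℝ≥0∞}
    (hF : AEMeasurable F (volume.restrict (halfSpace d))) :
    ∫⁻ x in halfSpace d, F x = ∫⁻ y : Eucl d, ∫⁻ t in Ioi (0 : ℝ), F (glue (y, t)) := by
  rw [← measurePreserving_glue_halfSpace.lintegral_comp_emb glue.measurableEmbedding,
    lintegral_prod (fun z => F (glue z)) (AEMeasurable.comp_quasiMeasurePreserving hF
      measurePreserving_glue_halfSpace.quasiMeasurePreserving)]

theorem ae_halfSpace_iff {P : Eucl (d + 1) → Prop} :
    (∀ᵐ x ∂(volume.restrict (halfSpace d)), P x) ↔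
      ∀ᵐ z ∂((volume : Measure (Eucl d)).prod (volume.restrict (Ioi (0 : ℝ)))), P (glue z) := by
  rw [← measurePreserving_glue_halfSpace.map_eq, glue.measurableEmbedding.ae_map_iff]

/-! ### The weight -/

/-- The weight `min(1, |t|)^α`, as a function of the distance `t` to the boundary. -/
noncomputable def weight (α t : ℝ) : ℝ≥0∞ := ENNReal.ofReal ((min 1 |t|) ^ α)

theorem measurable_weight (α : ℝ) : Measurable (weight α) := by
  unfold weight; fun_prop

theorem weightMeasure_eq (α : ℝ) : weightMeasure d α =
    (volume.restrict (halfSpace d)).withDensity (fun x => weight α (x (Fin.last d))) := rfl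

theorem measurable_weight_last (α : ℝ) :
    Measurable (fun x : Eucl (d + 1) => weight α (x (Fin.last d))) :=
  (measurable_weight α).comp (by fun_prop)

theorem weightMeasure_absolutelyContinuous (α : ℝ) :
    weightMeasure d α ≪ volume.restrict (halfSpace d) :=
  withDensity_absolutelyContinuous _ _

theorem weight_of_mem_Ioc {α t : ℝ} (ht : t ∈ Ioc (0 : ℝ) 1) :
    weight α t = ENNReal.ofReal (t ^ α) := by
  rw [weight, abs_of_pos ht.1, min_eq_right ht.2]

theorem weight_of_one_le {α t : ℝ} (ht : 1 ≤ t) : weight α t = 1 := by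
  rw [weight, abs_of_pos (by linarith), min_eq_left ht]; simp

theorem lintegral_weightMeasure {α : ℝ} {F : Eucl (d + 1) → ℝ≥0∞}
    (hF : AEMeasurable F (volume.restrict (halfSpace d))) :
    ∫⁻ x, F x ∂(weightMeasure d α) =
      ∫⁻ y : Eucl d, ∫⁻ t in Ioi (0 : ℝ), weight α t * F (glue (y, t)) := by
  rw [weightMeasure_eq, lintegral_withDensity_eq_lintegral_mul₀
    (measurable_weight_last α).aemeasurable hF,
    lintegral_halfSpace ((measurable_weight_last α).aemeasurable.mul hF)]
  simp [glue_last]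

end HalfSpace

/-! ### Jensen and Hardy inequalities -/

/-- Jensen's inequality for a finite measure which need not be normalized. -/
theorem lintegral_rpow_le {X : Type*} [MeasurableSpace X] {ν : Measure X} {p : ℝ} (hp : 1 ≤ p)
    {a : X → ℝ≥0∞} (ha : AEMeasurable a ν) :
    (∫⁻ x, a x ∂ν) ^ p ≤ ν univ ^ (p - 1) * ∫⁻ x, a x ^ p ∂ν := by
  have hp0 : 0 < p := by linarith
  have h := eLpNorm_le_eLpNorm_mul_rpow_measure_univ (μ := ν) (f := a) (p := 1)
    (q := ENNReal.ofReal p) (by simpa using hp) ha.aestronglyMeasurable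
  rw [eLpNorm_one_eq_lintegral_enorm, eLpNorm_eq_lintegral_rpow_enorm_toReal (by simpa using hp0)
    ENNReal.ofReal_ne_top, ENNReal.toReal_ofReal hp0.le] at h
  simp only [enorm_eq_self, ENNReal.toReal_one] at h
  have h2 := ENNReal.rpow_le_rpow h hp0.le
  rw [ENNReal.mul_rpow_of_nonneg _ _ hp0.le, ← ENNReal.rpow_mul, ← ENNReal.rpow_mul,
    one_div_mul_cancel hp0.ne', ENNReal.rpow_one, mul_comm] at h2
  convert h2 using 3
  field_simp

theorem lintegral_ofReal_rpow_Ioo {r β : ℝ} (hr : 0 < r) (hβ : -1 < β) :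
    ∫⁻ t in Ioo (0 : ℝ) r, ENNReal.ofReal (t ^ β) = ENNReal.ofReal (r ^ (β + 1) / (β + 1)) := by
  rw [← ofReal_integral_eq_lintegral_ofReal
    ((intervalIntegral.integrableOn_Ioo_rpow_iff hr).2 hβ)]
  · rw [← integral_Ioc_eq_integral_Ioo, ← intervalIntegral.integral_of_le hr.le,
      integral_rpow (Or.inl hβ), Real.zero_rpow (by linarith), sub_zero]
  · filter_upwards [ae_restrict_mem measurableSet_Ioo] with t ht
    exact Real.rpow_nonneg ht.1.le _

/-- Jensen's inequality for the measure `t^{-γ} dt` on `(0, r)`. -/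
theorem lintegral_Ioo_rpow_le {p γ r : ℝ} (hp : 1 ≤ p) (hγ : γ < 1) (hr : 0 < r) {a : ℝ → ℝ≥0∞}
    (ha : Measurable a) :
    (∫⁻ t in Ioo (0 : ℝ) r, a t) ^ p ≤
      ENNReal.ofReal (r ^ (1 - γ) / (1 - γ)) ^ (p - 1) *
        ∫⁻ t in Ioo (0 : ℝ) r, a t ^ p * ENNReal.ofReal (t ^ (γ * (p - 1))) := by
  set ν : Measure ℝ := (volume.restrict (Ioo (0 : ℝ) r)).withDensity
    (fun t => ENNReal.ofReal (t ^ (-γ))) with hν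
  have hm : Measurable (fun t : ℝ => ENNReal.ofReal (t ^ (-γ))) := by fun_prop
  have hm2 : Measurable (fun t : ℝ => ENNReal.ofReal (t ^ γ)) := by fun_prop
  have h := lintegral_rpow_le (ν := ν) hp (a := fun t => a t * ENNReal.ofReal (t ^ γ))
    (ha.mul hm2).aemeasurable
  have hu : ν univ = ENNReal.ofReal (r ^ (1 - γ) / (1 - γ)) := by
    rw [hν, withDensity_apply _ MeasurableSet.univ, Measure.restrict_univ,
      lintegral_ofReal_rpow_Ioo hr (by linarith)]
    rw [neg_add_eq_sub]
  rw [hu, hν, lintegral_withDensity_eq_lintegral_mul _ hm (by fun_prop),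
    lintegral_withDensity_eq_lintegral_mul _ hm (by fun_prop)] at h
  convert h using 2
  · refine setLIntegral_congr_fun measurableSet_Ioo (fun t ht => ?_)
    simp only [Pi.mul_apply]
    rw [mul_left_comm, ← ENNReal.ofReal_mul (Real.rpow_nonneg ht.1.le _), ← Real.rpow_add ht.1]
    simp
  · refine setLIntegral_congr_fun measurableSet_Ioo (fun t ht => ?_)
    simp only [Pi.mul_apply]
    rw [ENNReal.mul_rpow_of_nonneg _ _ (by linarith), mul_left_comm,
      ENNReal.ofReal_rpow_of_pos (Real.rpow_pos_of_pos ht.1 _), ← Real.rpow_mul ht.1.le,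
      ← ENNReal.ofReal_mul (Real.rpow_nonneg ht.1.le _), ← Real.rpow_add ht.1]
    congr 3
    ring

/-- An incomplete geometric series is dominated by its largest term. -/
theorem sum_range_two_rpow_le {ε t : ℝ} (hε : 0 < ε) (ht : 0 < t) (n : ℕ) :
    ∑ k ∈ Finset.range n, (if t < (2 : ℝ) ^ (-(k : ℝ)) then (2 : ℝ) ^ ((k : ℝ) * ε) else 0) ≤
      2 ^ ε / (2 ^ ε - 1) * t ^ (-ε) := by
  have hq : 1 < (2 : ℝ) ^ ε := Real.one_lt_rpow (by norm_num) hε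
  have hq' : 0 < (2 : ℝ) ^ ε - 1 := by linarith
  induction n with
  | zero => simp; positivity
  | succ n ih =>
    by_cases h : t < (2 : ℝ) ^ (-(n : ℝ))
    · have h1 : ∑ k ∈ Finset.range (n + 1),
          (if t < (2 : ℝ) ^ (-(k : ℝ)) then (2 : ℝ) ^ ((k : ℝ) * ε) else 0) ≤
          ∑ k ∈ Finset.range (n + 1), ((2 : ℝ) ^ ε) ^ k := by
        refine Finset.sum_le_sum (fun k _ => ?_)
        have : (2 : ℝ) ^ ((k : ℝ) * ε) = ((2 : ℝ) ^ ε) ^ k := by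
          rw [mul_comm, Real.rpow_mul (by norm_num), Real.rpow_natCast]
        split_ifs
        · exact this.le
        · positivity
      refine h1.trans ?_
      rw [geom_sum_eq hq.ne']
      have h2 : ((2 : ℝ) ^ ε) ^ n ≤ t ^ (-ε) := by
        have : ((2 : ℝ) ^ ε) ^ n = ((2 : ℝ) ^ (-(n : ℝ))) ^ (-ε) := by
          rw [← Real.rpow_natCast, ← Real.rpow_mul (by norm_num), ← Real.rpow_mul (by norm_num)]
          congr 1; ring
        rw [this]
        exact Real.rpow_le_rpow_of_nonpos ht h.le (by linarith)
      rw [div_mul_eq_mul_div]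
      gcongr
      rw [pow_succ]
      nlinarith
    · rw [Finset.sum_range_succ, if_neg h, add_zero]
      exact ih

/-- A dyadic form of Hardy's inequality. For every `k` the `p`-th power is moved inside the integral
by Jensen's inequality for the measure `t^{-γ} dt`, with `γ < 1` so close to `1` that the remaining
sum over `k` is a geometric series dominated by its largest term. -/
theorem exists_hardy {p α : ℝ} (hp : 1 ≤ p) (hαp : α < p - 1) :
    ∃ C : ℝ≥0, ∀ a : ℝ → ℝ≥0∞, Measurable a →
      ∑' k : ℕ, ENNReal.ofReal ((2 : ℝ) ^ ((k : ℝ) * (p - 1 - α))) *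
        (∫⁻ t in Ioo (0 : ℝ) ((2 : ℝ) ^ (-(k : ℝ))), a t) ^ p ≤
      C * ∫⁻ t in Ioo (0 : ℝ) 1, a t ^ p * ENNReal.ofReal (t ^ α) := by
  obtain ⟨γ, hγ, hγα⟩ : ∃ γ : ℝ, γ < 1 ∧ α < γ * (p - 1) := by
    rcases hp.eq_or_lt with rfl | hp1
    · exact ⟨0, by norm_num, by linarith⟩
    · have h : 0 < p - 1 := by linarith
      refine ⟨(α / (p - 1) + 1) / 2, ?_, ?_⟩
      · have := (div_lt_one h).2 hαp
        linarith
      · have : (α / (p - 1) + 1) / 2 * (p - 1) = (α + (p - 1)) / 2 := by field_simp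
        rw [this]; linarith
  -- the surplus in the exponent, which makes the sum over `k` geometric
  set ε := γ * (p - 1) - α with hεdef
  have hε : 0 < ε := by simp only [hεdef]; linarith
  have hq : 1 < (2 : ℝ) ^ ε := Real.one_lt_rpow (by norm_num) hε
  set A : ℝ≥0 := Real.toNNReal ((1 - γ)⁻¹ ^ (p - 1))
  set B : ℝ≥0 := Real.toNNReal (2 ^ ε / (2 ^ ε - 1))
  refine ⟨A * B, fun a ha => ?_⟩
  have step : ∀ k : ℕ, ENNReal.ofReal ((2 : ℝ) ^ ((k : ℝ) * (p - 1 - α))) *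
        (∫⁻ t in Ioo (0 : ℝ) ((2 : ℝ) ^ (-(k : ℝ))), a t) ^ p ≤
      A * ∫⁻ t in Ioo (0 : ℝ) 1, (a t ^ p * ENNReal.ofReal (t ^ (γ * (p - 1)))) *
        ENNReal.ofReal (if t < (2 : ℝ) ^ (-(k : ℝ)) then (2 : ℝ) ^ ((k : ℝ) * ε) else 0) := by
    intro k
    have hr : (0 : ℝ) < (2 : ℝ) ^ (-(k : ℝ)) := by positivity
    have hr1 : (2 : ℝ) ^ (-(k : ℝ)) ≤ 1 := by
      apply Real.rpow_le_one_of_one_le_of_nonpos (by norm_num); simp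
    have h := lintegral_Ioo_rpow_le hp hγ hr ha
    have e1 : ENNReal.ofReal ((2 : ℝ) ^ ((k : ℝ) * (p - 1 - α))) *
        ENNReal.ofReal (((2 : ℝ) ^ (-(k : ℝ))) ^ (1 - γ) / (1 - γ)) ^ (p - 1) =
        A * ENNReal.ofReal ((2 : ℝ) ^ ((k : ℝ) * ε)) := by
      have h1γ : 0 < 1 - γ := by linarith
      change _ = ENNReal.ofReal _ * _
      rw [ENNReal.ofReal_rpow_of_pos (by positivity), ← ENNReal.ofReal_mul (by positivity),
        ← ENNReal.ofReal_mul (by positivity), div_eq_mul_inv,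
        Real.mul_rpow (by positivity) (by positivity), ← mul_assoc, mul_comm]
      congr 2
      rw [← Real.rpow_mul (by norm_num), ← Real.rpow_mul (by norm_num),
        ← Real.rpow_add (by norm_num)]
      congr 1
      simp only [hεdef]; ring
    calc _ ≤ ENNReal.ofReal ((2 : ℝ) ^ ((k : ℝ) * (p - 1 - α))) *
          (ENNReal.ofReal (((2 : ℝ) ^ (-(k : ℝ))) ^ (1 - γ) / (1 - γ)) ^ (p - 1) *
          ∫⁻ t in Ioo (0 : ℝ) ((2 : ℝ) ^ (-(k : ℝ))), a t ^ p *
            ENNReal.ofReal (t ^ (γ * (p - 1)))) := by gcongr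
      _ = A * (ENNReal.ofReal ((2 : ℝ) ^ ((k : ℝ) * ε)) *
          ∫⁻ t in Ioo (0 : ℝ) ((2 : ℝ) ^ (-(k : ℝ))), a t ^ p *
            ENNReal.ofReal (t ^ (γ * (p - 1)))) := by rw [← mul_assoc, e1, mul_assoc]
      _ ≤ _ := by
        rw [← lintegral_const_mul _ (by fun_prop)]
        refine mul_le_mul_right ?_ _
        rw [← lintegral_indicator measurableSet_Ioo, ← lintegral_indicator measurableSet_Ioo]
        refine lintegral_mono (fun t => ?_)
        by_cases ht : t ∈ Ioo (0 : ℝ) ((2 : ℝ) ^ (-(k : ℝ)))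
        · rw [indicator_of_mem ht, indicator_of_mem (show t ∈ Ioo (0:ℝ) 1 from
            ⟨ht.1, ht.2.trans_le hr1⟩), if_pos ht.2, mul_comm]
        · rw [indicator_of_notMem ht]; exact zero_le
  have hm : ∀ k : ℕ, Measurable (fun t : ℝ => (a t ^ p * ENNReal.ofReal (t ^ (γ * (p - 1)))) *
      ENNReal.ofReal (if t < (2 : ℝ) ^ (-(k : ℝ)) then (2 : ℝ) ^ ((k : ℝ) * ε) else 0)) := by
    intro k
    refine (by fun_prop : Measurable (fun t => a t ^ p * ENNReal.ofReal (t ^ (γ * (p - 1))))).mul ?_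
    exact (Measurable.ite measurableSet_Iio measurable_const measurable_const).ennreal_ofReal
  refine (ENNReal.tsum_le_tsum step).trans ?_
  rw [ENNReal.tsum_mul_left, ENNReal.coe_mul, mul_assoc, ← lintegral_tsum,
    ← lintegral_const_mul (B : ℝ≥0∞) (by fun_prop)]
  · refine mul_le_mul_right ?_ _
    refine setLIntegral_mono (by fun_prop) (fun t ht => ?_)
    rw [ENNReal.tsum_mul_left]
    have : ∑' k : ℕ, ENNReal.ofReal
        (if t < (2 : ℝ) ^ (-(k : ℝ)) then (2 : ℝ) ^ ((k : ℝ) * ε) else 0) ≤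
        B * ENNReal.ofReal (t ^ (-ε)) := by
      refine ENNReal.tsum_le_of_sum_range_le (fun n => ?_)
      rw [← ENNReal.ofReal_sum_of_nonneg (fun k _ => by split_ifs <;> positivity)]
      change _ ≤ ENNReal.ofReal _ * _
      rw [← ENNReal.ofReal_mul (div_nonneg (by positivity) (by linarith))]
      exact ENNReal.ofReal_le_ofReal (sum_range_two_rpow_le hε ht.1 n)
    calc _ ≤ a t ^ p * ENNReal.ofReal (t ^ (γ * (p - 1))) * (B * ENNReal.ofReal (t ^ (-ε))) := by
          gcongr
      _ = B * (a t ^ p * (ENNReal.ofReal (t ^ (γ * (p - 1))) * ENNReal.ofReal (t ^ (-ε)))) := by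
        ring
      _ = _ := by
        rw [← ENNReal.ofReal_mul (Real.rpow_nonneg ht.1.le _), ← Real.rpow_add ht.1]
        congr 4
        simp only [hεdef]; ring
  · exact fun k => (hm k).aemeasurable

/-! ### Weak derivatives and translations -/

section Translation

variable {n : ℕ}

theorem locallyIntegrable_comp_add {F : Type*} [NormedAddCommGroup F] {f : Eucl n → F}
    (hf : LocallyIntegrable f volume) (v : Eucl n) :
    LocallyIntegrable (fun x => f (x + v)) volume := by
  rw [locallyIntegrable_iff]
  intro K hK
  have hmp := measurePreserving_add_right (volume : Measure (Eucl n)) v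
  have h := (hmp.integrableOn_comp_preimage (measurableEmbedding_addRight v) (f := f)
    (s := (fun x => x + v) '' K)).2
    (hf.integrableOn_isCompact (hK.image (by fun_prop)))
  exact h.mono_set (subset_preimage_image _ _)

/-- Integrability of `(x, s) ↦ b (x + s v)` on a bounded set times `(0, 1]`. -/
theorem integrable_segment {F : Type*} [NormedAddCommGroup F] {b : Eucl n → F}
    (hb : LocallyIntegrable b volume) (hbm : StronglyMeasurable b) (v : Eucl n) (R : ℝ) :
    Integrable (fun z : Eucl n × ℝ => b (z.1 + z.2 • v))
      ((volume.restrict (Metric.closedBall 0 R)).prod (volume.restrict (Ioc (0 : ℝ) 1))) := by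
  have hm : StronglyMeasurable (fun z : Eucl n × ℝ => b (z.1 + z.2 • v)) :=
    hbm.comp_measurable (by fun_prop)
  refine ⟨hm.aestronglyMeasurable, ?_⟩
  rw [HasFiniteIntegral, lintegral_prod_symm _ hm.enorm.aemeasurable]
  set M : ℝ≥0∞ := ∫⁻ x in Metric.closedBall (0 : Eucl n) (R + ‖v‖), ‖b x‖ₑ
  have hM : M < ⊤ := (hb.integrableOn_isCompact (isCompact_closedBall _ _)).2
  have : ∀ s ∈ Ioc (0 : ℝ) 1, ∫⁻ x in Metric.closedBall (0 : Eucl n) R, ‖b (x + s • v)‖ₑ ≤ M := by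
    intro s hs
    have h1 : Metric.closedBall (0 : Eucl n) R ⊆
        (fun x => x + s • v) ⁻¹' Metric.closedBall (0 : Eucl n) (R + ‖v‖) := by
      intro x hx
      simp only [mem_preimage, Metric.mem_closedBall, dist_zero_right] at hx ⊢
      refine (norm_add_le _ _).trans (add_le_add hx ?_)
      rw [norm_smul, Real.norm_of_nonneg hs.1.le]
      exact mul_le_of_le_one_left (norm_nonneg _) hs.2
    refine (lintegral_mono_set h1).trans (le_of_eq ?_)
    exact (measurePreserving_add_right (volume : Measure (Eucl n))
      (s • v)).setLIntegral_comp_preimage Metric.isClosed_closedBall.measurableSet hbm.enorm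
  calc _ ≤ ∫⁻ s in Ioc (0 : ℝ) 1, M := setLIntegral_mono measurable_const this
    _ < ⊤ := by simpa using hM

/-- If `b` is the weak derivative of `f` in the direction `v` on an open set which is stable under
translation by nonnegative multiples of `v`, then `f (x + v) - f x` is, almost everywhere, the
integral of `b` over the segment from `x` to `x + v`. The proof is by duality: for a test function
`φ` the function `s ↦ ∫ φ (x - s v) f x dx` is differentiable, and its derivative is
`∫ φ (x - s v) b x dx`. -/
theorem ae_sub_eq_integral_segment {f b : Eucl n → ℂ} {v : Eucl n} {U : Set (Eucl n)}
    (hU : IsOpen U) (hUv : ∀ x ∈ U, ∀ s : ℝ, 0 ≤ s → x + s • v ∈ U)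
    (hf : LocallyIntegrable f volume) (hb : LocallyIntegrable b volume) (hbm : StronglyMeasurable b)
    (hw : ∀ φ : Eucl n → ℝ, ContDiff ℝ ∞ φ → HasCompactSupport φ → tsupport φ ⊆ U →
      ∫ x, (fderiv ℝ φ x v) • f x = -∫ x, φ x • b x) :
    ∀ᵐ x, x ∈ U → f (x + v) - f x - ∫ s in (0 : ℝ)..1, b (x + s • v) = 0 := by
  have hG : ∀ R : ℝ, IntegrableOn (fun x => ∫ s in (0 : ℝ)..1, b (x + s • v))
      (Metric.closedBall 0 R) volume := by
    intro R
    simp_rw [intervalIntegral.integral_of_le zero_le_one]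
    exact (integrable_segment hb hbm v R).integral_prod_left
  have hGl : LocallyIntegrable (fun x => ∫ s in (0 : ℝ)..1, b (x + s • v)) volume := by
    rw [locallyIntegrable_iff]
    intro K hK
    obtain ⟨R, hR⟩ := hK.isBounded.subset_closedBall 0
    exact (hG R).mono_set hR
  have hfv := locallyIntegrable_comp_add hf v
  refine hU.ae_eq_zero_of_integral_contDiff_smul_eq_zero
    (((hfv.sub hf).sub hGl).locallyIntegrableOn U) (fun φ hφ hφc hφU => ?_)
  have hi1 := hfv.integrable_smul_left_of_hasCompactSupport hφ.continuous hφc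
  have hi2 := hf.integrable_smul_left_of_hasCompactSupport hφ.continuous hφc
  have hi3 := hGl.integrable_smul_left_of_hasCompactSupport hφ.continuous hφc
  have e0 : ∫ x, φ x • (f (x + v) - f x - ∫ s in (0 : ℝ)..1, b (x + s • v)) =
      (∫ x, φ x • f (x + v)) - (∫ x, φ x • f x) -
        ∫ x, φ x • ∫ s in (0 : ℝ)..1, b (x + s • v) := by
    simp_rw [smul_sub]
    rw [← integral_sub hi1 hi2]
    exact integral_sub (hi1.sub hi2) hi3
  rw [e0, sub_eq_zero]
  -- the pairing of `f` with the translates of `φ`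
  set L : ℂ →L[ℝ] ℝ →L[ℝ] ℂ := (ContinuousLinearMap.lsmul ℝ ℝ).flip
  set ψ : Eucl n → ℝ := fun x => φ (-x) with hψ
  have hψs : ContDiff ℝ ∞ ψ := hφ.comp contDiff_neg
  have hψc : HasCompactSupport ψ := hφc.comp_homeomorph (Homeomorph.neg _)
  set u : ℝ → ℂ := fun s => ∫ x, φ (x - s • v) • f x with hu
  have hconv : ∀ s : ℝ, u s = convolution f ψ L volume (s • v) := by
    intro s
    simp only [hu, convolution_def, hψ, L, ContinuousLinearMap.flip_apply,
      ContinuousLinearMap.lsmul_apply, neg_sub]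
  have hder : ∀ s : ℝ, 0 ≤ s → HasDerivAt u (∫ x, φ (x - s • v) • b x) s := by
    intro s hs
    have h1 := hψc.hasFDerivAt_convolution_right L hf (hψs.of_le (by simp)) (s • v)
    have h2 : HasDerivAt (fun s : ℝ => s • v) v s := by
      simpa using (hasDerivAt_id s).smul_const v
    have h3 := h1.comp_hasDerivAt s h2
    have h4 : (convolution f (fderiv ℝ ψ) (ContinuousLinearMap.precompR (Eucl n) L) volume
        (s • v)) v
        = ∫ x, φ (x - s • v) • b x := by
      rw [convolution_precompR_apply L hf (hψc.fderiv ℝ) (hψs.continuous_fderiv (by simp)),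
        convolution_def]
      set φs : Eucl n → ℝ := fun x => φ (x - s • v)
      have hφs : ContDiff ℝ ∞ φs := hφ.comp (contDiff_id.sub contDiff_const)
      have hφsc : HasCompactSupport φs := hφc.comp_homeomorph (Homeomorph.subRight (s • v))
      have hφsU : tsupport φs ⊆ U := by
        intro x hx
        have := tsupport_comp_subset_preimage φ (f := fun x => x - s • v) (by fun_prop) hx
        have h5 := hUv _ (hφU this) s hs
        simpa using h5
      rw [← neg_eq_iff_eq_neg.2 (hw φs hφs hφsc hφsU), ← integral_neg]
      congr 1
      ext x
      simp only [L, ContinuousLinearMap.flip_apply, ContinuousLinearMap.lsmul_apply]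
      rw [← neg_smul]
      congr 1
      have d1 : HasFDerivAt ψ ((fderiv ℝ φ (-(s • v - x))).comp
          (-ContinuousLinearMap.id ℝ (Eucl n))) (s • v - x) :=
        ((hφ.differentiable (by simp)) _).hasFDerivAt.comp _ (hasFDerivAt_id _).neg
      have d2 : HasFDerivAt φs ((fderiv ℝ φ (x - s • v)).comp
          (ContinuousLinearMap.id ℝ (Eucl n))) x :=
        ((hφ.differentiable (by simp)) _).hasFDerivAt.comp _ ((hasFDerivAt_id _).sub_const _)
      rw [d1.fderiv, d2.fderiv]
      simp
    rw [← h4]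
    exact h3.congr_of_eventuallyEq (Eventually.of_forall hconv)
  have hshift : ∀ s : ℝ, ∫ x, φ (x - s • v) • b x = ∫ x, φ x • b (x + s • v) := by
    intro s
    rw [← integral_add_right_eq_self _ (s • v)]
    simp
  obtain ⟨R, hR⟩ := hφc.isCompact.isBounded.subset_closedBall 0
  obtain ⟨M, hM⟩ := hφ.continuous.bounded_above_of_compact_support hφc
  have hφ0 : ∀ x ∉ Metric.closedBall (0 : Eucl n) R, φ x = 0 := fun x hx =>
    image_eq_zero_of_notMem_tsupport (fun h => hx (hR h))
  have hprod : Integrable (fun z : Eucl n × ℝ => φ z.1 • b (z.1 + z.2 • v))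
      ((volume.restrict (Metric.closedBall 0 R)).prod (volume.restrict (Ioc (0 : ℝ) 1))) := by
    refine Integrable.bdd_smul (φ := fun z : Eucl n × ℝ => φ z.1) (integrable_segment hb hbm v R) M
      ?_ ?_
    · exact (hφ.continuous.comp continuous_fst).aestronglyMeasurable
    · exact Eventually.of_forall (fun z => hM z.1)
  have hball : ∀ s : ℝ, ∫ x in Metric.closedBall (0 : Eucl n) R, φ x • b (x + s • v) =
      ∫ x, φ x • b (x + s • v) := fun s =>
    setIntegral_eq_integral_of_forall_compl_eq_zero (fun x hx => by simp [hφ0 x hx])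
  have hFTC : ∫ s in (0 : ℝ)..1, (∫ x, φ (x - s • v) • b x) = u 1 - u 0 := by
    refine intervalIntegral.integral_eq_sub_of_hasDerivAt (fun s hs => ?_) ?_
    · rw [uIcc_of_le zero_le_one] at hs
      exact hder s hs.1
    · rw [intervalIntegrable_iff_integrableOn_Ioc_of_le zero_le_one]
      simp_rw [hshift, ← hball]
      exact hprod.integral_prod_right
  have hu1 : u 1 = ∫ x, φ x • f (x + v) := by
    simp only [hu, one_smul]
    rw [← integral_add_right_eq_self _ v]
    simp
  have hu0 : u 0 = ∫ x, φ x • f x := by simp [hu]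
  rw [← hu1, ← hu0, ← hFTC]
  simp_rw [hshift, ← hball]
  rw [← setIntegral_eq_integral_of_forall_compl_eq_zero (s := Metric.closedBall 0 R)
    (fun x hx => by simp [hφ0 x hx])]
  simp_rw [intervalIntegral.integral_of_le zero_le_one]
  rw [← integral_integral_swap hprod]
  simp_rw [integral_smul]

end Translation

/-! ### Absolute continuity along vertical lines -/

section Representatives

variable {d : ℕ}

/-- A locally integrable function on the half-space together with a weak gradient, both represented
by measurable functions which vanish outside the half-space. -/
structure IsNormalPair (f : Eucl (d + 1) → ℂ)
    (g : Eucl (d + 1) → EuclideanSpace ℂ (Fin (d + 1))) : Prop where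
  measurable_fun : StronglyMeasurable f
  measurable_grad : StronglyMeasurable g
  fun_eq_zero : ∀ x ∉ halfSpace d, f x = 0
  grad_eq_zero : ∀ x ∉ halfSpace d, g x = 0
  locInt_fun : LocallyIntegrable f volume
  locInt_grad : LocallyIntegrable g volume
  isWeakGradient : IsWeakGradient f g

theorem LocIntegrableHalf.aestronglyMeasurable {F : Type*} [NormedAddCommGroup F]
    {f : Eucl (d + 1) → F} (hf : LocIntegrableHalf f) :
    AEStronglyMeasurable f (volume.restrict (halfSpace d)) := by
  have : halfSpace d = ⋃ n : ℕ, Metric.ball (0 : Eucl (d + 1)) n ∩ halfSpace d := by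
    rw [← iUnion_inter, Metric.iUnion_ball_nat, univ_inter]
  rw [this]
  exact AEStronglyMeasurable.iUnion (fun n => (hf _ Metric.isBounded_ball).1)

theorem LocIntegrableHalf.locallyIntegrable {F : Type*} [NormedAddCommGroup F]
    {f : Eucl (d + 1) → F} (hf : LocIntegrableHalf f) (h0 : ∀ x ∉ halfSpace d, f x = 0) :
    LocallyIntegrable f volume := by
  rw [locallyIntegrable_iff]
  intro K hK
  have h := (hf K hK.isBounded).integrable_indicator
    (hK.measurableSet.inter measurableSet_halfSpace)
  refine (h.integrableOn (s := K)).congr ?_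
  filter_upwards [ae_restrict_mem hK.measurableSet] with x hx
  by_cases hx2 : x ∈ halfSpace d
  · rw [indicator_of_mem (mem_inter hx hx2)]
  · rw [indicator_of_notMem (fun h => hx2 h.2), h0 x hx2]

theorem LocIntegrableHalf.congr {F : Type*} [NormedAddCommGroup F]
    {f f' : Eucl (d + 1) → F} (hf : LocIntegrableHalf f)
    (h : f =ᵐ[volume.restrict (halfSpace d)] f') : LocIntegrableHalf f' := by
  intro S hS
  exact (hf S hS).congr
    (ae_mono (Measure.restrict_mono inter_subset_right le_rfl) h)

theorem IsWeakGradient.congr {f f' : Eucl (d + 1) → ℂ}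
    {g g' : Eucl (d + 1) → EuclideanSpace ℂ (Fin (d + 1))} (h : IsWeakGradient f g)
    (hf : f =ᵐ[volume.restrict (halfSpace d)] f') (hg : g =ᵐ[volume.restrict (halfSpace d)] g') :
    IsWeakGradient f' g' := by
  refine ⟨h.1.congr hg, fun φ h1 h2 h3 i => ?_⟩
  have := h.2 φ h1 h2 h3 i
  have e1 : ∫ x in halfSpace d, (fderiv ℝ φ x (EuclideanSpace.single i (1 : ℝ))) • f x =
      ∫ x in halfSpace d, (fderiv ℝ φ x (EuclideanSpace.single i (1 : ℝ))) • f' x :=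
    integral_congr_ae (by filter_upwards [hf] with x hx; rw [hx])
  have e2 : ∫ x in halfSpace d, φ x • g x i = ∫ x in halfSpace d, φ x • g' x i :=
    integral_congr_ae (by filter_upwards [hg] with x hx; rw [hx])
  rwa [e1, e2] at this

/-- Changing `f` and its weak gradient on null sets, and outside the half-space, turns them into
a normal pair. -/
theorem exists_isNormalPair {f : Eucl (d + 1) → ℂ}
    {g : Eucl (d + 1) → EuclideanSpace ℂ (Fin (d + 1))} (hf : LocIntegrableHalf f)
    (h : IsWeakGradient f g) :
    ∃ f' g', IsNormalPair f' g' ∧ f =ᵐ[volume.restrict (halfSpace d)] f' ∧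
      g =ᵐ[volume.restrict (halfSpace d)] g' := by
  have key : ∀ {F : Type} [NormedAddCommGroup F] (u : Eucl (d + 1) → F)
      (hu : LocIntegrableHalf u), ∃ u' : Eucl (d + 1) → F, StronglyMeasurable u' ∧
        (∀ x ∉ halfSpace d, u' x = 0) ∧ u =ᵐ[volume.restrict (halfSpace d)] u' := by
    intro F _ u hu
    have hm := hu.aestronglyMeasurable
    refine ⟨(halfSpace d).indicator (hm.mk u),
      hm.stronglyMeasurable_mk.indicator measurableSet_halfSpace,
      fun x hx => indicator_of_notMem hx _, ?_⟩
    filter_upwards [hm.ae_eq_mk, ae_restrict_mem measurableSet_halfSpace] with x hx hx2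
    rw [indicator_of_mem hx2, hx]
  obtain ⟨f', m1, z1, e1⟩ := key f hf
  obtain ⟨g', m2, z2, e2⟩ := key g h.1
  exact ⟨f', g', ⟨m1, m2, z1, z2, (hf.congr e1).locallyIntegrable z1,
    (h.1.congr e2).locallyIntegrable z2, h.congr e1 e2⟩, e1, e2⟩

/-- The translation formula on the half-space, for vectors which do not point towards the boundary.
-/
theorem IsNormalPair.ae_translate {f : Eucl (d + 1) → ℂ}
    {g : Eucl (d + 1) → EuclideanSpace ℂ (Fin (d + 1))} (H : IsNormalPair f g)
    {v : Eucl (d + 1)} (hv : 0 ≤ v (Fin.last d)) :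
    ∀ᵐ x, x ∈ halfSpace d → f (x + v) - f x =
      ∫ s in (0 : ℝ)..1, ∑ i, v i • g (x + s • v) i := by
  have hbm : StronglyMeasurable (fun x => ∑ i, v i • g x i) := by
    refine Finset.stronglyMeasurable_fun_sum _ (fun i _ => ?_)
    exact ((EuclideanSpace.proj (𝕜 := ℂ) i).continuous.comp_stronglyMeasurable
      H.measurable_grad).const_smul (v i)
  have hgi : ∀ i, LocallyIntegrable (fun x => g x i) volume := fun i x => by
    obtain ⟨s, hs, h⟩ := H.locInt_grad x
    exact ⟨s, hs, (EuclideanSpace.proj (𝕜 := ℂ) i).integrable_comp h⟩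
  have hb : LocallyIntegrable (fun x => ∑ i, v i • g x i) volume := by
    rw [locallyIntegrable_iff]
    intro K hK
    exact integrable_finsetSum _ (fun i _ => ((hgi i).integrableOn_isCompact hK).smul (v i))
  have := ae_sub_eq_integral_segment (f := f) (b := fun x => ∑ i, v i • g x i) (v := v)
    isOpen_halfSpace (fun x hx s hs => ?_) H.locInt_fun hb hbm (fun φ h1 h2 h3 => ?_)
  · filter_upwards [this] with x hx hx2
    exact sub_eq_zero.1 (hx hx2)
  · have : 0 < x (Fin.last d) := hx
    simp only [halfSpace, mem_ofPred_eq, PiLp.add_apply, PiLp.smul_apply, smul_eq_mul]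
    positivity
  · have e : ∀ i, ∫ x, (fderiv ℝ φ x (EuclideanSpace.single i (1 : ℝ))) • f x =
        - ∫ x, φ x • g x i := by
      intro i
      have := H.isWeakGradient.2 φ h1 h2 h3 i
      rwa [setIntegral_eq_integral_of_forall_compl_eq_zero
          (fun x hx => by simp [H.fun_eq_zero x hx]),
        setIntegral_eq_integral_of_forall_compl_eq_zero
          (fun x hx => by simp [H.grad_eq_zero x hx])] at this
    have hv : v = ∑ i, v i • EuclideanSpace.single i (1 : ℝ) := by
      ext j; simp [Pi.single_apply]
    have l : ∀ x, (fderiv ℝ φ x v) • f x =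
        ∑ i, v i • ((fderiv ℝ φ x (EuclideanSpace.single i (1 : ℝ))) • f x) := by
      intro x
      conv_lhs => rw [hv]
      rw [map_sum, Finset.sum_smul]
      simp [mul_assoc]
    simp_rw [l, Finset.smul_sum]
    rw [integral_finsetSum, integral_finsetSum, ← Finset.sum_neg_distrib]
    · refine Finset.sum_congr rfl (fun i _ => ?_)
      rw [integral_smul, e i, smul_neg, ← integral_smul]
      simp_rw [smul_comm (v i)]
    · intro i _
      have := ((hgi i).integrable_smul_left_of_hasCompactSupport h1.continuous h2).smul (v i)
      simp_rw [smul_comm (φ _)]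
      exact this
    · intro i _
      refine Integrable.smul (v i) ?_
      refine H.locInt_fun.integrable_smul_left_of_hasCompactSupport ?_ ?_
      · exact (h1.continuous_fderiv (by simp)).clm_apply continuous_const
      · exact (h2.fderiv ℝ).comp_left (g := fun L : Eucl (d + 1) →L[ℝ] ℝ =>
          L (EuclideanSpace.single i (1 : ℝ))) (by simp)

/-- The measure on `ℝᵈ × (0, ∞)` corresponding to Lebesgue measure on the half-space. -/
noncomputable abbrev halfProd (d : ℕ) : Measure (Eucl d × ℝ) :=
  volume.prod (volume.restrict (Ioi (0 : ℝ)))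

theorem IsNormalPair.ae_translate_glue {f : Eucl (d + 1) → ℂ}
    {g : Eucl (d + 1) → EuclideanSpace ℂ (Fin (d + 1))} (H : IsNormalPair f g)
    {v : Eucl (d + 1)} (hv : 0 ≤ v (Fin.last d)) :
    ∀ᵐ z ∂(halfProd d), f (glue z + v) - f (glue z) =
      ∫ s in (0 : ℝ)..1, ∑ i, v i • g (glue z + s • v) i := by
  rw [← ae_halfSpace_iff (P := fun x => f (x + v) - f x =
      ∫ s in (0 : ℝ)..1, ∑ i, v i • g (x + s • v) i)]
  exact (ae_restrict_iff' measurableSet_halfSpace).2 (H.ae_translate hv)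

/-- The vertical derivative, in product coordinates. -/
noncomputable def vert (g : Eucl (d + 1) → EuclideanSpace ℂ (Fin (d + 1))) (z : Eucl d × ℝ) : ℂ :=
  g (glue z) (Fin.last d)

theorem enorm_vert_le (g : Eucl (d + 1) → EuclideanSpace ℂ (Fin (d + 1))) (z : Eucl d × ℝ) :
    ‖vert g z‖ₑ ≤ ‖g (glue z)‖ₑ := by
  rw [enorm_le_iff_norm_le]
  exact PiLp.norm_apply_le _ _

theorem IsNormalPair.stronglyMeasurable_vert {f : Eucl (d + 1) → ℂ}
    {g : Eucl (d + 1) → EuclideanSpace ℂ (Fin (d + 1))} (H : IsNormalPair f g) :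
    StronglyMeasurable (vert g) :=
  (EuclideanSpace.proj (𝕜 := ℂ) (Fin.last d)).continuous.comp_stronglyMeasurable
    (H.measurable_grad.comp_measurable glue.measurable)

theorem IsNormalPair.measurable_enorm_grad {f : Eucl (d + 1) → ℂ}
    {g : Eucl (d + 1) → EuclideanSpace ℂ (Fin (d + 1))} (H : IsNormalPair f g) :
    Measurable (fun z : Eucl d × ℝ => ‖g (glue z)‖ₑ) :=
  (H.measurable_grad.comp_measurable glue.measurable).enorm

theorem IsNormalPair.ae_vertical {f : Eucl (d + 1) → ℂ}
    {g : Eucl (d + 1) → EuclideanSpace ℂ (Fin (d + 1))} (H : IsNormalPair f g)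
    {τ : ℝ} (hτ : 0 ≤ τ) :
    ∀ᵐ z ∂(halfProd d), f (glue (z.1, z.2 + τ)) - f (glue z) =
      ∫ s in z.2..(z.2 + τ), vert g (z.1, s) := by
  have h := H.ae_translate_glue (v := glue (0, τ)) (by simpa [glue_last] using hτ)
  filter_upwards [h] with z hz
  have e : ∀ s : ℝ, glue z + s • glue (0, τ) = glue (z.1, z.2 + τ * s) := by
    intro s
    rw [← glue_smul, ← Prod.mk.eta (p := z), ← glue_add, smul_zero, add_zero, mul_comm]
  have e1 := e 1
  rw [one_smul, mul_one] at e1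
  rw [e1] at hz
  rw [hz]
  simp_rw [e, Fin.sum_univ_castSucc, glue_castSucc, glue_last]
  simp only [PiLp.zero_apply, zero_smul, Finset.sum_const_zero, zero_add]
  rw [intervalIntegral.integral_smul]
  have := intervalIntegral.smul_integral_comp_add_mul (f := fun s => vert g (z.1, s))
    (a := 0) (b := 1) τ z.2
  simpa [vert] using this

/-- The horizontal increments of `f` are bounded by the integral of the gradient over the segment
joining the two points. -/
theorem IsNormalPair.ae_horizontal {f : Eucl (d + 1) → ℂ}
    {g : Eucl (d + 1) → EuclideanSpace ℂ (Fin (d + 1))} (H : IsNormalPair f g) (h : Eucl d) :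
    ∀ᵐ z ∂(halfProd d), ‖f (glue (z.1 + h, z.2)) - f (glue z)‖ₑ ≤
      (d + 1) * ‖h‖ₑ * ∫⁻ s in Ioc (0 : ℝ) 1, ‖g (glue (z.1 + s • h, z.2))‖ₑ := by
  have h1 := H.ae_translate_glue (v := glue (h, 0)) (by simp [glue_last])
  filter_upwards [h1] with z hz
  have e : ∀ s : ℝ, glue z + s • glue (h, 0) = glue (z.1 + s • h, z.2) := by
    intro s
    rw [← glue_smul, ← Prod.mk.eta (p := z), ← glue_add]
    simp
  have e1 := e 1
  rw [one_smul, one_smul] at e1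
  rw [e1] at hz
  rw [hz, intervalIntegral.integral_of_le zero_le_one]
  refine (enorm_integral_le_lintegral_enorm _).trans ?_
  have hm : Measurable (fun s : ℝ => ‖g (glue (z.1 + s • h, z.2))‖ₑ) :=
    H.measurable_enorm_grad.comp (f := fun s : ℝ => (z.1 + s • h, z.2)) (by fun_prop)
  rw [← lintegral_const_mul _ hm]
  refine lintegral_mono (fun s => ?_)
  simp only [e]
  refine (enorm_sum_le _ _).trans ?_
  have : ∀ i ∈ (Finset.univ : Finset (Fin (d + 1))),
      ‖(glue (h, 0) : Eucl (d + 1)) i • (g (glue (z.1 + s • h, z.2))) i‖ₑ ≤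
        ‖h‖ₑ * ‖g (glue (z.1 + s • h, z.2))‖ₑ := by
    intro i _
    rw [enorm_smul]
    refine mul_le_mul' ?_ (enorm_le_iff_norm_le.2 (PiLp.norm_apply_le _ _))
    refine Fin.lastCases ?_ (fun i => ?_) i
    · simp [glue_last]
    · rw [glue_castSucc]
      exact enorm_le_iff_norm_le.2 (PiLp.norm_apply_le _ _)
  refine (Finset.sum_le_card_nsmul _ _ _ this).trans (le_of_eq ?_)
  simp [mul_assoc]

/-- The integral of the norm of the gradient over the vertical segment of length `r` above a
boundary point. -/
noncomputable def column (g : Eucl (d + 1) → EuclideanSpace ℂ (Fin (d + 1))) (r : ℝ)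
    (y : Eucl d) : ℝ≥0∞ :=
  ∫⁻ t in Ioo (0 : ℝ) r, ‖g (glue (y, t))‖ₑ

theorem column_mono (g : Eucl (d + 1) → EuclideanSpace ℂ (Fin (d + 1))) {r r' : ℝ} (h : r ≤ r')
    (y : Eucl d) : column g r y ≤ column g r' y :=
  lintegral_mono_set (Ioo_subset_Ioo_right h)

theorem IsNormalPair.measurable_column {f : Eucl (d + 1) → ℂ}
    {g : Eucl (d + 1) → EuclideanSpace ℂ (Fin (d + 1))} (H : IsNormalPair f g) (r : ℝ) :
    Measurable (column g r) :=
  H.measurable_enorm_grad.lintegral_prod_right'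

/-- The integral over a cylinder of a nonnegative function on the half-space. -/
theorem lintegral_cylinder {F : Eucl (d + 1) → ℝ≥0∞} (hF : Measurable F) {A : Set (Eucl d)}
    (hA : MeasurableSet A) {T : Set ℝ} (hT : MeasurableSet T) :
    ∫⁻ y in A, ∫⁻ t in T, F (glue (y, t)) = ∫⁻ x in glue '' (A ×ˢ T), F x := by
  rw [← lintegral_prod (fun z => F (glue z)) (hF.comp glue.measurable).aemeasurable,
    Measure.prod_restrict]
  rw [← measurePreserving_glue.setLIntegral_comp_preimage
    (glue.measurableEmbedding.measurableSet_image.2 (hA.prod hT)) hF,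
    preimage_image_eq _ glue.injective]

theorem isBounded_glue_image {A : Set (Eucl d)} {T : Set ℝ} (hA : Bornology.IsBounded A)
    (hT : Bornology.IsBounded T) : Bornology.IsBounded (glue '' (A ×ˢ T)) := by
  obtain ⟨R, hR⟩ := hA.subset_closedBall 0
  obtain ⟨S, hS⟩ := hT.subset_closedBall 0
  refine (Metric.isBounded_closedBall (x := glue (0, 0)) (r := |R| + |S|)).subset ?_
  rintro _ ⟨z, ⟨hz1, hz2⟩, rfl⟩
  have h1 : dist z.1 0 ≤ |R| := (hR hz1).trans (le_abs_self R)
  have h2 : dist z.2 0 ≤ |S| := (hS hz2).trans (le_abs_self S)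
  rw [Metric.mem_closedBall]
  refine abs_le_of_sq_le_sq' ?_ (by positivity) |>.2
  rw [dist_glue_sq]
  nlinarith [dist_nonneg (x := z.1) (y := 0), dist_nonneg (x := z.2) (y := 0),
    abs_nonneg R, abs_nonneg S]

theorem lintegral_cylinder_lt_top {F : Type*} [NormedAddCommGroup F] {f : Eucl (d + 1) → F}
    (hfm : StronglyMeasurable f) (hf : LocallyIntegrable f volume) {A : Set (Eucl d)}
    (hA : MeasurableSet A) (hAb : Bornology.IsBounded A) {T : Set ℝ} (hT : MeasurableSet T)
    (hTb : Bornology.IsBounded T) :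
    ∫⁻ y in A, ∫⁻ t in T, ‖f (glue (y, t))‖ₑ < ⊤ := by
  rw [lintegral_cylinder hfm.enorm hA hT]
  obtain ⟨R, hR⟩ := (isBounded_glue_image hAb hTb).subset_closedBall 0
  exact (lintegral_mono_set hR).trans_lt
    (hf.integrableOn_isCompact (isCompact_closedBall _ _)).2

theorem IsNormalPair.ae_column_lt_top {f : Eucl (d + 1) → ℂ}
    {g : Eucl (d + 1) → EuclideanSpace ℂ (Fin (d + 1))} (H : IsNormalPair f g) :
    ∀ᵐ y : Eucl d, ∀ r, column g r y < ⊤ := by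
  have h : ∀ n : ℕ, ∀ᵐ y : Eucl d, y ∈ Metric.ball (0 : Eucl d) n → column g n y < ⊤ := by
    intro n
    refine (ae_restrict_iff' measurableSet_ball).1 ?_
    exact ae_lt_top (H.measurable_column n) (lintegral_cylinder_lt_top H.measurable_grad
      H.locInt_grad measurableSet_ball Metric.isBounded_ball measurableSet_Ioo
      (Metric.isBounded_Ioo 0 (n : ℝ))).ne
  filter_upwards [ae_all_iff.2 h] with y hy r
  obtain ⟨n, hn⟩ := exists_nat_gt (max r ‖y‖)
  refine (column_mono g ((le_max_left _ _).trans hn.le) y).trans_lt (hy n ?_)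
  rw [mem_ball_zero_iff]
  exact (le_max_right _ _).trans_lt hn

/-- The difference of `f` and the integral of its vertical derivative from the boundary. -/
noncomputable def vertDefect (f : Eucl (d + 1) → ℂ)
    (g : Eucl (d + 1) → EuclideanSpace ℂ (Fin (d + 1))) (z : Eucl d × ℝ) : ℂ :=
  f (glue z) - ∫ s in Ioc 0 z.2, vert g (z.1, s)

theorem IsNormalPair.stronglyMeasurable_vertDefect {f : Eucl (d + 1) → ℂ}
    {g : Eucl (d + 1) → EuclideanSpace ℂ (Fin (d + 1))} (H : IsNormalPair f g) :
    StronglyMeasurable (vertDefect f g) := by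
  refine (H.measurable_fun.comp_measurable glue.measurable).sub ?_
  have e : (fun z : Eucl d × ℝ => ∫ s in Ioc 0 z.2, vert g (z.1, s)) =
      fun z => ∫ s, (Ioc 0 z.2).indicator (fun s => vert g (z.1, s)) s := by
    ext z; rw [integral_indicator measurableSet_Ioc]
  rw [e]
  refine StronglyMeasurable.integral_prod_right (f := fun (z : Eucl d × ℝ) s =>
    (Ioc 0 z.2).indicator (fun s => vert g (z.1, s)) s) ?_
  have e2 : Function.uncurry (fun (z : Eucl d × ℝ) s =>
      (Ioc 0 z.2).indicator (fun s => vert g (z.1, s)) s) =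
      {w : (Eucl d × ℝ) × ℝ | 0 < w.2 ∧ w.2 ≤ w.1.2}.indicator
        (fun w => vert g (w.1.1, w.2)) := by
    ext w
    simp only [Function.uncurry, indicator, mem_Ioc, mem_ofPred_eq]
  rw [e2]
  refine StronglyMeasurable.indicator ?_ ?_
  · exact H.stronglyMeasurable_vert.comp_measurable (by fun_prop)
  · exact (measurableSet_lt measurable_const measurable_snd).inter
      (measurableSet_le measurable_snd (by fun_prop))

theorem integrableOn_vert {g : Eucl (d + 1) → EuclideanSpace ℂ (Fin (d + 1))}
    (hg : StronglyMeasurable (vert g)) {y : Eucl d} (h : ∀ r, column g r y < ⊤) (t : ℝ) :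
    IntegrableOn (fun s => vert g (y, s)) (Ioc 0 t) := by
  refine ⟨(hg.comp_measurable (by fun_prop)).aestronglyMeasurable, ?_⟩
  refine lt_of_le_of_lt ?_ (h (t + 1))
  refine (lintegral_mono_set (Ioc_subset_Ioo_right (lt_add_one t))).trans ?_
  exact lintegral_mono (fun s => enorm_vert_le g (y, s))

theorem enorm_integral_vert_le (g : Eucl (d + 1) → EuclideanSpace ℂ (Fin (d + 1))) (y : Eucl d)
    {t r : ℝ} (htr : t < r) : ‖∫ s in Ioc 0 t, vert g (y, s)‖ₑ ≤ column g r y :=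
  (enorm_integral_le_lintegral_enorm _).trans
    ((lintegral_mono_set (Ioc_subset_Ioo_right htr)).trans
      (lintegral_mono (fun s => enorm_vert_le g (y, s))))

/-- The boundary values of `f`: the value, for almost every `t`, of
`f (y, t) - ∫₀ᵗ ∂_{d+1} f (y, s) ds`. The mean over `t ∈ (0, 1)` selects this value in a measurable
way. -/
noncomputable def bdry (f : Eucl (d + 1) → ℂ)
    (g : Eucl (d + 1) → EuclideanSpace ℂ (Fin (d + 1))) (y : Eucl d) : ℂ :=
  ∫ t in Ioo (0 : ℝ) 1, vertDefect f g (y, t)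

theorem IsNormalPair.stronglyMeasurable_bdry {f : Eucl (d + 1) → ℂ}
    {g : Eucl (d + 1) → EuclideanSpace ℂ (Fin (d + 1))} (H : IsNormalPair f g) :
    StronglyMeasurable (bdry f g) :=
  StronglyMeasurable.integral_prod_right (f := fun y t => vertDefect f g (y, t))
    H.stronglyMeasurable_vertDefect

/-- Absolute continuity on almost every vertical line. -/
theorem IsNormalPair.ae_eq_bdry_add {f : Eucl (d + 1) → ℂ}
    {g : Eucl (d + 1) → EuclideanSpace ℂ (Fin (d + 1))} (H : IsNormalPair f g) :
    ∀ᵐ y : Eucl d, ∀ᵐ t ∂(volume.restrict (Ioi (0 : ℝ))),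
      f (glue (y, t)) = bdry f g y + ∫ s in Ioc 0 t, vert g (y, s) := by
  have hm := H.stronglyMeasurable_vertDefect
  have hcol : ∀ᵐ z ∂(halfProd d), ∀ r, column g r z.1 < ⊤ :=
    Measure.quasiMeasurePreserving_fst.ae H.ae_column_lt_top
  have hpos : ∀ᵐ z ∂(halfProd d), 0 < z.2 :=
    Measure.quasiMeasurePreserving_snd.ae (ae_restrict_mem measurableSet_Ioi)
  -- the defect is invariant under each vertical translation, almost everywhere
  have h1 : ∀ᵐ τ ∂(volume.restrict (Ioi (0 : ℝ))), ∀ᵐ z ∂(halfProd d),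
      vertDefect f g (z.1, z.2 + τ) = vertDefect f g z := by
    filter_upwards [ae_restrict_mem measurableSet_Ioi] with τ hτ
    have hτ : 0 < τ := hτ
    filter_upwards [H.ae_vertical hτ.le, hcol, hpos] with z hz hc hz2
    have hi := integrableOn_vert H.stronglyMeasurable_vert hc (z.2 + τ)
    rw [intervalIntegral.integral_of_le (by linarith)] at hz
    have : ∫ s in Ioc 0 (z.2 + τ), vert g (z.1, s) =
        (∫ s in Ioc 0 z.2, vert g (z.1, s)) + ∫ s in Ioc z.2 (z.2 + τ), vert g (z.1, s) := by
      rw [← Ioc_union_Ioc_eq_Ioc hz2.le (by linarith : z.2 ≤ z.2 + τ)] at hi ⊢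
      exact setIntegral_union (Ioc_disjoint_Ioc_of_le le_rfl) measurableSet_Ioc
        (hi.mono_set subset_union_left) (hi.mono_set subset_union_right)
    simp only [vertDefect, this, ← hz]
    ring
  have h2 : ∀ᵐ z ∂(halfProd d), ∀ᵐ τ ∂(volume.restrict (Ioi (0 : ℝ))),
      vertDefect f g (z.1, z.2 + τ) = vertDefect f g z := by
    refine (Measure.ae_ae_comm (p := fun (z : Eucl d × ℝ) (τ : ℝ) =>
      vertDefect f g (z.1, z.2 + τ) = vertDefect f g z) ?_).2 h1
    exact measurableSet_eq_fun (hm.measurable.comp (by fun_prop))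
      (hm.measurable.comp (by fun_prop))
  filter_upwards [Measure.ae_ae_of_ae_prod h2] with y hy
  have h3 : ∀ᵐ t ∂(volume.restrict (Ioi (0 : ℝ))), ∀ᵐ t' : ℝ, t < t' →
      vertDefect f g (y, t') = vertDefect f g (y, t) := by
    filter_upwards [hy] with t ht
    have ht' := (ae_restrict_iff' measurableSet_Ioi).1 ht
    have := (measurePreserving_sub_right (volume : Measure ℝ) t).quasiMeasurePreserving.ae ht'
    filter_upwards [this] with t' h h'
    have := h (by simpa using h')
    simpa using this
  have hne : NeBot (ae (volume.restrict (Ioi (0 : ℝ)))) := by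
    rw [ae_neBot, Ne, Measure.restrict_eq_zero]; simp
  obtain ⟨t1, ht1⟩ := h3.exists
  -- two heights are compared through a third one above both
  have h4 : ∀ᵐ t ∂(volume.restrict (Ioi (0 : ℝ))),
      vertDefect f g (y, t) = vertDefect f g (y, t1) := by
    filter_upwards [h3] with t ht
    have hne : NeBot (ae (volume.restrict (Ioi (max t t1)))) := by
      rw [ae_neBot, Ne, Measure.restrict_eq_zero]; simp
    obtain ⟨t', ⟨ha, hb⟩, hc⟩ := ((ae_restrict_of_ae (ht.and ht1)).and
      (ae_restrict_mem (measurableSet_Ioi (a := max t t1)))).exists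
    rw [← ha ((le_max_left _ _).trans_lt hc), hb ((le_max_right _ _).trans_lt hc)]
  have h5 : bdry f g y = vertDefect f g (y, t1) := by
    have : ∀ᵐ t ∂(volume.restrict (Ioo (0 : ℝ) 1)),
        vertDefect f g (y, t) = vertDefect f g (y, t1) :=
      ae_mono (Measure.restrict_mono Ioo_subset_Ioi_self le_rfl) h4
    rw [bdry, integral_congr_ae this]
    simp
  filter_upwards [h4] with t ht
  rw [h5, ← ht, vertDefect]
  ring

end Representatives

/-! ### Half-balls -/

section HalfBalls

variable {d : ℕ}

theorem measurableSet_halfBall (x : Eucl d) (r : ℝ) : MeasurableSet (halfBall x r) :=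
  measurableSet_ball.inter measurableSet_halfSpace

theorem glue_mem_halfBall {x y : Eucl d} {t r : ℝ} (hr : 0 < r) :
    glue (y, t) ∈ halfBall x r ↔ dist y x ^ 2 + t ^ 2 < r ^ 2 ∧ 0 < t := by
  rw [halfBall, mem_inter_iff, glue_mem_halfSpace, Metric.mem_ball, boundaryPoint_eq_glue,
    ← abs_of_nonneg (dist_nonneg (x := glue (y, t))), ← abs_of_pos hr, ← sq_lt_sq, dist_glue_sq,
    abs_of_pos hr]
  simp

theorem setLIntegral_halfBall_le {α : ℝ} {F : Eucl (d + 1) → ℝ≥0∞} (hF : Measurable F)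
    (x : Eucl d) {r : ℝ} (hr : 0 < r) :
    ∫⁻ z in halfBall x r, F z ∂(weightMeasure d α) ≤
      ∫⁻ y in Metric.closedBall x r, ∫⁻ t in Ioo 0 r, weight α t * F (glue (y, t)) := by
  rw [← lintegral_indicator (measurableSet_halfBall x r),
    lintegral_weightMeasure (hF.indicator (measurableSet_halfBall x r)).aemeasurable,
    ← lintegral_indicator Metric.isClosed_closedBall.measurableSet]
  refine lintegral_mono (fun y => ?_)
  by_cases hy : y ∈ Metric.closedBall x r
  · rw [indicator_of_mem hy, ← lintegral_indicator measurableSet_Ioi,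
      ← lintegral_indicator measurableSet_Ioo]
    refine lintegral_mono (fun t => ?_)
    by_cases ht : glue (y, t) ∈ halfBall x r
    · obtain ⟨h1, h2⟩ := (glue_mem_halfBall hr).1 ht
      have : t < r := lt_of_pow_lt_pow_left₀ 2 hr.le (by nlinarith [sq_nonneg (dist y x)])
      rw [indicator_of_mem (mem_Ioi.2 h2), indicator_of_mem (mem_Ioo.2 ⟨h2, this⟩),
        indicator_of_mem ht]
    · have : (Ioi (0 : ℝ)).indicator
          (fun t => weight α t * (halfBall x r).indicator F (glue (y, t))) t = 0 := by
        rw [indicator_apply_eq_zero]; intro _; rw [indicator_of_notMem ht, mul_zero]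
      rw [this]; exact zero_le
  · rw [indicator_of_notMem hy]
    refine (lintegral_eq_zero_of_ae_eq_zero (Eventually.of_forall fun t => ?_)).le
    have : glue (y, t) ∉ halfBall x r := by
      rw [glue_mem_halfBall hr]
      rintro ⟨h1, -⟩
      refine hy (Metric.mem_closedBall.2 ?_)
      exact (lt_of_pow_lt_pow_left₀ 2 hr.le (by nlinarith [sq_nonneg t])).le
    simp [indicator_of_notMem this]

/-- The mass of the weight on `(0, r)`. -/
noncomputable def weightMass (α r : ℝ) : ℝ≥0∞ := ∫⁻ t in Ioo (0 : ℝ) r, weight α t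

theorem weightMass_of_le_one {α r : ℝ} (hα : -1 < α) (hr : 0 < r) (hr1 : r ≤ 1) :
    weightMass α r = ENNReal.ofReal (r ^ (α + 1) / (α + 1)) := by
  rw [weightMass, ← lintegral_ofReal_rpow_Ioo hr hα]
  exact setLIntegral_congr_fun measurableSet_Ioo
    (fun t ht => weight_of_mem_Ioc ⟨ht.1, ht.2.le.trans hr1⟩)

theorem weightMass_lt_top {α : ℝ} (hα : -1 < α) (r : ℝ) : weightMass α r < ⊤ := by
  have h : weightMass α r ≤ weightMass α 1 + ∫⁻ t in Icc (1 : ℝ) r, 1 := by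
    have h1 : Ioo (0 : ℝ) r ⊆ Ioo 0 1 ∪ Icc 1 r := by
      intro t ht
      rcases lt_or_ge t 1 with h | h
      · exact Or.inl ⟨ht.1, h⟩
      · exact Or.inr ⟨h, ht.2.le⟩
    refine (lintegral_mono_set h1).trans ((lintegral_union_le _ _ _).trans ?_)
    refine add_le_add le_rfl (le_of_eq ?_)
    exact setLIntegral_congr_fun measurableSet_Icc (fun t ht => weight_of_one_le ht.1)
  refine h.trans_lt ?_
  rw [weightMass_of_le_one hα one_pos le_rfl]
  simp

theorem weightMeasure_halfBall_lt_top {α : ℝ} (hα : -1 < α) (x : Eucl d) {r : ℝ} (hr : 0 < r) :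
    weightMeasure d α (halfBall x r) < ⊤ := by
  rw [← setLIntegral_one]
  refine (setLIntegral_halfBall_le measurable_const x hr).trans_lt ?_
  simp only [mul_one]
  rw [setLIntegral_const]
  exact ENNReal.mul_lt_top (weightMass_lt_top hα r) measure_closedBall_lt_top

/-- A half-ball contains a cylinder of half the size. -/
theorem le_weightMeasure_halfBall {α : ℝ} (x : Eucl d) {r : ℝ} (hr : 0 < r) :
    weightMass α (r / 2) * volume (Metric.closedBall x (r / 2)) ≤
      weightMeasure d α (halfBall x r) := by
  rw [← setLIntegral_one (halfBall x r), ← lintegral_indicator (measurableSet_halfBall x r),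
    lintegral_weightMeasure (measurable_const.indicator (measurableSet_halfBall x r)).aemeasurable,
    ← setLIntegral_const, ← lintegral_indicator Metric.isClosed_closedBall.measurableSet]
  refine lintegral_mono (fun y => ?_)
  by_cases hy : y ∈ Metric.closedBall x (r / 2)
  · rw [indicator_of_mem hy, weightMass, ← lintegral_indicator measurableSet_Ioi,
      ← lintegral_indicator measurableSet_Ioo]
    refine lintegral_mono (fun t => ?_)
    by_cases ht : t ∈ Ioo 0 (r / 2)
    · have h : glue (y, t) ∈ halfBall x r := by
        rw [glue_mem_halfBall hr]
        refine ⟨?_, ht.1⟩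
        have h1 := Metric.mem_closedBall.1 hy
        have h2 := dist_nonneg (x := y) (y := x)
        nlinarith [ht.1, ht.2]
      rw [indicator_of_mem ht, indicator_of_mem (mem_Ioi.2 ht.1), indicator_of_mem h, mul_one]
    · rw [indicator_of_notMem ht]; exact zero_le
  · rw [indicator_of_notMem hy]; exact zero_le

/-- The cylinder around a half-ball has comparable measure, uniformly for small radii. -/
theorem exists_cylinder_le_halfBall {α : ℝ} (hα : -1 < α) :
    ∃ C : ℝ≥0, ∀ (x : Eucl d) (r : ℝ), 0 < r → r ≤ 1 →
      weightMass α r * volume (Metric.closedBall x r) ≤ C * weightMeasure d α (halfBall x r) := by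
  refine ⟨Real.toNNReal (2 ^ (α + 1) * 2 ^ d), fun x r hr hr1 => ?_⟩
  refine le_trans (le_of_eq ?_) (mul_le_mul_right (le_weightMeasure_halfBall x hr) _)
  have h1 : 0 < α + 1 := by linarith
  rw [weightMass_of_le_one hα hr hr1, weightMass_of_le_one hα (by linarith) (by linarith),
    Measure.addHaar_closedBall _ _ hr.le, Measure.addHaar_closedBall _ _ (by linarith : 0 ≤ r / 2)]
  change _ = ENNReal.ofReal _ * _
  rw [← mul_assoc, ← mul_assoc, ← mul_assoc, ← ENNReal.ofReal_mul (by positivity),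
    ← ENNReal.ofReal_mul (by positivity), ← ENNReal.ofReal_mul (by positivity)]
  congr 2
  rw [Real.div_rpow hr.le (by norm_num), finrank_euclideanSpace_fin, div_pow]
  field_simp

theorem weightMeasure_halfBall_ne_zero {α : ℝ} (hα : -1 < α) (x : Eucl d) {r : ℝ} (hr : 0 < r)
    (hr1 : r ≤ 1) : weightMeasure d α (halfBall x r) ≠ 0 := by
  refine ne_of_gt (lt_of_lt_of_le ?_ (le_weightMeasure_halfBall x hr))
  have h1 : 0 < α + 1 := by linarith
  rw [weightMass_of_le_one hα (by linarith) (by linarith)]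
  refine ENNReal.mul_pos ?_ (Metric.measure_closedBall_pos _ _ (by linarith)).ne'
  rw [Ne, ENNReal.ofReal_eq_zero, not_le]
  positivity

theorem integrableOn_halfBall {α p : ℝ} (hα : -1 < α) (hp : 1 ≤ p) {f : Eucl (d + 1) → ℂ}
    (hf : AEStronglyMeasurable f (weightMeasure d α))
    (hfp : eLpNorm f (ENNReal.ofReal p) (weightMeasure d α) < ⊤) (x : Eucl d) {r : ℝ}
    (hr : 0 < r) : IntegrableOn f (halfBall x r) (weightMeasure d α) := by
  have : IsFiniteMeasure ((weightMeasure d α).restrict (halfBall x r)) :=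
    ⟨by rw [Measure.restrict_apply_univ]; exact weightMeasure_halfBall_lt_top hα x hr⟩
  exact (MemLp.restrict (halfBall x r) ⟨hf, hfp⟩).integrable (by simpa using hp)

/-! ### The trace -/

/-- On almost every vertical line, `f` differs from its boundary value by at most the integral of
the norm of the gradient over the segment below. -/
theorem IsNormalPair.ae_enorm_sub_bdry_le {f : Eucl (d + 1) → ℂ}
    {g : Eucl (d + 1) → EuclideanSpace ℂ (Fin (d + 1))} (H : IsNormalPair f g) :
    ∀ᵐ y : Eucl d, ∀ᵐ t ∂(volume.restrict (Ioi (0 : ℝ))), ∀ r, t < r →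
      ‖f (glue (y, t)) - bdry f g y‖ₑ ≤ column g r y := by
  filter_upwards [H.ae_eq_bdry_add] with y hy
  filter_upwards [hy] with t ht r htr
  rw [ht, add_sub_cancel_left]
  exact enorm_integral_vert_le g y htr

theorem IsNormalPair.ae_enorm_bdry_le {f : Eucl (d + 1) → ℂ}
    {g : Eucl (d + 1) → EuclideanSpace ℂ (Fin (d + 1))} (H : IsNormalPair f g) :
    ∀ᵐ y : Eucl d, ‖bdry f g y‖ₑ ≤ (∫⁻ t in Ioo (0 : ℝ) 1, ‖f (glue (y, t))‖ₑ) + column g 1 y := by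
  filter_upwards [H.ae_enorm_sub_bdry_le] with y hy
  have hy' : ∀ᵐ t ∂(volume.restrict (Ioo (0 : ℝ) 1)),
      ‖bdry f g y‖ₑ ≤ ‖f (glue (y, t))‖ₑ + column g 1 y := by
    filter_upwards [ae_mono (Measure.restrict_mono Ioo_subset_Ioi_self le_rfl) hy,
      ae_restrict_mem measurableSet_Ioo] with t ht ht2
    have h1 := ht 1 ht2.2
    calc ‖bdry f g y‖ₑ = ‖f (glue (y, t)) - (f (glue (y, t)) - bdry f g y)‖ₑ := by
          rw [sub_sub_cancel]
      _ ≤ ‖f (glue (y, t))‖ₑ + ‖f (glue (y, t)) - bdry f g y‖ₑ := enorm_sub_le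
      _ ≤ _ := by gcongr
  have h2 := lintegral_mono_ae hy'
  rw [lintegral_add_right _ measurable_const] at h2
  simpa using h2

theorem locallyIntegrable_of_lintegral_ball_lt_top {F : Type*} [NormedAddCommGroup F]
    {u : Eucl d → F} (hu : AEStronglyMeasurable u volume)
    (h : ∀ R : ℝ, ∫⁻ y in Metric.closedBall 0 R, ‖u y‖ₑ < ⊤) : LocallyIntegrable u volume := by
  rw [locallyIntegrable_iff]
  intro K hK
  obtain ⟨R, hR⟩ := hK.isBounded.subset_closedBall 0
  exact ⟨hu.restrict, (lintegral_mono_set hR).trans_lt (h R)⟩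

theorem IsNormalPair.lintegral_column_lt_top {f : Eucl (d + 1) → ℂ}
    {g : Eucl (d + 1) → EuclideanSpace ℂ (Fin (d + 1))} (H : IsNormalPair f g) (r R : ℝ) :
    ∫⁻ y in Metric.closedBall 0 R, column g r y < ⊤ :=
  lintegral_cylinder_lt_top H.measurable_grad H.locInt_grad
    Metric.isClosed_closedBall.measurableSet Metric.isBounded_closedBall measurableSet_Ioo
    (Metric.isBounded_Ioo 0 r)

theorem IsNormalPair.locallyIntegrable_bdry {f : Eucl (d + 1) → ℂ}
    {g : Eucl (d + 1) → EuclideanSpace ℂ (Fin (d + 1))} (H : IsNormalPair f g) :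
    LocallyIntegrable (bdry f g) volume := by
  refine locallyIntegrable_of_lintegral_ball_lt_top
    H.stronglyMeasurable_bdry.aestronglyMeasurable (fun R => ?_)
  refine (lintegral_mono_ae (ae_restrict_of_ae H.ae_enorm_bdry_le)).trans_lt ?_
  rw [lintegral_add_right _ (H.measurable_column 1)]
  exact ENNReal.add_lt_top.2 ⟨lintegral_cylinder_lt_top H.measurable_fun H.locInt_fun
    Metric.isClosed_closedBall.measurableSet Metric.isBounded_closedBall measurableSet_Ioo
    (Metric.isBounded_Ioo 0 1), H.lintegral_column_lt_top 1 R⟩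

theorem IsNormalPair.locallyIntegrable_column {f : Eucl (d + 1) → ℂ}
    {g : Eucl (d + 1) → EuclideanSpace ℂ (Fin (d + 1))} (H : IsNormalPair f g) (r : ℝ) :
    LocallyIntegrable (fun y => (column g r y).toReal) volume := by
  refine locallyIntegrable_of_lintegral_ball_lt_top
    (H.measurable_column r).ennreal_toReal.aestronglyMeasurable (fun R => ?_)
  refine lt_of_le_of_lt (lintegral_mono fun y => ?_) (H.lintegral_column_lt_top r R)
  rw [Real.enorm_of_nonneg ENNReal.toReal_nonneg]
  exact ENNReal.ofReal_toReal_le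

/-- Lebesgue's differentiation theorem: almost every point is a Lebesgue point. -/
theorem tendsto_lintegral_enorm_sub_div {F : Type*} [NormedAddCommGroup F] {u : Eucl d → F}
    (hu : LocallyIntegrable u volume) : ∀ᵐ x : Eucl d, Tendsto (fun r : ℝ =>
      (∫⁻ y in Metric.closedBall x r, ‖u y - u x‖ₑ) / volume (Metric.closedBall x r))
      (𝓝[>] 0) (𝓝 0) := by
  filter_upwards [(Besicovitch.vitaliFamily
    (volume : Measure (Eucl d))).ae_tendsto_lintegral_enorm_sub_div hu] with x hx
  exact hx.comp (Besicovitch.tendsto_filterAt volume x)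

theorem tendsto_column_zero {g : Eucl (d + 1) → EuclideanSpace ℂ (Fin (d + 1))} {y : Eucl d}
    (h : column g 1 y < ⊤) :
    Tendsto (fun n : ℕ => column g (1 / ((n : ℝ) + 1)) y) atTop (𝓝 0) := by
  have h1 : ∀ n : ℕ, column g (1 / ((n : ℝ) + 1)) y =
      ∫⁻ t in Ioo (0 : ℝ) (1 / ((n : ℝ) + 1)), ‖g (glue (y, t))‖ₑ ∂(volume.restrict (Ioo 0 1)) := by
    intro n
    rw [Measure.restrict_restrict measurableSet_Ioo, inter_eq_left.2 (Ioo_subset_Ioo_right ?_)]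
    · rfl
    · rw [div_le_one (by positivity)]; linarith [Nat.cast_nonneg (α := ℝ) n]
  simp_rw [h1]
  refine tendsto_setLIntegral_zero (μ := volume.restrict (Ioo (0 : ℝ) 1)) (ne_of_lt h) ?_
  have h2 : Tendsto (fun n : ℕ => ENNReal.ofReal (1 / ((n : ℝ) + 1))) atTop (𝓝 0) := by
    rw [← ENNReal.ofReal_zero]
    exact ENNReal.tendsto_ofReal tendsto_one_div_add_atTop_nhds_zero_nat
  refine tendsto_of_tendsto_of_tendsto_of_le_of_le tendsto_const_nhds h2 (fun n => zero_le)
    (fun n => ?_)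
  refine (Measure.restrict_apply_le _ _).trans ?_
  simp

/-- The deviation of the half-ball average of `f` from a boundary value is controlled by averages
over balls of the boundary. -/
theorem IsNormalPair.enorm_average_sub_le {f : Eucl (d + 1) → ℂ}
    {g : Eucl (d + 1) → EuclideanSpace ℂ (Fin (d + 1))} (H : IsNormalPair f g) {α : ℝ}
    (hα : -1 < α) {C : ℝ≥0} (hC : ∀ (x : Eucl d) (r : ℝ), 0 < r → r ≤ 1 →
      weightMass α r * volume (Metric.closedBall x r) ≤ C * weightMeasure d α (halfBall x r))
    (x : Eucl d) {r R : ℝ} (hr : 0 < r) (hr1 : r ≤ 1) (hrR : r ≤ R)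
    (hi : IntegrableOn f (halfBall x r) (weightMeasure d α)) (c : ℂ) :
    ‖(⨍ z in halfBall x r, f z ∂(weightMeasure d α)) - c‖ₑ ≤
      C * ((∫⁻ y in Metric.closedBall x r, (‖bdry f g y - c‖ₑ + column g R y)) /
        volume (Metric.closedBall x r)) := by
  set μ := weightMeasure d α
  have h0 : μ (halfBall x r) ≠ 0 := weightMeasure_halfBall_ne_zero hα x hr hr1
  have h1 : μ (halfBall x r) ≠ ⊤ := (weightMeasure_halfBall_lt_top hα x hr).ne
  have hv0 : volume (Metric.closedBall x r) ≠ 0 := (Metric.measure_closedBall_pos _ _ hr).ne'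
  have hv1 : volume (Metric.closedBall x r) ≠ ⊤ := measure_closedBall_lt_top.ne
  have hm0 : μ.real (halfBall x r) ≠ 0 := (ENNReal.toReal_pos h0 h1).ne'
  have e1 : (⨍ z in halfBall x r, f z ∂μ) - c = (μ.real (halfBall x r))⁻¹ •
      ∫ z in halfBall x r, (f z - c) ∂μ := by
    rw [integral_sub hi (integrableOn_const h1), setAverage_eq, smul_sub, setIntegral_const,
      inv_smul_smul₀ hm0]
  have e2 : ∫⁻ z in halfBall x r, ‖f z - c‖ₑ ∂μ ≤
      weightMass α r * ∫⁻ y in Metric.closedBall x r, (‖bdry f g y - c‖ₑ + column g R y) := by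
    refine (setLIntegral_halfBall_le (F := fun z => ‖f z - c‖ₑ)
      (H.measurable_fun.sub stronglyMeasurable_const).enorm x hr).trans ?_
    have hbm : Measurable (fun y => ‖bdry f g y - c‖ₑ) :=
      (H.stronglyMeasurable_bdry.sub stronglyMeasurable_const).enorm
    have hsum : Measurable (fun y => ‖bdry f g y - c‖ₑ + column g R y) :=
      hbm.add (H.measurable_column R)
    rw [← lintegral_const_mul _ hsum]
    refine lintegral_mono_ae (ae_restrict_of_ae ?_)
    filter_upwards [H.ae_enorm_sub_bdry_le] with y hy
    rw [weightMass, ← lintegral_mul_const _ (measurable_weight α)]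
    refine lintegral_mono_ae ?_
    filter_upwards [ae_mono (Measure.restrict_mono Ioo_subset_Ioi_self le_rfl) hy,
      ae_restrict_mem measurableSet_Ioo] with t ht ht2
    gcongr
    calc ‖f (glue (y, t)) - c‖ₑ = ‖(bdry f g y - c) + (f (glue (y, t)) - bdry f g y)‖ₑ := by
          congr 1; ring
      _ ≤ ‖bdry f g y - c‖ₑ + ‖f (glue (y, t)) - bdry f g y‖ₑ := enorm_add_le _ _
      _ ≤ _ := by gcongr; exact ht R (ht2.2.trans_le hrR)
  rw [e1, enorm_smul, enorm_inv hm0, Measure.real, Real.enorm_of_nonneg ENNReal.toReal_nonneg,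
    ENNReal.ofReal_toReal h1, mul_comm, ← div_eq_mul_inv]
  refine ENNReal.div_le_of_le_mul ?_
  refine (enorm_integral_le_lintegral_enorm _).trans (e2.trans ?_)
  set I := ∫⁻ y in Metric.closedBall x r, (‖bdry f g y - c‖ₑ + column g R y)
  calc weightMass α r * I
      = weightMass α r * volume (Metric.closedBall x r) * (I / volume (Metric.closedBall x r)) := by
        rw [mul_assoc, ENNReal.mul_div_cancel hv0 hv1]
    _ ≤ C * μ (halfBall x r) * (I / volume (Metric.closedBall x r)) := by
        exact mul_le_mul_left (hC x r hr hr1) _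
    _ = _ := by ring

/-- The averages over half-balls converge to the boundary values, almost everywhere. -/
theorem IsNormalPair.ae_hasTraceAt {f : Eucl (d + 1) → ℂ}
    {g : Eucl (d + 1) → EuclideanSpace ℂ (Fin (d + 1))} (H : IsNormalPair f g) {α : ℝ}
    (hα : -1 < α)
    (hi : ∀ (x : Eucl d) (r : ℝ), 0 < r → IntegrableOn f (halfBall x r) (weightMeasure d α)) :
    ∀ᵐ x : Eucl d, HasTraceAt (weightMeasure d α) f x (bdry f g x) := by
  obtain ⟨C, hC⟩ := exists_cylinder_le_halfBall (d := d) hα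
  have hcol := ae_all_iff.2 (fun n : ℕ =>
    tendsto_lintegral_enorm_sub_div (H.locallyIntegrable_column (1 / ((n : ℝ) + 1))))
  filter_upwards [tendsto_lintegral_enorm_sub_div H.locallyIntegrable_bdry, hcol,
    H.ae_column_lt_top] with x hx hxc hfin
  refine ⟨hi x, ?_⟩
  rw [tendsto_iff_edist_tendsto_0]
  simp_rw [edist_eq_enorm_sub]
  rw [ENNReal.tendsto_nhds_zero]
  intro ε hε
  have h1 : Tendsto (fun n : ℕ => (C : ℝ≥0∞) * column g (1 / ((n : ℝ) + 1)) x) atTop (𝓝 0) := by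
    simpa using ENNReal.Tendsto.const_mul (tendsto_column_zero (hfin 1))
      (Or.inr (ENNReal.coe_ne_top (r := C)))
  -- a fixed column height `R` for which the error at `x` is small, before letting `r → 0`
  obtain ⟨n, hn⟩ := ((tendsto_order.1 h1).2 ε hε).exists
  set R : ℝ := 1 / ((n : ℝ) + 1)
  have hR : 0 < R := by positivity
  have h2 := ENNReal.Tendsto.const_mul ((hx.add (hxc n)).add_const (column g R x))
      (Or.inr (ENNReal.coe_ne_top (r := C)))
  rw [add_zero, zero_add] at h2
  filter_upwards [(tendsto_order.1 h2).2 ε hn, self_mem_nhdsWithin,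
    nhdsWithin_le_nhds (Iio_mem_nhds (lt_min one_pos hR))] with r hr hr0 hr1
  have hr0 : 0 < r := hr0
  have hr1 : r < min 1 R := hr1
  refine (H.enorm_average_sub_le hα hC x hr0 (hr1.le.trans (min_le_left _ _))
    (hr1.le.trans (min_le_right _ _)) (hi x r hr0) (bdry f g x)).trans (le_trans ?_ hr.le)
  gcongr
  have hv0 : volume (Metric.closedBall x r) ≠ 0 := (Metric.measure_closedBall_pos _ _ hr0).ne'
  have hv1 : volume (Metric.closedBall x r) ≠ ⊤ := measure_closedBall_lt_top.ne
  rw [← ENNReal.add_div]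
  refine ENNReal.div_le_of_le_mul ?_
  rw [add_mul, ENNReal.div_mul_cancel hv0 hv1]
  have hbm : Measurable (fun y => ‖bdry f g y - bdry f g x‖ₑ) :=
    (H.stronglyMeasurable_bdry.sub stronglyMeasurable_const).enorm
  rw [lintegral_add_left hbm, add_assoc]
  gcongr
  rw [← setLIntegral_const, ← lintegral_add_right _ measurable_const]
  refine lintegral_mono_ae (ae_restrict_of_ae ?_)
  filter_upwards [H.ae_column_lt_top] with y hy
  calc column g R y = ‖(column g R y).toReal‖ₑ := by
        rw [Real.enorm_of_nonneg ENNReal.toReal_nonneg, ENNReal.ofReal_toReal (hy R).ne]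
    _ = ‖((column g R y).toReal - (column g R x).toReal) + (column g R x).toReal‖ₑ := by
        rw [sub_add_cancel]
    _ ≤ ‖(column g R y).toReal - (column g R x).toReal‖ₑ + ‖(column g R x).toReal‖ₑ :=
        enorm_add_le _ _
    _ = _ := by
        rw [Real.enorm_of_nonneg (ENNReal.toReal_nonneg (a := column g R x)),
          ENNReal.ofReal_toReal (hfin R).ne]

end HalfBalls

/-! ### Dyadic cubes -/

section Dyadic

variable {d : ℕ}

theorem edge_pos (k : ℤ) : 0 < edge k := by unfold edge; positivity

theorem edge_natCast (k : ℕ) : edge (k : ℤ) = (2 : ℝ) ^ (-(k : ℝ)) := by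
  rw [edge, ← Real.rpow_intCast]; simp

theorem edge_succ (k : ℤ) : edge k = 2 * edge (k + 1) := by
  unfold edge
  rw [neg_add, zpow_add₀ (by norm_num)]
  norm_num
  ring

theorem edge_zero : edge 0 = 1 := by simp [edge]

theorem edge_le_one (k : ℕ) : edge (k : ℤ) ≤ 1 := by
  rw [edge_natCast]
  exact Real.rpow_le_one_of_one_le_of_nonpos (by norm_num) (by simp)

theorem edge_anti {j k : ℤ} (h : j ≤ k) : edge k ≤ edge j :=
  zpow_le_zpow_right₀ (by norm_num) (by omega)

theorem edge_div_edge (j k : ℤ) : edge k / edge j = (2 : ℝ) ^ (j - k) := by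
  unfold edge
  rw [← zpow_sub₀ (by norm_num)]
  congr 1; ring

theorem half_le_edge_div_iff (j k : ℤ) :
    (1 / 2 ≤ edge k / edge j ∧ edge k / edge j ≤ 2) ↔ k - 1 ≤ j ∧ j ≤ k + 1 := by
  rw [edge_div_edge]
  have h1 : (1 / 2 : ℝ) = 2 ^ (-1 : ℤ) := by norm_num
  have h2 : ((2 : ℝ) ^ (j - k) ≤ 2) ↔ (2 : ℝ) ^ (j - k) ≤ 2 ^ (1 : ℤ) := by norm_num
  rw [h1, h2, zpow_le_zpow_iff_right₀ (by norm_num), zpow_le_zpow_iff_right₀ (by norm_num)]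
  omega

theorem dyadicCube_eq_preimage (k : ℤ) (m : Fin d → ℤ) :
    dyadicCube k m = (WithLp.ofLp : Eucl d → Fin d → ℝ) ⁻¹'
      (univ.pi fun i => Ioc (edge k * (m i : ℝ)) (edge k * ((m i : ℝ) + 1))) := by
  ext x; simp [dyadicCube]

theorem measurableSet_dyadicCube (k : ℤ) (m : Fin d → ℤ) : MeasurableSet (dyadicCube k m) := by
  rw [dyadicCube_eq_preimage]
  exact (WithLp.measurable_ofLp 2 _) (MeasurableSet.univ_pi fun i => measurableSet_Ioc)

theorem volume_dyadicCube (k : ℤ) (m : Fin d → ℤ) :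
    volume (dyadicCube k m) = ENNReal.ofReal (edge k) ^ d := by
  rw [dyadicCube_eq_preimage]
  have h := (EuclideanSpace.volume_preserving_symm_measurableEquiv_toLp (Fin d)).measure_preimage
    (s := univ.pi fun i => Ioc (edge k * (m i : ℝ)) (edge k * ((m i : ℝ) + 1)))
    (MeasurableSet.univ_pi fun i => measurableSet_Ioc).nullMeasurableSet
  refine h.trans ?_
  rw [Real.volume_pi_Ioc]
  simp [mul_add]

theorem volume_dyadicCube_ne_zero (k : ℤ) (m : Fin d → ℤ) : volume (dyadicCube k m) ≠ 0 := by
  rw [volume_dyadicCube]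
  exact pow_ne_zero _ (by simpa using edge_pos k)

theorem volume_dyadicCube_ne_top (k : ℤ) (m : Fin d → ℤ) : volume (dyadicCube k m) ≠ ⊤ := by
  rw [volume_dyadicCube]
  exact ENNReal.pow_ne_top ENNReal.ofReal_ne_top

/-- The position of the dyadic cube of level `k` containing a given point. -/
noncomputable def cubeIndex (k : ℤ) (x : Eucl d) : Fin d → ℤ := fun i => ⌈x i / edge k⌉ - 1

theorem mem_dyadicCube_iff {k : ℤ} {m : Fin d → ℤ} {x : Eucl d} :
    x ∈ dyadicCube k m ↔ m = cubeIndex k x := by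
  rw [funext_iff]
  refine forall_congr' (fun i => ?_)
  rw [cubeIndex, eq_sub_iff_add_eq, eq_comm, Int.ceil_eq_iff, lt_div_iff₀ (edge_pos k),
    div_le_iff₀ (edge_pos k)]
  push_cast
  rw [add_sub_cancel_right, mul_comm (edge k), mul_comm (edge k)]

theorem iUnion_dyadicCube (k : ℤ) : ⋃ m : Fin d → ℤ, dyadicCube k m = univ := by
  refine eq_univ_of_forall (fun x => mem_iUnion.2 ⟨cubeIndex k x, ?_⟩)
  exact mem_dyadicCube_iff.2 rfl

theorem pairwise_disjoint_dyadicCube (k : ℤ) :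
    Pairwise (Function.onFun Disjoint fun m : Fin d → ℤ => dyadicCube k m) := by
  intro m m' h
  rw [Function.onFun, Set.disjoint_left]
  intro x h1 h2
  exact h ((mem_dyadicCube_iff.1 h1).trans (mem_dyadicCube_iff.1 h2).symm)

theorem tsum_lintegral_dyadicCube (k : ℤ) (F : Eucl d → ℝ≥0∞) :
    ∑' m : Fin d → ℤ, ∫⁻ y in dyadicCube k m, F y = ∫⁻ y, F y := by
  rw [← lintegral_iUnion (measurableSet_dyadicCube k) (pairwise_disjoint_dyadicCube k),
    iUnion_dyadicCube, Measure.restrict_univ]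

theorem closure_dyadicCube (k : ℤ) (m : Fin d → ℤ) :
    closure (dyadicCube k m) =
      {x | ∀ i, edge k * (m i : ℝ) ≤ x i ∧ x i ≤ edge k * ((m i : ℝ) + 1)} := by
  have h := (PiLp.homeomorph 2 (fun _ : Fin d => ℝ)).preimage_closure
    (univ.pi fun i => Ioc (edge k * (m i : ℝ)) (edge k * ((m i : ℝ) + 1)))
  have h2 : dyadicCube k m = (PiLp.homeomorph 2 (fun _ : Fin d => ℝ)) ⁻¹'
    (univ.pi fun i => Ioc (edge k * (m i : ℝ)) (edge k * ((m i : ℝ) + 1))) :=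
    dyadicCube_eq_preimage k m
  rw [h2, ← h, closure_pi_set]
  have h3 : ∀ i, closure (Ioc (edge k * (m i : ℝ)) (edge k * ((m i : ℝ) + 1))) =
      Icc (edge k * (m i : ℝ)) (edge k * ((m i : ℝ) + 1)) := fun i =>
    closure_Ioc (by nlinarith [edge_pos k])
  simp_rw [h3]
  ext x
  simp [PiLp.homeomorph, Pi.le_def, forall_and]

theorem neighbor_iff {k j : ℤ} {m m' : Fin d → ℤ} :
    Neighbor (k, m) (j, m') ↔ (k - 1 ≤ j ∧ j ≤ k + 1) ∧
      ∀ i, edge k * (m i : ℝ) ≤ edge j * ((m' i : ℝ) + 1) ∧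
        edge j * (m' i : ℝ) ≤ edge k * ((m i : ℝ) + 1) := by
  rw [Neighbor, ← and_assoc, half_le_edge_div_iff]
  refine and_congr_right (fun _ => ?_)
  simp only [closure_dyadicCube]
  constructor
  · rintro ⟨x, h1, h2⟩ i
    exact ⟨(h1 i).1.trans (h2 i).2, (h2 i).1.trans (h1 i).2⟩
  · intro h
    refine ⟨WithLp.toLp 2 fun i => max (edge k * (m i : ℝ)) (edge j * (m' i : ℝ)),
      fun i => ⟨le_max_left _ _, max_le ?_ (h i).2⟩, fun i => ⟨le_max_right _ _, max_le (h i).1 ?_⟩⟩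
    · nlinarith [edge_pos k]
    · nlinarith [edge_pos j]

/-- An upper bound for the number of neighbors of a dyadic cube. -/
def neighborBound (d : ℕ) : ℕ := 3 * 4 ^ d

theorem exists_finset_neighbor (Q : ℤ × (Fin d → ℤ)) :
    ∃ T : Finset (ℤ × (Fin d → ℤ)), T.card ≤ neighborBound d ∧
      ∀ Q', Q' ∈ T ↔ Neighbor Q Q' := by
  classical
  obtain ⟨k, m⟩ := Q
  -- in each coordinate, a neighbor of level `j` has one of four positions, from `a j i` on
  set a : ℤ → Fin d → ℤ := fun j i => ⌈edge k * (m i : ℝ) / edge j - 1⌉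
  set T := (Finset.Icc (k - 1) (k + 1)).biUnion fun j =>
    (Fintype.piFinset fun i => Finset.Icc (a j i) (a j i + 3)).image fun v => (j, v) with hT
  have hcard : T.card ≤ neighborBound d := by
    refine (Finset.card_biUnion_le_card_mul _ _ (4 ^ d) (fun j _ => ?_)).trans (le_of_eq ?_)
    · refine Finset.card_image_le.trans (le_of_eq ?_)
      rw [Fintype.card_piFinset]
      have : ∀ i, a j i + 3 + 1 - a j i = 4 := fun i => by ring
      simp [this]
    · simp [neighborBound]
      omega
  refine ⟨T.filter (fun Q' => Neighbor (k, m) Q'), (Finset.card_filter_le _ _).trans hcard, ?_⟩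
  rintro ⟨j, m'⟩
  rw [Finset.mem_filter, and_iff_right_iff_imp]
  intro h
  obtain ⟨h1, h2⟩ := neighbor_iff.1 h
  rw [hT, Finset.mem_biUnion]
  refine ⟨j, Finset.mem_Icc.2 h1, Finset.mem_image.2 ⟨m', ?_, rfl⟩⟩
  rw [Fintype.mem_piFinset]
  intro i
  have hj := edge_pos j
  have h3 := (h2 i).1
  have h4 := (h2 i).2
  have hkj : edge k / edge j ≤ 2 := ((half_le_edge_div_iff j k).2 h1).2
  rw [Finset.mem_Icc]
  constructor
  · rw [Int.ceil_le, sub_le_iff_le_add, div_le_iff₀ hj, mul_comm _ (edge j)]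
    exact h3
  · have h5 : (m' i : ℝ) ≤ edge k * (m i : ℝ) / edge j + edge k / edge j := by
      rw [← add_div, le_div_iff₀ hj]; linarith
    have h6 := Int.le_ceil (edge k * (m i : ℝ) / edge j - 1)
    have h7 : (m' i : ℝ) ≤ ((a j i + 3 : ℤ) : ℝ) := by push_cast; simp only [a]; linarith
    exact_mod_cast h7

/-- The finite set of neighbors of a dyadic cube. -/
noncomputable def neighbors (Q : ℤ × (Fin d → ℤ)) : Finset (ℤ × (Fin d → ℤ)) :=
  (exists_finset_neighbor Q).choose

theorem card_neighbors_le (Q : ℤ × (Fin d → ℤ)) : (neighbors Q).card ≤ neighborBound d :=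
  (exists_finset_neighbor Q).choose_spec.1

theorem mem_neighbors {Q Q' : ℤ × (Fin d → ℤ)} : Q' ∈ neighbors Q ↔ Neighbor Q Q' :=
  (exists_finset_neighbor Q).choose_spec.2 Q'

theorem tsum_neighbor (Q : ℤ × (Fin d → ℤ)) (a : ℤ × (Fin d → ℤ) → ℝ≥0∞) :
    ∑' Q' : {Q' : ℤ × (Fin d → ℤ) // Neighbor Q Q'}, a Q'.1 = ∑ Q' ∈ neighbors Q, a Q' := by
  rw [← Finset.tsum_subtype, ← (Equiv.subtypeEquivRight (fun Q' => mem_neighbors (Q := Q)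
    (Q' := Q'))).tsum_eq]
  rfl

/-! ### Averages over cubes -/

theorem isBounded_dyadicCube (k : ℤ) (m : Fin d → ℤ) : Bornology.IsBounded (dyadicCube k m) := by
  rw [dyadicCube_eq_preimage]
  refine (PiLp.antilipschitzWith_ofLp 2 (fun _ : Fin d => ℝ)).isBounded_preimage ?_
  exact Bornology.IsBounded.pi fun i => Metric.isBounded_Ioc _ _

theorem integrableOn_dyadicCube {F : Type*} [NormedAddCommGroup F] {f : Eucl d → F}
    (hf : LocallyIntegrable f volume) (k : ℤ) (m : Fin d → ℤ) :
    IntegrableOn f (dyadicCube k m) volume := by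
  obtain ⟨R, hR⟩ := (isBounded_dyadicCube k m).subset_closedBall 0
  exact (hf.integrableOn_isCompact (isCompact_closedBall _ _)).mono_set hR

/-- Jensen's inequality for the deviation of a mean value from a constant. -/
theorem enorm_setAverage_sub_rpow_le {X : Type*} [MeasurableSpace X] {ν : Measure X} {s : Set X}
    (h0 : ν s ≠ 0) (h1 : ν s ≠ ⊤) {f : X → ℂ} (hf : IntegrableOn f s ν) (c : ℂ) {p : ℝ}
    (hp : 1 ≤ p) :
    ‖(⨍ x in s, f x ∂ν) - c‖ₑ ^ p ≤ (ν s)⁻¹ * ∫⁻ x in s, ‖f x - c‖ₑ ^ p ∂ν := by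
  have hp0 : 0 ≤ p := by linarith
  have hm0 : ν.real s ≠ 0 := (ENNReal.toReal_pos h0 h1).ne'
  have e1 : (⨍ x in s, f x ∂ν) - c = (ν.real s)⁻¹ • ∫ x in s, (f x - c) ∂ν := by
    rw [integral_sub hf (integrableOn_const h1), setAverage_eq, smul_sub, setIntegral_const,
      inv_smul_smul₀ hm0]
  have hm : AEMeasurable (fun x => ‖f x - c‖ₑ) (ν.restrict s) :=
    (hf.1.sub aestronglyMeasurable_const).enorm
  rw [e1, enorm_smul, enorm_inv hm0, Measure.real, Real.enorm_of_nonneg ENNReal.toReal_nonneg,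
    ENNReal.ofReal_toReal h1, ENNReal.mul_rpow_of_nonneg _ _ hp0]
  calc _ ≤ (ν s)⁻¹ ^ p * (∫⁻ x in s, ‖f x - c‖ₑ ∂ν) ^ p := by
        gcongr; exact enorm_integral_le_lintegral_enorm _
    _ ≤ (ν s)⁻¹ ^ p * ((ν s) ^ (p - 1) * ∫⁻ x in s, ‖f x - c‖ₑ ^ p ∂ν) := by
        gcongr
        have := lintegral_rpow_le hp hm
        rwa [Measure.restrict_apply_univ] at this
    _ = _ := by
        rw [← mul_assoc]
        congr 1
        rw [ENNReal.rpow_sub _ _ h0 h1, ENNReal.rpow_one, ENNReal.inv_rpow, div_eq_mul_inv,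
          ← mul_assoc, ENNReal.inv_mul_cancel, one_mul]
        · exact (ENNReal.rpow_pos (pos_iff_ne_zero.2 h0) h1).ne'
        · exact ENNReal.rpow_ne_top_of_nonneg hp0 h1

theorem enorm_cubeAverage_rpow_le {f : Eucl d → ℂ} (hf : LocallyIntegrable f volume) {p : ℝ}
    (hp : 1 ≤ p) (k : ℤ) (m : Fin d → ℤ) :
    volume (dyadicCube k m) * ‖cubeAverage f (k, m)‖ₑ ^ p ≤
      ∫⁻ x in dyadicCube k m, ‖f x‖ₑ ^ p := by
  have h := enorm_setAverage_sub_rpow_le (volume_dyadicCube_ne_zero k m)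
    (volume_dyadicCube_ne_top k m) (integrableOn_dyadicCube hf k m) 0 hp
  simp only [sub_zero] at h
  calc _ ≤ volume (dyadicCube k m) * ((volume (dyadicCube k m))⁻¹ *
        ∫⁻ x in dyadicCube k m, ‖f x‖ₑ ^ p) := by gcongr; exact h
    _ = _ := by
      rw [← mul_assoc, ENNReal.mul_inv_cancel (volume_dyadicCube_ne_zero k m)
        (volume_dyadicCube_ne_top k m), one_mul]

/-- Points of neighboring cubes are close to each other. -/
theorem dist_le_of_neighbor {k j : ℤ} {m m' : Fin d → ℤ} (h : Neighbor (k, m) (j, m'))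
    {y z : Eucl d} (hy : y ∈ dyadicCube k m) (hz : z ∈ dyadicCube j m') :
    dist z y ≤ 3 * d * edge k := by
  obtain ⟨h1, h2⟩ := neighbor_iff.1 h
  have hj : edge j ≤ 2 * edge k := by
    have := (half_le_edge_div_iff j k).2 h1
    have := this.1
    rw [le_div_iff₀ (edge_pos j)] at this
    linarith
  have hi : ∀ i, |z i - y i| ≤ 3 * edge k := by
    intro i
    have a1 := hy i
    have a2 := hz i
    have a3 := h2 i
    rw [abs_le]
    constructor <;> nlinarith
  rw [EuclideanSpace.dist_eq]
  refine Real.sqrt_le_iff.2 ⟨by have := edge_pos k; positivity, ?_⟩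
  have h3 : ∀ i ∈ Finset.univ, dist (z i) (y i) ^ 2 ≤ (3 * edge k) ^ 2 := by
    intro i _
    rw [Real.dist_eq]
    exact pow_le_pow_left₀ (abs_nonneg _) (hi i) 2
  refine (Finset.sum_le_card_nsmul _ _ _ h3).trans ?_
  rw [Finset.card_univ, Fintype.card_fin, nsmul_eq_mul]
  have h4 : (d : ℝ) ≤ (d : ℝ) ^ 2 := by exact_mod_cast Nat.le_self_pow (by norm_num) d
  nlinarith [sq_nonneg (edge k)]

/-- The contribution of one pair of neighbors to the Besov norm. -/
theorem enorm_cubeAverage_sub_rpow_le {f : Eucl d → ℂ} (hf : LocallyIntegrable f volume) {p : ℝ}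
    (hp : 1 ≤ p) {k j : ℤ} {m m' : Fin d → ℤ} (h : Neighbor (k, m) (j, m')) :
    volume (dyadicCube k m) * ‖cubeAverage f (k, m) - cubeAverage f (j, m')‖ₑ ^ p ≤
      (ENNReal.ofReal (edge k / 2) ^ d)⁻¹ * ∫⁻ y in dyadicCube k m,
        ∫⁻ z in Metric.closedBall y (3 * d * edge k), ‖f z - f y‖ₑ ^ p := by
  have hv0 := volume_dyadicCube_ne_zero k m
  have hv1 := volume_dyadicCube_ne_top k m
  have h1 := enorm_setAverage_sub_rpow_le hv0 hv1 (integrableOn_dyadicCube hf k m)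
    (cubeAverage f (j, m')) hp
  have hvol : (volume (dyadicCube j m'))⁻¹ ≤ (ENNReal.ofReal (edge k / 2) ^ d)⁻¹ := by
    rw [volume_dyadicCube, ENNReal.inv_le_inv]
    gcongr
    have := ((half_le_edge_div_iff j k).2 (neighbor_iff.1 h).1).2
    rw [div_le_iff₀ (edge_pos j)] at this
    linarith
  have h2 : ∀ y ∈ dyadicCube k m, ‖f y - cubeAverage f (j, m')‖ₑ ^ p ≤
      (ENNReal.ofReal (edge k / 2) ^ d)⁻¹ *
        ∫⁻ z in Metric.closedBall y (3 * d * edge k), ‖f z - f y‖ₑ ^ p := by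
    intro y hy
    have h3 := enorm_setAverage_sub_rpow_le (volume_dyadicCube_ne_zero j m')
      (volume_dyadicCube_ne_top j m') (integrableOn_dyadicCube hf j m') (f y) hp
    rw [← neg_sub, enorm_neg]
    refine h3.trans (mul_le_mul' hvol (lintegral_mono_set fun z hz => ?_))
    exact Metric.mem_closedBall.2 (dist_le_of_neighbor h hy hz)
  calc _ ≤ volume (dyadicCube k m) * ((volume (dyadicCube k m))⁻¹ *
        ∫⁻ y in dyadicCube k m, ‖f y - cubeAverage f (j, m')‖ₑ ^ p) := by gcongr; exact h1
    _ = ∫⁻ y in dyadicCube k m, ‖f y - cubeAverage f (j, m')‖ₑ ^ p := by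
      rw [← mul_assoc, ENNReal.mul_inv_cancel hv0 hv1, one_mul]
    _ ≤ ∫⁻ y in dyadicCube k m, (ENNReal.ofReal (edge k / 2) ^ d)⁻¹ *
        ∫⁻ z in Metric.closedBall y (3 * d * edge k), ‖f z - f y‖ₑ ^ p :=
      setLIntegral_mono' (measurableSet_dyadicCube k m) h2
    _ = _ := lintegral_const_mul' _ _ (ENNReal.inv_ne_top.2 (pow_ne_zero _ (by
      simpa using edge_pos k)))

/-- The part of the Besov norm coming from the cubes of one level is controlled by the
`L^p` modulus of continuity at the scale of the cubes. -/
theorem tsum_level_le {f : Eucl d → ℂ} (hfm : StronglyMeasurable f)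
    (hf : LocallyIntegrable f volume) {p : ℝ} (hp : 1 ≤ p) (k : ℤ) {M : ℝ≥0∞}
    (hM : ∀ h : Eucl d, ‖h‖ ≤ 3 * d * edge k → ∫⁻ y, ‖f (y + h) - f y‖ₑ ^ p ≤ M) :
    (∑' m : Fin d → ℤ, volume (dyadicCube k m) *
        ∑' Q' : {Q' : ℤ × (Fin d → ℤ) // Neighbor (k, m) Q'},
          ‖cubeAverage f (k, m) - cubeAverage f Q'.1‖ₑ ^ p) ≤
      neighborBound d * (ENNReal.ofReal (6 * d) ^ d * volume (Metric.ball (0 : Eucl d) 1)) * M := by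
  set c : ℝ≥0∞ := (ENNReal.ofReal (edge k / 2) ^ d)⁻¹
  set ρ : ℝ := 3 * d * edge k
  have hρ : 0 ≤ ρ := by have := edge_pos k; positivity
  have h1 : ∀ m : Fin d → ℤ, volume (dyadicCube k m) *
        ∑' Q' : {Q' : ℤ × (Fin d → ℤ) // Neighbor (k, m) Q'},
          ‖cubeAverage f (k, m) - cubeAverage f Q'.1‖ₑ ^ p ≤
      neighborBound d * (c * ∫⁻ y in dyadicCube k m,
        ∫⁻ z in Metric.closedBall y ρ, ‖f z - f y‖ₑ ^ p) := by
    intro m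
    rw [tsum_neighbor (k, m) (fun Q' => ‖cubeAverage f (k, m) - cubeAverage f Q'‖ₑ ^ p),
      Finset.mul_sum]
    refine (Finset.sum_le_card_nsmul _ _ _ (fun Q' hQ' =>
      enorm_cubeAverage_sub_rpow_le hf hp (mem_neighbors.1 hQ'))).trans ?_
    rw [nsmul_eq_mul]
    gcongr
    exact card_neighbors_le _
  refine (ENNReal.tsum_le_tsum h1).trans ?_
  rw [ENNReal.tsum_mul_left, ENNReal.tsum_mul_left, tsum_lintegral_dyadicCube]
  have hmeas : Measurable (fun w : Eucl d × Eucl d => ‖f (w.1 + w.2) - f w.1‖ₑ ^ p) :=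
    (((hfm.comp_measurable (by fun_prop)).sub
      (hfm.comp_measurable measurable_fst)).enorm).pow_const p
  have h2 : ∀ y, ∫⁻ z in Metric.closedBall y ρ, ‖f z - f y‖ₑ ^ p =
      ∫⁻ h in Metric.closedBall 0 ρ, ‖f (y + h) - f y‖ₑ ^ p := by
    intro y
    have := (measurePreserving_add_left (volume : Measure (Eucl d)) y).setLIntegral_comp_emb
      (measurableEmbedding_addLeft y) (fun z => ‖f z - f y‖ₑ ^ p) (Metric.closedBall 0 ρ)
    rw [this]
    congr 2
    ext z
    simp [neg_add_eq_sub, dist_eq_norm]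
  simp_rw [h2]
  rw [lintegral_lintegral_swap hmeas.aemeasurable]
  have h3 : ∫⁻ h in Metric.closedBall (0 : Eucl d) ρ, ∫⁻ y, ‖f (y + h) - f y‖ₑ ^ p ≤
      ∫⁻ _ in Metric.closedBall (0 : Eucl d) ρ, M :=
    setLIntegral_mono measurable_const (fun h hh => hM h (by simpa using hh))
  rw [setLIntegral_const, Measure.addHaar_closedBall _ _ hρ, finrank_euclideanSpace_fin] at h3
  calc _ ≤ (neighborBound d : ℝ≥0∞) * (c * (M * (ENNReal.ofReal (ρ ^ d) *
        volume (Metric.ball (0 : Eucl d) 1)))) := by gcongr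
    _ = neighborBound d * ((c * ENNReal.ofReal (ρ ^ d)) * volume (Metric.ball (0 : Eucl d) 1)) *
        M := by ring
    _ = _ := by
      congr 3
      have h4 : 0 < edge k / 2 := by have := edge_pos k; positivity
      rw [ENNReal.ofReal_pow hρ]
      have h5 : ENNReal.ofReal ρ = ENNReal.ofReal (edge k / 2) * ENNReal.ofReal (6 * d) := by
        rw [← ENNReal.ofReal_mul h4.le]
        congr 1; simp only [ρ]; ring
      rw [h5, mul_pow, ← mul_assoc, ENNReal.inv_mul_cancel, one_mul]
      · exact pow_ne_zero _ (by simpa using edge_pos k)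
      · exact ENNReal.pow_ne_top ENNReal.ofReal_ne_top

end Dyadic

/-! ### Boundedness of the trace -/

section TraceBound

variable {d : ℕ}

theorem lintegral_column_weight_le {α p : ℝ} {a : Eucl (d + 1) → ℝ≥0∞}
    (ha : Measurable a) :
    ∫⁻ y : Eucl d, ∫⁻ t in Ioo (0 : ℝ) 1, a (glue (y, t)) ^ p * ENNReal.ofReal (t ^ α) ≤
      ∫⁻ x, a x ^ p ∂(weightMeasure d α) := by
  rw [lintegral_weightMeasure (ha.pow_const p).aemeasurable]
  refine lintegral_mono (fun y => ?_)
  refine le_trans (le_of_eq ?_) (lintegral_mono_set (s := Ioo (0 : ℝ) 1) Ioo_subset_Ioi_self)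
  refine setLIntegral_congr_fun measurableSet_Ioo (fun t ht => ?_)
  rw [weight_of_mem_Ioc ⟨ht.1, ht.2.le⟩, mul_comm]

/-- Hardy's inequality on the half-space, for integrals over vertical segments of dyadic length. -/
theorem exists_hardy_halfSpace (d : ℕ) {p α : ℝ} (hp : 1 ≤ p) (hαp : α < p - 1) :
    ∃ C : ℝ≥0, ∀ a : Eucl (d + 1) → ℝ≥0∞, Measurable a →
      ∑' k : ℕ, ENNReal.ofReal ((2 : ℝ) ^ ((k : ℝ) * (p - 1 - α))) *
        ∫⁻ y : Eucl d, (∫⁻ t in Ioo (0 : ℝ) ((2 : ℝ) ^ (-(k : ℝ))), a (glue (y, t))) ^ p ≤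
      C * ∫⁻ x, a x ^ p ∂(weightMeasure d α) := by
  obtain ⟨C, hC⟩ := exists_hardy hp hαp
  refine ⟨C, fun a ha => ?_⟩
  have ham : Measurable (fun z : Eucl d × ℝ => a (glue z)) := ha.comp glue.measurable
  have hm : ∀ k : ℕ, Measurable (fun y : Eucl d =>
      (∫⁻ t in Ioo (0 : ℝ) ((2 : ℝ) ^ (-(k : ℝ))), a (glue (y, t))) ^ p) := fun k =>
    ham.lintegral_prod_right'.pow_const p
  simp_rw [← fun k : ℕ => lintegral_const_mul (μ := (volume : Measure (Eucl d)))
    (ENNReal.ofReal ((2 : ℝ) ^ ((k : ℝ) * (p - 1 - α)))) (hm k)]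
  rw [← lintegral_tsum (fun k => ((hm k).const_mul _).aemeasurable)]
  refine le_trans ?_ (mul_le_mul_right (lintegral_column_weight_le ha) _)
  rw [← lintegral_const_mul' _ _ ENNReal.coe_ne_top]
  exact lintegral_mono (fun y => hC (fun t => a (glue (y, t))) (ham.comp (by fun_prop)))

/-- The case `k = 0` of Hardy's inequality: integrals over vertical segments of length `1`. -/
theorem exists_hardy_unit (d : ℕ) {p α : ℝ} (hp : 1 ≤ p) (hαp : α < p - 1) :
    ∃ C : ℝ≥0, ∀ a : Eucl (d + 1) → ℝ≥0∞, Measurable a →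
      ∫⁻ y : Eucl d, (∫⁻ t in Ioo (0 : ℝ) 1, a (glue (y, t))) ^ p ≤
      C * ∫⁻ x, a x ^ p ∂(weightMeasure d α) := by
  obtain ⟨C, hC⟩ := exists_hardy_halfSpace d hp hαp
  refine ⟨C, fun a ha => le_trans ?_ (hC a ha)⟩
  refine le_trans (le_of_eq ?_) (ENNReal.le_tsum 0)
  simp

theorem eLpNorm_eq_lintegral {X : Type*} [MeasurableSpace X] {ν : Measure X} {F : Type*}
    [NormedAddCommGroup F] {p : ℝ} (hp : 1 ≤ p) (u : X → F) :
    eLpNorm u (ENNReal.ofReal p) ν = (∫⁻ x, ‖u x‖ₑ ^ p ∂ν) ^ (1 / p) := by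
  have hp0 : 0 < p := by linarith
  rw [eLpNorm_eq_lintegral_rpow_enorm_toReal (by simpa using hp0) ENNReal.ofReal_ne_top,
    ENNReal.toReal_ofReal hp0.le]

theorem lintegral_eq_eLpNorm_rpow {X : Type*} [MeasurableSpace X] {ν : Measure X} {F : Type*}
    [NormedAddCommGroup F] {p : ℝ} (hp : 1 ≤ p) (u : X → F) :
    ∫⁻ x, ‖u x‖ₑ ^ p ∂ν = eLpNorm u (ENNReal.ofReal p) ν ^ p := by
  rw [eLpNorm_eq_lintegral hp, ← ENNReal.rpow_mul, one_div_mul_cancel (by linarith),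
    ENNReal.rpow_one]

theorem rpow_inv_le_of_le_mul {p : ℝ} (hp : 1 ≤ p) {C a b : ℝ≥0∞} (h : a ≤ C * b ^ p) :
    a ^ (1 / p) ≤ C ^ (1 / p) * b := by
  have hp0 : 0 < p := by linarith
  refine (ENNReal.rpow_le_rpow h (by positivity)).trans (le_of_eq ?_)
  rw [ENNReal.mul_rpow_of_nonneg _ _ (by positivity), ← ENNReal.rpow_mul,
    mul_one_div_cancel hp0.ne', ENNReal.rpow_one]

theorem exists_eLpNorm_bdry_le (d : ℕ) {p α : ℝ} (hp : 1 ≤ p) (hαp : α < p - 1) :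
    ∃ C : ℝ≥0, ∀ (f : Eucl (d + 1) → ℂ) (g : Eucl (d + 1) → EuclideanSpace ℂ (Fin (d + 1))),
      IsNormalPair f g → eLpNorm (bdry f g) (ENNReal.ofReal p) volume ≤
        C * (eLpNorm f (ENNReal.ofReal p) (weightMeasure d α) +
          eLpNorm g (ENNReal.ofReal p) (weightMeasure d α)) := by
  obtain ⟨C, hC⟩ := exists_hardy_unit d hp hαp
  have hp0 : 0 < p := by linarith
  refine ⟨(2 ^ (p - 1) * C) ^ (1 / p), fun f g H => ?_⟩
  rw [eLpNorm_eq_lintegral hp (bdry f g), ENNReal.coe_rpow_of_nonneg _ (by positivity)]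
  refine rpow_inv_le_of_le_mul hp ?_
  have h1 := hC _ H.measurable_fun.enorm
  have h2 := hC _ H.measurable_grad.enorm
  rw [lintegral_eq_eLpNorm_rpow hp] at h1 h2
  have hm : Measurable (fun y : Eucl d => (∫⁻ t in Ioo (0 : ℝ) 1, ‖f (glue (y, t))‖ₑ) ^ p) :=
    ((H.measurable_fun.comp_measurable glue.measurable).enorm.lintegral_prod_right').pow_const p
  calc ∫⁻ y, ‖bdry f g y‖ₑ ^ p
      ≤ ∫⁻ y, 2 ^ (p - 1) * ((∫⁻ t in Ioo (0 : ℝ) 1, ‖f (glue (y, t))‖ₑ) ^ p +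
          column g 1 y ^ p) := by
        refine lintegral_mono_ae ?_
        filter_upwards [H.ae_enorm_bdry_le] with y hy
        exact (ENNReal.rpow_le_rpow hy hp0.le).trans (ENNReal.rpow_add_le_mul_rpow_add_rpow _ _ hp)
    _ = 2 ^ (p - 1) * ((∫⁻ y : Eucl d, (∫⁻ t in Ioo (0 : ℝ) 1, ‖f (glue (y, t))‖ₑ) ^ p) +
          ∫⁻ y, column g 1 y ^ p) := by
        rw [lintegral_const_mul' _ _ (by finiteness), lintegral_add_left hm]
    _ ≤ 2 ^ (p - 1) * (C * eLpNorm f (ENNReal.ofReal p) (weightMeasure d α) ^ p +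
          C * eLpNorm g (ENNReal.ofReal p) (weightMeasure d α) ^ p) := by
        gcongr
        exact h2
    _ = 2 ^ (p - 1) * C * (eLpNorm f (ENNReal.ofReal p) (weightMeasure d α) ^ p +
          eLpNorm g (ENNReal.ofReal p) (weightMeasure d α) ^ p) := by ring
    _ ≤ 2 ^ (p - 1) * C * (eLpNorm f (ENNReal.ofReal p) (weightMeasure d α) +
          eLpNorm g (ENNReal.ofReal p) (weightMeasure d α)) ^ p := by
        gcongr
        exact ENNReal.add_rpow_le_rpow_add _ _ hp
    _ = _ := by
        rw [ENNReal.coe_mul, ENNReal.coe_rpow_of_ne_zero (by norm_num)]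
        rfl

theorem quasiMeasurePreserving_add_right (h : Eucl d) :
    Measure.QuasiMeasurePreserving (fun y : Eucl d => y + h) volume volume :=
  (measurePreserving_add_right volume h).quasiMeasurePreserving

/-- A difference of boundary values is estimated by going up from the boundary, moving
horizontally, and going down again. -/
theorem IsNormalPair.ae_enorm_bdry_sub_le {f : Eucl (d + 1) → ℂ}
    {g : Eucl (d + 1) → EuclideanSpace ℂ (Fin (d + 1))} (H : IsNormalPair f g) (h : Eucl d)
    (r : ℝ) :
    ∀ᵐ y : Eucl d, ENNReal.ofReal r * ‖bdry f g (y + h) - bdry f g y‖ₑ ≤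
      (d + 1) * ‖h‖ₑ * (∫⁻ s in Ioc (0 : ℝ) 1, column g r (y + s • h)) +
        ENNReal.ofReal r * (column g r y + column g r (y + h)) := by
  have h1 := (quasiMeasurePreserving_add_right h).ae H.ae_enorm_sub_bdry_le
  filter_upwards [H.ae_enorm_sub_bdry_le, h1, Measure.ae_ae_of_ae_prod (H.ae_horizontal h)]
    with y hy hyh hz
  have hgm : Measurable (fun w : ℝ × ℝ => ‖g (glue (y + w.2 • h, w.1))‖ₑ) :=
    H.measurable_enorm_grad.comp (f := fun w : ℝ × ℝ => (y + w.2 • h, w.1)) (by fun_prop)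
  have key : ∀ᵐ t ∂(volume.restrict (Ioo (0 : ℝ) r)),
      ‖bdry f g (y + h) - bdry f g y‖ₑ ≤
        (d + 1) * ‖h‖ₑ * (∫⁻ s in Ioc (0 : ℝ) 1, ‖g (glue (y + s • h, t))‖ₑ) +
          (column g r y + column g r (y + h)) := by
    have hle : ae (volume.restrict (Ioo (0 : ℝ) r)) ≤ ae (volume.restrict (Ioi (0 : ℝ))) :=
      ae_mono (Measure.restrict_mono Ioo_subset_Ioi_self le_rfl)
    filter_upwards [hle hy, hle hyh, hle hz, ae_restrict_mem measurableSet_Ioo] with t a1 a2 a3 a4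
    have b1 := a1 r a4.2
    have b2 := a2 r a4.2
    calc ‖bdry f g (y + h) - bdry f g y‖ₑ
        = ‖(f (glue (y + h, t)) - f (glue (y, t))) +
            ((f (glue (y, t)) - bdry f g y) - (f (glue (y + h, t)) - bdry f g (y + h)))‖ₑ := by
          congr 1; ring
      _ ≤ ‖f (glue (y + h, t)) - f (glue (y, t))‖ₑ + (‖f (glue (y, t)) - bdry f g y‖ₑ +
            ‖f (glue (y + h, t)) - bdry f g (y + h)‖ₑ) :=
          (enorm_add_le _ _).trans (by gcongr; exact enorm_sub_le)
      _ ≤ _ := by gcongr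
  have h2 := lintegral_mono_ae key
  rw [lintegral_add_right _ measurable_const, lintegral_const_mul' _ _ (by finiteness),
    lintegral_lintegral_swap (f := fun t s => ‖g (glue (y + s • h, t))‖ₑ) hgm.aemeasurable,
    setLIntegral_const, setLIntegral_const, Real.volume_Ioo, sub_zero] at h2
  rw [mul_comm, mul_comm (ENNReal.ofReal r) (column g r y + _)]
  exact h2

/-- The `L^p` modulus of continuity of the boundary values at scale `r`. -/
theorem IsNormalPair.lintegral_bdry_sub_le {f : Eucl (d + 1) → ℂ}
    {g : Eucl (d + 1) → EuclideanSpace ℂ (Fin (d + 1))} (H : IsNormalPair f g) {h : Eucl d}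
    {r K p : ℝ} (hr : 0 < r) (hK : 0 ≤ K) (hh : ‖h‖ ≤ K * r) (hp : 1 ≤ p) :
    ∫⁻ y, ‖bdry f g (y + h) - bdry f g y‖ₑ ^ p ≤
      2 ^ (p - 1) * (((d + 1) * ENNReal.ofReal K) ^ p + 2 ^ (p - 1) * 2) *
        ∫⁻ y, column g r y ^ p := by
  have hp0 : 0 < p := by linarith
  set c : ℝ≥0∞ := (d + 1) * ENNReal.ofReal K
  have hcol := H.measurable_column r
  have hr0 : ENNReal.ofReal r ≠ 0 := by simpa using hr
  have hm1 : Measurable (fun w : Eucl d × ℝ => column g r (w.1 + w.2 • h) ^ p) :=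
    (hcol.comp (by fun_prop)).pow_const p
  have hm2 : Measurable (fun y => ∫⁻ s in Ioc (0 : ℝ) 1, column g r (y + s • h) ^ p) :=
    hm1.lintegral_prod_right'
  have h1 : ∀ᵐ y : Eucl d, ‖bdry f g (y + h) - bdry f g y‖ₑ ^ p ≤
      2 ^ (p - 1) * (c ^ p * (∫⁻ s in Ioc (0 : ℝ) 1, column g r (y + s • h) ^ p) +
        2 ^ (p - 1) * (column g r y ^ p + column g r (y + h) ^ p)) := by
    filter_upwards [H.ae_enorm_bdry_sub_le h r] with y hy
    have h2 : ‖bdry f g (y + h) - bdry f g y‖ₑ ≤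
        c * (∫⁻ s in Ioc (0 : ℝ) 1, column g r (y + s • h)) +
          (column g r y + column g r (y + h)) := by
      refine (ENNReal.mul_le_mul_iff_right hr0 ENNReal.ofReal_ne_top).1 (hy.trans ?_)
      rw [mul_add (ENNReal.ofReal r) (c * _)]
      gcongr ?_ + _
      have : ‖h‖ₑ ≤ ENNReal.ofReal K * ENNReal.ofReal r := by
        rw [← ENNReal.ofReal_mul hK, ← ofReal_norm]
        exact ENNReal.ofReal_le_ofReal hh
      calc _ ≤ (d + 1) * (ENNReal.ofReal K * ENNReal.ofReal r) *
            ∫⁻ s in Ioc (0 : ℝ) 1, column g r (y + s • h) := by gcongr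
        _ = _ := by ring
    have h3 : (∫⁻ s in Ioc (0 : ℝ) 1, column g r (y + s • h)) ^ p ≤
        ∫⁻ s in Ioc (0 : ℝ) 1, column g r (y + s • h) ^ p := by
      have := lintegral_rpow_le (ν := volume.restrict (Ioc (0 : ℝ) 1)) hp
        (a := fun s => column g r (y + s • h)) (hcol.comp (by fun_prop)).aemeasurable
      simpa using this
    refine (ENNReal.rpow_le_rpow h2 hp0.le).trans ?_
    refine (ENNReal.rpow_add_le_mul_rpow_add_rpow _ _ hp).trans ?_
    rw [ENNReal.mul_rpow_of_nonneg _ _ hp0.le]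
    gcongr
    exact ENNReal.rpow_add_le_mul_rpow_add_rpow _ _ hp
  have h4 : ∫⁻ y, ∫⁻ s in Ioc (0 : ℝ) 1, column g r (y + s • h) ^ p = ∫⁻ y, column g r y ^ p := by
    rw [lintegral_lintegral_swap hm1.aemeasurable]
    simp_rw [fun s : ℝ => lintegral_add_right_eq_self (μ := (volume : Measure (Eucl d)))
      (fun y => column g r y ^ p) (s • h)]
    simp
  have h5 := lintegral_add_right_eq_self (μ := (volume : Measure (Eucl d)))
    (fun y => column g r y ^ p) h
  refine (lintegral_mono_ae h1).trans (le_of_eq ?_)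
  rw [lintegral_const_mul' _ _ (by finiteness), lintegral_add_left (hm2.const_mul _),
    lintegral_const_mul _ hm2, lintegral_const_mul' _ _ (by finiteness),
    lintegral_add_left (hcol.pow_const p), h4, h5]
  ring

theorem besovNorm_self {s p : ℝ} (hp : 1 ≤ p) (f : Eucl d → ℂ) :
    besovNorm s p p f = eLpNorm f (ENNReal.ofReal p) volume +
      (∑' k : ℕ, ENNReal.ofReal ((2 : ℝ) ^ ((k : ℝ) * s * p)) *
        ∑' m : Fin d → ℤ, volume (dyadicCube (k : ℤ) m) *
          ∑' Q' : {Q' : ℤ × (Fin d → ℤ) // Neighbor ((k : ℤ), m) Q'},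
            ‖cubeAverage f ((k : ℤ), m) - cubeAverage f Q'.1‖ₑ ^ p) ^ (1 / p) := by
  rw [besovNorm, div_self (by linarith)]
  simp

/-- The boundary values lie in the Besov space: the `L^p` modulus of continuity of the boundary
values at scale `2^{-k}` is controlled by the columns of height `2^{-k}`, and Hardy's inequality
sums over `k`. -/
theorem exists_besovNorm_bdry_le (d : ℕ) {p α : ℝ} (hp : 1 ≤ p) (hαp : α < p - 1) :
    ∃ C : ℝ≥0, ∀ (f : Eucl (d + 1) → ℂ) (g : Eucl (d + 1) → EuclideanSpace ℂ (Fin (d + 1))),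
      IsNormalPair f g → besovNorm (1 - (α + 1) / p) p p (bdry f g) ≤
        C * (eLpNorm f (ENNReal.ofReal p) (weightMeasure d α) +
          eLpNorm g (ENNReal.ofReal p) (weightMeasure d α)) := by
  have hp0 : 0 < p := by linarith
  obtain ⟨C1, hC1⟩ := exists_eLpNorm_bdry_le d hp hαp
  obtain ⟨C2, hC2⟩ := exists_hardy_halfSpace d hp hαp
  set A : ℝ≥0∞ := neighborBound d *
    (ENNReal.ofReal (6 * d) ^ d * volume (Metric.ball (0 : Eucl d) 1))
  set B : ℝ≥0∞ := 2 ^ (p - 1) * (((d + 1) * ENNReal.ofReal (3 * d)) ^ p + 2 ^ (p - 1) * 2)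
  have hA : A ≠ ⊤ := by
    have : volume (Metric.ball (0 : Eucl d) 1) ≠ ⊤ := measure_ball_lt_top.ne
    finiteness
  have hB : B ≠ ⊤ := by finiteness
  have hD : (A * B * C2) ^ (1 / p) ≠ ⊤ := by finiteness
  refine ⟨C1 + ((A * B * C2) ^ (1 / p)).toNNReal, fun f g H => ?_⟩
  rw [besovNorm_self hp, ENNReal.coe_add, ENNReal.coe_toNNReal hD, add_mul]
  refine add_le_add (hC1 f g H) ?_
  have hlev : ∀ k : ℕ, ENNReal.ofReal ((2 : ℝ) ^ ((k : ℝ) * (1 - (α + 1) / p) * p)) *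
        ∑' m : Fin d → ℤ, volume (dyadicCube (k : ℤ) m) *
          ∑' Q' : {Q' : ℤ × (Fin d → ℤ) // Neighbor ((k : ℤ), m) Q'},
            ‖cubeAverage (bdry f g) ((k : ℤ), m) - cubeAverage (bdry f g) Q'.1‖ₑ ^ p ≤
      A * B * (ENNReal.ofReal ((2 : ℝ) ^ ((k : ℝ) * (p - 1 - α))) *
        ∫⁻ y : Eucl d, (∫⁻ t in Ioo (0 : ℝ) ((2 : ℝ) ^ (-(k : ℝ))), ‖g (glue (y, t))‖ₑ) ^ p) := by
    intro k
    have h1 := tsum_level_le H.stronglyMeasurable_bdry H.locallyIntegrable_bdry hp (k : ℤ)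
      (fun h hh => H.lintegral_bdry_sub_le (edge_pos k) (by positivity) hh hp)
    have e1 : (k : ℝ) * (1 - (α + 1) / p) * p = (k : ℝ) * (p - 1 - α) := by
      field_simp; ring
    rw [e1]
    refine (mul_le_mul_right h1 _).trans (le_of_eq ?_)
    simp only [column, edge_natCast]
    ring
  have h2 := (ENNReal.tsum_le_tsum hlev).trans (le_of_eq ENNReal.tsum_mul_left)
  have h3 := hC2 _ H.measurable_grad.enorm
  rw [lintegral_eq_eLpNorm_rpow hp] at h3
  have h4 := h2.trans (mul_le_mul_right h3 _)
  rw [← mul_assoc] at h4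
  refine (rpow_inv_le_of_le_mul hp h4).trans ?_
  gcongr
  exact le_add_self

end TraceBound

/-! ### The trace operator -/

section TraceOperator

variable {d : ℕ}

theorem HasTraceAt.congr {μ : Measure (Eucl (d + 1))} {f f' : Eucl (d + 1) → ℂ}
    (h : f =ᵐ[μ] f') {x : Eucl d} {c : ℂ} (hf : HasTraceAt μ f x c) : HasTraceAt μ f' x c := by
  refine ⟨fun r hr => (hf.1 r hr).congr (ae_restrict_of_ae h), ?_⟩
  refine hf.2.congr (fun r => ?_)
  rw [setAverage_eq, setAverage_eq, integral_congr_ae (ae_restrict_of_ae h)]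

theorem HasTraceAt.trace_eq {μ : Measure (Eucl (d + 1))} {f : Eucl (d + 1) → ℂ} {x : Eucl d}
    {c : ℂ} (h : HasTraceAt μ f x c) : trace μ f x = c :=
  h.2.limUnder_eq

theorem HasTraceAt.linear {μ : Measure (Eucl (d + 1))} {f g : Eucl (d + 1) → ℂ} {x : Eucl d}
    {c e : ℂ} (hf : HasTraceAt μ f x c) (hg : HasTraceAt μ g x e) (a b : ℂ) :
    HasTraceAt μ (a • f + b • g) x (a * c + b * e) := by
  refine ⟨fun r hr => ((hf.1 r hr).smul a).add ((hg.1 r hr).smul b), ?_⟩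
  refine ((hf.2.const_mul a).add (hg.2.const_mul b)).congr' ?_
  filter_upwards [self_mem_nhdsWithin] with r hr
  have h := integral_add ((hf.1 r hr).smul a) ((hg.1 r hr).smul b)
  simp only [setAverage_eq]
  simp only [Pi.add_apply, Pi.smul_apply, smul_eq_mul] at h ⊢
  rw [h, integral_const_mul, integral_const_mul, smul_add, mul_smul_comm, mul_smul_comm]

theorem eLpNorm_congr_halfSpace {F : Type*} [NormedAddCommGroup F] {α : ℝ} {q : ℝ≥0∞}
    {u v : Eucl (d + 1) → F} (h : u =ᵐ[volume.restrict (halfSpace d)] v) :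
    eLpNorm u q (weightMeasure d α) = eLpNorm v q (weightMeasure d α) :=
  eLpNorm_congr_ae ((weightMeasure_absolutelyContinuous α).ae_le h)

/-- A function in `L^p(μ_α)` with a weak gradient has a trace almost everywhere, and the trace is
given by the boundary values of a normal pair. -/
theorem exists_normalPair_hasTraceAt {p α : ℝ} (hp : 1 ≤ p) (hα : -1 < α)
    {f : Eucl (d + 1) → ℂ} {g : Eucl (d + 1) → EuclideanSpace ℂ (Fin (d + 1))}
    (hf : LocIntegrableHalf f)
    (hfp : eLpNorm f (ENNReal.ofReal p) (weightMeasure d α) < ⊤) (h : IsWeakGradient f g) :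
    ∃ f' g', IsNormalPair f' g' ∧ f =ᵐ[volume.restrict (halfSpace d)] f' ∧
      g =ᵐ[volume.restrict (halfSpace d)] g' ∧
      ∀ᵐ x : Eucl d, HasTraceAt (weightMeasure d α) f x (bdry f' g' x) := by
  obtain ⟨f', g', H, e1, e2⟩ := exists_isNormalPair hf h
  refine ⟨f', g', H, e1, e2, ?_⟩
  have e1' : f' =ᵐ[weightMeasure d α] f :=
    (weightMeasure_absolutelyContinuous α).ae_le e1.symm
  filter_upwards [H.ae_hasTraceAt hα (fun x r hr => integrableOn_halfBall hα hp
    H.measurable_fun.aestronglyMeasurable (by rwa [eLpNorm_congr_ae e1']) x hr)] with x hx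
  exact hx.congr e1'

theorem exists_weakGradient {p : ℝ} {μ : Measure (Eucl (d + 1))} {f : Eucl (d + 1) → ℂ}
    (hf : f ∈ sobolevSpace d p μ) : ∃ g, IsWeakGradient f g := by
  have h := (ENNReal.add_lt_top.1 hf.2).2
  obtain ⟨g, hg⟩ := iInf_lt_iff.1 h
  obtain ⟨hg, -⟩ := iInf_lt_iff.1 hg
  exact ⟨g, hg⟩

theorem eLpNorm_lt_top_of_mem_sobolevSpace {p : ℝ} {μ : Measure (Eucl (d + 1))}
    {f : Eucl (d + 1) → ℂ} (hf : f ∈ sobolevSpace d p μ) : eLpNorm f (ENNReal.ofReal p) μ < ⊤ :=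
  (ENNReal.add_lt_top.1 hf.2).1

theorem cubeAverage_congr_ae {f f' : Eucl d → ℂ} (h : f =ᵐ[volume] f') (Q : ℤ × (Fin d → ℤ)) :
    cubeAverage f Q = cubeAverage f' Q := by
  rw [cubeAverage, cubeAverage, setAverage_eq, setAverage_eq,
    integral_congr_ae (ae_restrict_of_ae h)]

theorem besovNorm_congr_ae {s p q : ℝ} {f f' : Eucl d → ℂ} (h : f =ᵐ[volume] f') :
    besovNorm s p q f = besovNorm s p q f' := by
  simp only [besovNorm, eLpNorm_congr_ae h, cubeAverage_congr_ae h]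

theorem ae_exists_hasTraceAt {p α : ℝ} (hp : 1 ≤ p) (hα : -1 < α) {f : Eucl (d + 1) → ℂ}
    (hf : f ∈ sobolevSpace d p (weightMeasure d α)) :
    (∀ᵐ x : Eucl d, ∃ c : ℂ, HasTraceAt (weightMeasure d α) f x c) ∧
      LocallyIntegrable (trace (weightMeasure d α) f) volume := by
  obtain ⟨g, hg⟩ := exists_weakGradient hf
  obtain ⟨f', g', H, -, -, ht⟩ := exists_normalPair_hasTraceAt hp hα hf.1
    (eLpNorm_lt_top_of_mem_sobolevSpace hf) hg
  refine ⟨ht.mono fun x hx => ⟨_, hx⟩, ?_⟩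
  exact H.locallyIntegrable_bdry.congr (ht.mono fun x hx => hx.trace_eq.symm)

theorem ae_trace_linear {p α : ℝ} (hp : 1 ≤ p) (hα : -1 < α) {f g : Eucl (d + 1) → ℂ}
    (hf : f ∈ sobolevSpace d p (weightMeasure d α))
    (hg : g ∈ sobolevSpace d p (weightMeasure d α)) (a b : ℂ) :
    ∀ᵐ x : Eucl d, trace (weightMeasure d α) (a • f + b • g) x =
      a * trace (weightMeasure d α) f x + b * trace (weightMeasure d α) g x := by
  filter_upwards [(ae_exists_hasTraceAt hp hα hf).1, (ae_exists_hasTraceAt hp hα hg).1]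
    with x ⟨c, hc⟩ ⟨e, he⟩
  rw [hc.trace_eq, he.trace_eq, (hc.linear he a b).trace_eq]

theorem exists_besovNorm_trace_le (d : ℕ) {p α : ℝ} (hp : 1 ≤ p) (hα : -1 < α)
    (hαp : α < p - 1) :
    ∃ C : ℝ≥0, ∀ f ∈ sobolevSpace d p (weightMeasure d α),
      trace (weightMeasure d α) f ∈ besovSpace d (1 - (α + 1) / p) p p ∧
      besovNorm (1 - (α + 1) / p) p p (trace (weightMeasure d α) f) ≤
        C * sobolevNorm p (weightMeasure d α) f := by
  obtain ⟨C, hC⟩ := exists_besovNorm_bdry_le d hp hαp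
  have key : ∀ f ∈ sobolevSpace d p (weightMeasure d α),
      besovNorm (1 - (α + 1) / p) p p (trace (weightMeasure d α) f) ≤
        (C + 1 : ℝ≥0) * sobolevNorm p (weightMeasure d α) f := by
    intro f hf
    -- the constant is made positive, so that it can be moved inside the infimum over the gradients
    have h0 : ((C + 1 : ℝ≥0) : ℝ≥0∞) ≠ 0 := by simp
    rw [sobolevNorm, ENNReal.add_iInf₂, ENNReal.mul_iInf_of_ne h0 ENNReal.coe_ne_top]
    simp_rw [ENNReal.mul_iInf_of_ne h0 ENNReal.coe_ne_top]
    refine le_iInf₂ fun g hg => ?_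
    obtain ⟨f', g', H, e1, e2, ht⟩ := exists_normalPair_hasTraceAt hp hα hf.1
      (eLpNorm_lt_top_of_mem_sobolevSpace hf) hg
    rw [besovNorm_congr_ae (ht.mono fun x hx => hx.trace_eq), eLpNorm_congr_halfSpace e1,
      eLpNorm_congr_halfSpace e2]
    refine (hC f' g' H).trans ?_
    gcongr
    simp
  refine ⟨C + 1, fun f hf => ⟨⟨(ae_exists_hasTraceAt hp hα hf).2, ?_⟩, key f hf⟩⟩
  exact (key f hf).trans_lt (ENNReal.mul_lt_top ENNReal.coe_lt_top hf.2)

end TraceOperator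

/-! ### The Whitney extension is a locally finite sum -/

section Extension

variable {d : ℕ} {ψ : ℕ → (Fin d → ℤ) → Eucl (d + 1) → ℝ}

theorem abs_sub_le_dist (x z : Eucl (d + 1)) (i : Fin (d + 1)) : |x i - z i| ≤ dist x z := by
  rw [dist_eq_norm]
  exact PiLp.norm_apply_le (x - z) i

theorem IsWhitneyFamily.bounds_of_mem_tsupport (hψ : IsWhitneyFamily ψ) {j : ℕ} {m : Fin d → ℤ}
    {x : Eucl (d + 1)} (hx : x ∈ tsupport (ψ j m)) :
    (∀ i : Fin d, edge j * (m i : ℝ) - edge j / 4 < horizontal x i ∧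
      horizontal x i < edge j * ((m i : ℝ) + 1) + edge j / 4) ∧
      3 / 4 * edge j < x (Fin.last d) ∧ x (Fin.last d) < 9 / 4 * edge j := by
  obtain ⟨z, ⟨hz1, hz2, hz3⟩, hxz⟩ := Metric.mem_thickening_iff.1 (hψ.support_subset j m hx)
  refine ⟨fun i => ?_, ?_, ?_⟩
  · have h1 := (abs_sub_le_dist x z i.castSucc).trans_lt hxz
    have h2 : edge j * (m i : ℝ) < z i.castSucc ∧ z i.castSucc ≤ edge j * ((m i : ℝ) + 1) := hz1 i
    rw [abs_lt] at h1
    change _ < x i.castSucc ∧ x i.castSucc < _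
    constructor <;> linarith
  · have h1 := (abs_sub_le_dist x z (Fin.last d)).trans_lt hxz
    rw [abs_lt] at h1
    linarith
  · have h1 := (abs_sub_le_dist x z (Fin.last d)).trans_lt hxz
    rw [abs_lt] at h1
    linarith

/-- The layers `(2^{-k}, 2^{1-k}]`, `k ≥ 1`, and `(1, ∞)` of heights. -/
def layer (k : ℕ) : Set ℝ := {t | edge k < t ∧ (t ≤ 2 * edge k ∨ k = 0)}

theorem exists_mem_Ioc_edge {t : ℝ} (ht : 0 < t) (ht2 : t ≤ 2) :
    ∃ k : ℕ, edge k < t ∧ t ≤ 2 * edge k := by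
  obtain ⟨n, h1, h2⟩ := exists_nat_pow_near_of_lt_one (x := t / 2) (y := (1 / 2 : ℝ))
    (by linarith) (by linarith) (by norm_num) (by norm_num)
  have e : ∀ n : ℕ, edge n = (1 / 2 : ℝ) ^ n := by
    intro n; rw [edge, zpow_neg, zpow_natCast, one_div, inv_pow]
  refine ⟨n, ?_, ?_⟩
  · rw [e]; rw [pow_succ] at h1; linarith
  · rw [e]; linarith

theorem exists_mem_layer {t : ℝ} (ht : 0 < t) : ∃ k, t ∈ layer k := by
  rcases le_or_gt t 2 with h | h
  · obtain ⟨k, h1, h2⟩ := exists_mem_Ioc_edge ht h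
    exact ⟨k, h1, Or.inl h2⟩
  · refine ⟨0, ?_, Or.inr rfl⟩
    simp only [Nat.cast_zero, edge_zero]; linarith

/-- A bump function which does not vanish near a point of the Whitney box over `Q` belongs to a
neighbor of `Q`. -/
theorem IsWhitneyFamily.neighbor_of_mem_tsupport (hψ : IsWhitneyFamily ψ) {k j : ℕ}
    {m m' : Fin d → ℤ} {x : Eucl (d + 1)} (hxm : horizontal x ∈ dyadicCube k m)
    (hxk : x (Fin.last d) ∈ layer k) (hx : x ∈ tsupport (ψ j m')) :
    Neighbor ((k : ℤ), m) ((j : ℤ), m') := by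
  obtain ⟨h1, h2, h3⟩ := hψ.bounds_of_mem_tsupport hx
  obtain ⟨h4, h5⟩ := hxk
  have hk := edge_pos k
  have hj := edge_pos j
  have hjk : (j : ℤ) ≤ k + 1 := by
    by_contra! h
    have a1 : edge j ≤ edge ((k : ℤ) + 1 + 1) := edge_anti (by omega)
    have a2 := edge_succ (k : ℤ)
    have a3 := edge_succ ((k : ℤ) + 1)
    linarith
  have hkj : (k : ℤ) - 1 ≤ j := by
    rcases h5 with h5 | rfl
    · by_contra! h
      have a1 : edge ((k : ℤ) - 1 - 1) ≤ edge j := edge_anti (by omega)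
      have a2 := edge_succ ((k : ℤ) - 1)
      have a3 := edge_succ ((k : ℤ) - 1 - 1)
      rw [sub_add_cancel] at a2 a3
      linarith
    · simp
  refine neighbor_iff.2 ⟨⟨hkj, hjk⟩, fun i => ?_⟩
  obtain ⟨b1, b2⟩ := h1 i
  obtain ⟨b3, b4⟩ := hxm i
  -- an overhang by a quarter of the edge length is not enough to reach another cube, as the
  -- positions are integers
  have hcase : (j : ℤ) = k ∨ (j : ℤ) = k + 1 ∨ (k : ℤ) = j + 1 := by omega
  rcases hcase with h | h | h
  · rw [h] at b1 b2 ⊢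
    have c1 : (m i : ℝ) < m' i + 5 / 4 := by nlinarith
    have c2 : (m' i : ℝ) < m i + 5 / 4 := by nlinarith
    have c3 : m i < m' i + 2 := by
      have : (m i : ℝ) < ((m' i + 2 : ℤ) : ℝ) := by push_cast; linarith
      exact_mod_cast this
    have c4 : m' i < m i + 2 := by
      have : (m' i : ℝ) < ((m i + 2 : ℤ) : ℝ) := by push_cast; linarith
      exact_mod_cast this
    have c5 : (m i : ℝ) ≤ m' i + 1 := by exact_mod_cast (by omega : m i ≤ m' i + 1)
    have c6 : (m' i : ℝ) ≤ m i + 1 := by exact_mod_cast (by omega : m' i ≤ m i + 1)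
    exact ⟨mul_le_mul_of_nonneg_left c5 hk.le, mul_le_mul_of_nonneg_left c6 hk.le⟩
  · rw [edge_succ (k : ℤ), ← h] at b3 b4 ⊢
    have c1 : 2 * (m i : ℝ) < m' i + 5 / 4 := by nlinarith
    have c2 : (m' i : ℝ) < 2 * m i + 9 / 4 := by nlinarith
    have c3 : 2 * m i < m' i + 2 := by
      have : 2 * (m i : ℝ) < ((m' i + 2 : ℤ) : ℝ) := by push_cast; linarith
      exact_mod_cast this
    have c4 : m' i < 2 * m i + 3 := by
      have : (m' i : ℝ) < ((2 * m i + 3 : ℤ) : ℝ) := by push_cast; linarith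
      exact_mod_cast this
    have c5 : 2 * (m i : ℝ) ≤ m' i + 1 := by exact_mod_cast (by omega : 2 * m i ≤ m' i + 1)
    have c6 : (m' i : ℝ) ≤ 2 * m i + 2 := by exact_mod_cast (by omega : m' i ≤ 2 * m i + 2)
    constructor <;> nlinarith
  · rw [edge_succ (j : ℤ), ← h] at b1 b2 ⊢
    have c1 : (m i : ℝ) < 2 * m' i + 5 / 2 := by nlinarith
    have c2 : 2 * (m' i : ℝ) < m i + 3 / 2 := by nlinarith
    have c3 : m i < 2 * m' i + 3 := by
      have : (m i : ℝ) < ((2 * m' i + 3 : ℤ) : ℝ) := by push_cast; linarith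
      exact_mod_cast this
    have c4 : 2 * m' i < m i + 2 := by
      have : 2 * (m' i : ℝ) < ((m i + 2 : ℤ) : ℝ) := by push_cast; linarith
      exact_mod_cast this
    have c5 : (m i : ℝ) ≤ 2 * m' i + 2 := by exact_mod_cast (by omega : m i ≤ 2 * m' i + 2)
    have c6 : 2 * (m' i : ℝ) ≤ m i + 1 := by exact_mod_cast (by omega : 2 * m' i ≤ m i + 1)
    constructor <;> nlinarith

/-- Local finiteness of the supports in the half-space. -/
theorem IsWhitneyFamily.exists_finset (hψ : IsWhitneyFamily ψ) {x₀ : Eucl (d + 1)}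
    (h0 : x₀ ∈ halfSpace d) :
    ∃ F : Finset (ℕ × (Fin d → ℤ)), ∀ᶠ x in 𝓝 x₀, ∀ Q : ℕ × (Fin d → ℤ),
      x ∈ tsupport (ψ Q.1 Q.2) → Q ∈ F := by
  classical
  have ht : 0 < x₀ (Fin.last d) := h0
  set t := x₀ (Fin.last d)
  obtain ⟨J, hJ⟩ := exists_pow_lt_of_lt_one (show 0 < t / 9 by positivity)
    (show (1 / 2 : ℝ) < 1 by norm_num)
  set M : ℤ := ⌈(‖x₀‖ + t + 2) * 2 ^ J⌉
  refine ⟨Finset.range J ×ˢ Fintype.piFinset fun _ => Finset.Icc (-M) M, ?_⟩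
  filter_upwards [Metric.ball_mem_nhds x₀ (show 0 < t / 2 by positivity)] with x hx Q hQ
  obtain ⟨h1, h2, h3⟩ := hψ.bounds_of_mem_tsupport hQ
  have hx' : dist x x₀ < t / 2 := hx
  have h4 := (abs_sub_le_dist x x₀ (Fin.last d)).trans_lt hx'
  rw [abs_lt] at h4
  have hQ1 : Q.1 < J := by
    by_contra! h
    have e : edge (Q.1 : ℤ) = (1 / 2 : ℝ) ^ Q.1 := by
      rw [edge, zpow_neg, zpow_natCast, one_div, inv_pow]
    have : (1 / 2 : ℝ) ^ Q.1 ≤ (1 / 2) ^ J :=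
      pow_le_pow_of_le_one (by norm_num) (by norm_num) h
    rw [e] at h3
    have : t / 2 < x (Fin.last d) := by linarith
    linarith
  have hpow : 1 ≤ edge (Q.1 : ℤ) * 2 ^ J := by
    have e : edge (Q.1 : ℤ) = ((2 : ℝ) ^ Q.1)⁻¹ := by rw [edge, zpow_neg, zpow_natCast]
    rw [e, inv_mul_eq_div, one_le_div (by positivity)]
    exact pow_le_pow_right₀ (by norm_num) hQ1.le
  have hxn : ‖x‖ ≤ ‖x₀‖ + t := by
    have := norm_sub_norm_le x x₀
    rw [← dist_eq_norm] at this
    linarith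
  rw [Finset.mem_product, Finset.mem_range, Fintype.mem_piFinset]
  refine ⟨hQ1, fun i => ?_⟩
  obtain ⟨b1, b2⟩ := h1 i
  have hxi : |horizontal x i| ≤ ‖x‖ := PiLp.norm_apply_le x i.castSucc
  have hxi := abs_le.1 (hxi.trans hxn)
  have he := edge_pos (Q.1 : ℤ)
  have he1 := edge_le_one Q.1
  set R := ‖x₀‖ + t + 2
  have hR : 0 < R := by positivity
  have hM := Int.le_ceil (R * 2 ^ J)
  have hm : |(Q.2 i : ℝ)| ≤ R * 2 ^ J := by
    have h5 : edge (Q.1 : ℤ) * |(Q.2 i : ℝ)| ≤ R := by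
      rw [← abs_of_pos he, ← abs_mul, abs_le]
      constructor <;> simp only [R] <;> linarith
    calc |(Q.2 i : ℝ)| ≤ (edge (Q.1 : ℤ) * 2 ^ J) * |(Q.2 i : ℝ)| :=
          le_mul_of_one_le_left (abs_nonneg _) hpow
      _ = (edge (Q.1 : ℤ) * |(Q.2 i : ℝ)|) * 2 ^ J := by ring
      _ ≤ R * 2 ^ J := by gcongr
  have hm' : |Q.2 i| ≤ M := by
    have : ((|Q.2 i| : ℤ) : ℝ) ≤ (M : ℝ) := by push_cast; exact hm.trans hM
    exact_mod_cast this
  rw [Finset.mem_Icc]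
  exact abs_le.1 hm'

theorem finsum_eq_sum_of_tsupport {M : Type*} [AddCommGroup M] [Module ℝ M]
    {F : Finset (ℕ × (Fin d → ℤ))} {x : Eucl (d + 1)}
    (hF : ∀ Q : ℕ × (Fin d → ℤ), x ∈ tsupport (ψ Q.1 Q.2) → Q ∈ F)
    (c : ℕ × (Fin d → ℤ) → M) :
    ∑ᶠ Q : ℕ × (Fin d → ℤ), ψ Q.1 Q.2 x • c Q = ∑ Q ∈ F, ψ Q.1 Q.2 x • c Q := by
  refine finsum_eq_sum_of_support_subset _ (fun Q hQ => hF Q (subset_tsupport _ ?_))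
  rw [Function.mem_support] at hQ ⊢
  exact fun h => hQ (by rw [h, zero_smul])

theorem IsWhitneyFamily.whitneyExt_linear (hψ : IsWhitneyFamily ψ) {f g : Eucl d → ℂ}
    (hf : LocallyIntegrable f volume) (hg : LocallyIntegrable g volume) (a b : ℂ)
    {x : Eucl (d + 1)} (hx : x ∈ halfSpace d) :
    whitneyExt ψ (a • f + b • g) x = a * whitneyExt ψ f x + b * whitneyExt ψ g x := by
  obtain ⟨F, hF⟩ := hψ.exists_finset hx
  have hF := hF.self_of_nhds
  have hav : ∀ Q : ℕ × (Fin d → ℤ), cubeAverage (a • f + b • g) ((Q.1 : ℤ), Q.2) =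
      a * cubeAverage f ((Q.1 : ℤ), Q.2) + b * cubeAverage g ((Q.1 : ℤ), Q.2) := by
    intro Q
    have h := integral_add ((integrableOn_dyadicCube hf Q.1 Q.2).smul a)
      ((integrableOn_dyadicCube hg Q.1 Q.2).smul b)
    simp only [cubeAverage, setAverage_eq]
    simp only [Pi.add_apply, Pi.smul_apply, smul_eq_mul] at h ⊢
    rw [h, integral_const_mul, integral_const_mul, smul_add, mul_smul_comm, mul_smul_comm]
  simp only [whitneyExt]
  rw [finsum_eq_sum_of_tsupport hF, finsum_eq_sum_of_tsupport hF, finsum_eq_sum_of_tsupport hF,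
    Finset.mul_sum, Finset.mul_sum, ← Finset.sum_add_distrib]
  refine Finset.sum_congr rfl (fun Q _ => ?_)
  rw [hav, smul_add, mul_smul_comm, mul_smul_comm]

theorem IsWhitneyFamily.sum_eq_one_of_le_two (hψ : IsWhitneyFamily ψ) {x : Eucl (d + 1)}
    (hx : x ∈ halfSpace d) (hx2 : x (Fin.last d) ≤ 2) {F : Finset (ℕ × (Fin d → ℤ))}
    (hF : ∀ Q : ℕ × (Fin d → ℤ), x ∈ tsupport (ψ Q.1 Q.2) → Q ∈ F) :
    ∑ Q ∈ F, ψ Q.1 Q.2 x = 1 := by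
  obtain ⟨k, h1, h2⟩ := exists_mem_Ioc_edge hx hx2
  have h := hψ.sum_eq_one x (mem_iUnion.2 ⟨(k, cubeIndex k (horizontal x)),
    mem_dyadicCube_iff.2 rfl, h1, h2⟩)
  have h3 := finsum_eq_sum_of_tsupport hF (fun _ => (1 : ℝ))
  simp only [smul_eq_mul, mul_one] at h3
  rw [← h3, h]

theorem IsWhitneyFamily.contDiffAt_whitneyExt (hψ : IsWhitneyFamily ψ) (f : Eucl d → ℂ)
    {x : Eucl (d + 1)} (hx : x ∈ halfSpace d) : ContDiffAt ℝ ∞ (whitneyExt ψ f) x := by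
  obtain ⟨F, hF⟩ := hψ.exists_finset hx
  have h : ContDiffAt ℝ ∞ (fun x => ∑ Q ∈ F, ψ Q.1 Q.2 x • cubeAverage f ((Q.1 : ℤ), Q.2)) x :=
    ContDiffAt.sum fun Q _ => ((hψ.smooth Q.1 Q.2).contDiffAt).smul contDiffAt_const
  refine h.congr_of_eventuallyEq ?_
  filter_upwards [hF] with z hz
  exact finsum_eq_sum_of_tsupport hz _

theorem IsWhitneyFamily.fderiv_whitneyExt (hψ : IsWhitneyFamily ψ) (f : Eucl d → ℂ)
    {x : Eucl (d + 1)} {F : Finset (ℕ × (Fin d → ℤ))}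
    (hF : ∀ᶠ z in 𝓝 x, ∀ Q : ℕ × (Fin d → ℤ), z ∈ tsupport (ψ Q.1 Q.2) → Q ∈ F) :
    fderiv ℝ (whitneyExt ψ f) x =
      ∑ Q ∈ F, (fderiv ℝ (ψ Q.1 Q.2) x).smulRight (cubeAverage f ((Q.1 : ℤ), Q.2)) := by
  have h1 : whitneyExt ψ f =ᶠ[𝓝 x]
      fun x => ∑ Q ∈ F, ψ Q.1 Q.2 x • cubeAverage f ((Q.1 : ℤ), Q.2) := by
    filter_upwards [hF] with z hz
    exact finsum_eq_sum_of_tsupport hz _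
  rw [h1.fderiv_eq]
  refine HasFDerivAt.fderiv (HasFDerivAt.fun_sum fun Q _ => ?_)
  exact (((hψ.smooth Q.1 Q.2).differentiable (by simp)) x).hasFDerivAt.smul_const _

theorem IsWhitneyFamily.sum_fderiv_eq_zero (hψ : IsWhitneyFamily ψ)
    {x : Eucl (d + 1)} (hx : x ∈ halfSpace d) (hx2 : x (Fin.last d) < 2)
    {F : Finset (ℕ × (Fin d → ℤ))}
    (hF : ∀ᶠ z in 𝓝 x, ∀ Q : ℕ × (Fin d → ℤ), z ∈ tsupport (ψ Q.1 Q.2) → Q ∈ F) :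
    ∑ Q ∈ F, fderiv ℝ (ψ Q.1 Q.2) x = 0 := by
  have h1 : (fun x => ∑ Q ∈ F, ψ Q.1 Q.2 x) =ᶠ[𝓝 x] fun _ => (1 : ℝ) := by
    have h2 : ∀ᶠ z in 𝓝 x, z (Fin.last d) < 2 :=
      (isOpen_lt (by fun_prop) continuous_const :
        IsOpen {z : Eucl (d + 1) | z (Fin.last d) < 2}).mem_nhds hx2
    filter_upwards [hF, h2, isOpen_halfSpace.mem_nhds hx] with z hz hz2 hz3
    exact hψ.sum_eq_one_of_le_two hz3 hz2.le hz
  have h3 : HasFDerivAt (fun x => ∑ Q ∈ F, ψ Q.1 Q.2 x) (∑ Q ∈ F, fderiv ℝ (ψ Q.1 Q.2) x) x :=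
    HasFDerivAt.fun_sum fun Q _ => (((hψ.smooth Q.1 Q.2).differentiable (by simp)) x).hasFDerivAt
  rw [← h3.fderiv, h1.fderiv_eq]
  simp

/-! ### Pointwise bounds for the extension -/

theorem sum_le_sum_neighbors {k : ℕ} {m : Fin d → ℤ} {F : Finset (ℕ × (Fin d → ℤ))}
    {u : ℕ × (Fin d → ℤ) → ℝ≥0∞} {b : ℤ × (Fin d → ℤ) → ℝ≥0∞}
    (h : ∀ Q ∈ F, u Q ≠ 0 → Neighbor ((k : ℤ), m) ((Q.1 : ℤ), Q.2) ∧ u Q ≤ b ((Q.1 : ℤ), Q.2)) :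
    ∑ Q ∈ F, u Q ≤ ∑ Q' ∈ neighbors ((k : ℤ), m), b Q' := by
  classical
  set ι : ℕ × (Fin d → ℤ) → ℤ × (Fin d → ℤ) := fun Q => ((Q.1 : ℤ), Q.2)
  have hι : Function.Injective ι := by
    rintro ⟨a, b⟩ ⟨a', b'⟩ h
    simpa [ι] using h
  calc ∑ Q ∈ F, u Q = ∑ Q ∈ F.filter (fun Q => u Q ≠ 0), u Q := (Finset.sum_filter_ne_zero F).symm
    _ ≤ ∑ Q ∈ F.filter (fun Q => u Q ≠ 0), b (ι Q) := Finset.sum_le_sum fun Q hQ =>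
        (h Q (Finset.mem_filter.1 hQ).1 (Finset.mem_filter.1 hQ).2).2
    _ = ∑ Q' ∈ (F.filter (fun Q => u Q ≠ 0)).image ι, b Q' :=
        (Finset.sum_image hι.injOn).symm
    _ ≤ _ := by
        refine Finset.sum_le_sum_of_subset fun Q' hQ' => ?_
        obtain ⟨Q, hQ, rfl⟩ := Finset.mem_image.1 hQ'
        exact mem_neighbors.2 (h Q (Finset.mem_filter.1 hQ).1 (Finset.mem_filter.1 hQ).2).1

/-- The total oscillation of the averages of `f` between a cube and its neighbors. -/
noncomputable def cubeOsc (f : Eucl d → ℂ) (Q : ℤ × (Fin d → ℤ)) : ℝ≥0∞ :=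
  ∑ Q' ∈ neighbors Q, ‖cubeAverage f Q - cubeAverage f Q'‖ₑ

theorem sum_neighbors_add_le (f : Eucl d → ℂ) (Q : ℤ × (Fin d → ℤ)) :
    ∑ Q' ∈ neighbors Q, ‖cubeAverage f Q'‖ₑ ≤
      cubeOsc f Q + neighborBound d * ‖cubeAverage f Q‖ₑ := by
  have h : ∀ Q' ∈ neighbors Q, ‖cubeAverage f Q'‖ₑ ≤
      ‖cubeAverage f Q - cubeAverage f Q'‖ₑ + ‖cubeAverage f Q‖ₑ := by
    intro Q' _
    rw [← enorm_neg (cubeAverage f Q - cubeAverage f Q'), neg_sub]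
    calc _ = ‖(cubeAverage f Q' - cubeAverage f Q) + cubeAverage f Q‖ₑ := by rw [sub_add_cancel]
      _ ≤ _ := enorm_add_le _ _
  refine (Finset.sum_le_sum h).trans ?_
  rw [Finset.sum_add_distrib, Finset.sum_const, nsmul_eq_mul, cubeOsc]
  gcongr
  exact card_neighbors_le Q

/-- On the part of the half-space over `Q` and in the layer of `Q`, the extension is controlled by
the averages of `f` over `Q` and its neighbors. -/
theorem IsWhitneyFamily.enorm_whitneyExt_le (hψ : IsWhitneyFamily ψ) (f : Eucl d → ℂ) {k : ℕ}
    {m : Fin d → ℤ} {x : Eucl (d + 1)} (hx : x ∈ halfSpace d)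
    (hxm : horizontal x ∈ dyadicCube k m) (hxk : x (Fin.last d) ∈ layer k) :
    ‖whitneyExt ψ f x‖ₑ ≤
      cubeOsc f ((k : ℤ), m) + neighborBound d * ‖cubeAverage f ((k : ℤ), m)‖ₑ := by
  obtain ⟨F, hF⟩ := hψ.exists_finset hx
  rw [whitneyExt, finsum_eq_sum_of_tsupport hF.self_of_nhds]
  refine (enorm_sum_le _ _).trans (le_trans (sum_le_sum_neighbors (k := k) (m := m)
    (b := fun Q' => ‖cubeAverage f Q'‖ₑ) fun Q _ hu => ⟨?_, ?_⟩) (sum_neighbors_add_le f _))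
  · refine hψ.neighbor_of_mem_tsupport hxm hxk (subset_tsupport _ ?_)
    rw [Function.mem_support]
    intro h; simp [h] at hu
  · rw [enorm_smul]
    refine mul_le_of_le_one_left (zero_le) ?_
    have := hψ.mem_Icc Q.1 Q.2 x
    rw [Real.enorm_of_nonneg this.1]
    exact ENNReal.ofReal_le_one.2 this.2

theorem enorm_fderiv_whitney_le {C : ℝ≥0} (hC : ∀ k m, LipschitzWith (C * 2 ^ k) (ψ k m))
    {k j : ℕ} {m m' : Fin d → ℤ} (h : Neighbor ((k : ℤ), m) ((j : ℤ), m')) (x : Eucl (d + 1)) :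
    ‖fderiv ℝ (ψ j m') x‖ₑ ≤ 2 * C * 2 ^ k := by
  have hjk : j ≤ k + 1 := by have := (neighbor_iff.1 h).1; omega
  have h1 : ‖fderiv ℝ (ψ j m') x‖₊ ≤ C * 2 ^ j := norm_fderiv_le_of_lipschitz ℝ (hC j m')
  have h2 : C * 2 ^ j ≤ 2 * C * 2 ^ k := by
    calc C * 2 ^ j ≤ C * 2 ^ (k + 1) := by gcongr; norm_num
      _ = _ := by ring
  exact_mod_cast h1.trans h2

theorem enorm_smulRight (L : Eucl (d + 1) →L[ℝ] ℝ) (c : ℂ) :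
    ‖L.smulRight c‖ₑ = ‖L‖ₑ * ‖c‖ₑ := by
  rw [enorm_eq_nnnorm, ContinuousLinearMap.nnnorm_smulRight_apply, ENNReal.coe_mul]
  rfl

/-- The gradient of the extension over `Q`. Below height `2` the gradients of the bump functions sum
to zero, so that only differences of averages contribute. -/
theorem IsWhitneyFamily.enorm_fderiv_whitneyExt_le (hψ : IsWhitneyFamily ψ) {C : ℝ≥0}
    (hC : ∀ k m, LipschitzWith (C * 2 ^ k) (ψ k m)) (f : Eucl d → ℂ) {k : ℕ}
    {m : Fin d → ℤ} {x : Eucl (d + 1)} (hx : x ∈ halfSpace d)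
    (hxm : horizontal x ∈ dyadicCube k m) (hxk : x (Fin.last d) ∈ layer k) :
    ‖fderiv ℝ (whitneyExt ψ f) x‖ₑ ≤ 2 * C *
      (2 ^ k * cubeOsc f ((k : ℤ), m) + neighborBound d * ‖cubeAverage f ((k : ℤ), m)‖ₑ) := by
  obtain ⟨F, hF⟩ := hψ.exists_finset hx
  have hnb : ∀ Q : ℕ × (Fin d → ℤ), fderiv ℝ (ψ Q.1 Q.2) x ≠ 0 →
      Neighbor ((k : ℤ), m) ((Q.1 : ℤ), Q.2) := fun Q hQ =>
    hψ.neighbor_of_mem_tsupport hxm hxk (support_fderiv_subset ℝ hQ)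
  rw [hψ.fderiv_whitneyExt f hF]
  rcases Nat.eq_zero_or_pos k with rfl | hk
  · -- in the top layer the bump functions need not sum to one, and no cancellation is used
    refine (enorm_sum_le F (fun Q => (fderiv ℝ (ψ Q.1 Q.2) x).smulRight
      (cubeAverage f ((Q.1 : ℤ), Q.2)))).trans (le_trans (sum_le_sum_neighbors (k := 0) (m := m)
      (b := fun Q' => 2 * C * ‖cubeAverage f Q'‖ₑ) fun Q _ hu => ?_) ?_)
    · have hn := hnb Q (by rintro h; simp [h] at hu)
      refine ⟨hn, ?_⟩
      rw [enorm_smulRight]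
      gcongr
      simpa using enorm_fderiv_whitney_le hC hn x
    · rw [← Finset.mul_sum]
      gcongr
      simpa using sum_neighbors_add_le f (((0 : ℕ) : ℤ), m)
  · have hx2 : x (Fin.last d) < 2 := by
      have h1 := hxk.2.resolve_right hk.ne'
      have h2 : edge k ≤ edge 1 := edge_anti (by omega)
      have h3 : edge 1 = 1 / 2 := by norm_num [edge]
      linarith
    have h0 : ∑ Q ∈ F, (fderiv ℝ (ψ Q.1 Q.2) x).smulRight (cubeAverage f ((Q.1 : ℤ), Q.2)) =
        ∑ Q ∈ F, (fderiv ℝ (ψ Q.1 Q.2) x).smulRight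
          (cubeAverage f ((Q.1 : ℤ), Q.2) - cubeAverage f ((k : ℤ), m)) := by
      have h1 : ∑ Q ∈ F, (fderiv ℝ (ψ Q.1 Q.2) x).smulRight (cubeAverage f ((k : ℤ), m)) = 0 := by
        have h2 := hψ.sum_fderiv_eq_zero hx hx2 hF
        ext v
        have h3 := congrArg (fun L => L v) h2
        simp only [_root_.sum_apply, _root_.zero_apply] at h3
        simp only [_root_.sum_apply, ContinuousLinearMap.smulRight_apply,
          _root_.zero_apply]
        rw [← Finset.sum_smul, h3, zero_smul]
      rw [← sub_zero (∑ Q ∈ F, (fderiv ℝ (ψ Q.1 Q.2) x).smulRight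
        (cubeAverage f ((Q.1 : ℤ), Q.2))), ← h1, ← Finset.sum_sub_distrib]
      refine Finset.sum_congr rfl fun Q _ => ?_
      ext v
      simp [smul_sub]
    rw [h0]
    refine (enorm_sum_le F (fun Q => (fderiv ℝ (ψ Q.1 Q.2) x).smulRight
      (cubeAverage f ((Q.1 : ℤ), Q.2) - cubeAverage f ((k : ℤ), m)))).trans
      (le_trans (sum_le_sum_neighbors (k := k) (m := m)
      (b := fun Q' => 2 * C * 2 ^ k * ‖cubeAverage f ((k : ℤ), m) - cubeAverage f Q'‖ₑ)
      fun Q _ hu => ?_) ?_)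
    · have hn := hnb Q (by rintro h; simp [h] at hu)
      refine ⟨hn, ?_⟩
      rw [enorm_smulRight,
        ← enorm_neg (cubeAverage f ((Q.1 : ℤ), Q.2) - _), neg_sub]
      gcongr
      exact enorm_fderiv_whitney_le hC hn x
    · rw [← Finset.mul_sum, mul_assoc (2 * (C : ℝ≥0∞))]
      gcongr
      exact le_self_add

/-- The extension vanishes at large heights, because only the cubes of level `k ≥ 0` are used. -/
theorem IsWhitneyFamily.whitneyExt_eventuallyEq_zero (hψ : IsWhitneyFamily ψ) (f : Eucl d → ℂ)
    {x : Eucl (d + 1)} (hx : 3 ≤ x (Fin.last d)) : whitneyExt ψ f =ᶠ[𝓝 x] 0 := by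
  have h2 : ∀ᶠ z in 𝓝 x, 9 / 4 < z (Fin.last d) :=
    (isOpen_lt continuous_const (by fun_prop) :
      IsOpen {z : Eucl (d + 1) | 9 / 4 < z (Fin.last d)}).mem_nhds (by
        simp only [mem_ofPred_eq]; linarith)
  filter_upwards [h2] with z hz
  have h : ∀ Q : ℕ × (Fin d → ℤ), z ∈ tsupport (ψ Q.1 Q.2) → Q ∈ (∅ : Finset _) := by
    intro Q hQ
    have h3 := (hψ.bounds_of_mem_tsupport hQ).2.2
    have := edge_le_one Q.1
    linarith
  rw [whitneyExt, finsum_eq_sum_of_tsupport h]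
  simp

end Extension

/-! ### Boundedness of the extension -/

section ExtensionBound

variable {d : ℕ}

theorem measurable_cubeIndex (k : ℤ) : Measurable (cubeIndex (d := d) k) := by
  refine measurable_pi_lambda _ fun i => ?_
  have h : Measurable (fun x : Eucl d => x i / edge k) := by fun_prop
  exact (Int.measurable_ceil.comp h).sub_const 1

theorem lintegral_cubeIndex (k : ℤ) (G : (Fin d → ℤ) → ℝ≥0∞) :
    ∫⁻ y, G (cubeIndex k y) = ∑' m, volume (dyadicCube k m) * G m := by
  rw [← tsum_lintegral_dyadicCube k]
  refine tsum_congr fun m => ?_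
  rw [mul_comm, ← setLIntegral_const]
  refine setLIntegral_congr_fun (measurableSet_dyadicCube k m) fun y hy => ?_
  rw [mem_dyadicCube_iff.1 hy]

theorem measurableSet_layer (k : ℕ) : MeasurableSet (layer k) :=
  measurableSet_Ioi.inter (measurableSet_Iic.union (MeasurableSet.const _))

/-- The weight is comparable to `2^{-kα}` on the layer `k`; the factor covers both signs of `α`. -/
theorem weight_le_of_mem_layer (α : ℝ) {k : ℕ} {t : ℝ} (ht : t ∈ layer k) :
    weight α t ≤ ENNReal.ofReal (2 ^ |α| * (2 : ℝ) ^ (-((k : ℝ) * α))) := by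
  obtain ⟨h1, h2⟩ := ht
  have hk := edge_pos k
  have ht : 0 < t := hk.trans h1
  rw [weight, abs_of_pos ht]
  refine ENNReal.ofReal_le_ofReal ?_
  have a1 : edge k ≤ min 1 t := le_min (edge_le_one k) h1.le
  have a2 : min 1 t ≤ 2 * edge k := by
    rcases h2 with h2 | rfl
    · exact (min_le_right _ _).trans h2
    · refine (min_le_left _ _).trans ?_
      simp [edge_zero]
  have e : (2 : ℝ) ^ (-((k : ℝ) * α)) = edge k ^ α := by
    rw [edge_natCast, ← Real.rpow_mul (by norm_num), neg_mul]
  rw [e]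
  rcases le_or_gt 0 α with hα | hα
  · refine (Real.rpow_le_rpow (hk.le.trans a1) a2 hα).trans (le_of_eq ?_)
    rw [Real.mul_rpow (by norm_num) hk.le, abs_of_nonneg hα]
  · refine (Real.rpow_le_rpow_of_nonpos hk a1 hα.le).trans ?_
    exact le_mul_of_one_le_left (by positivity) (Real.one_le_rpow (by norm_num) (abs_nonneg _))

theorem setLIntegral_weight_layer_le (α : ℝ) (k : ℕ) :
    ∫⁻ t in layer k ∩ Iio 3, weight α t ≤
      ENNReal.ofReal (2 ^ |α| * 2) * ENNReal.ofReal ((2 : ℝ) ^ (-((k : ℝ) * (α + 1)))) := by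
  have hk := edge_pos k
  have hvol : volume (layer k ∩ Iio 3) ≤ ENNReal.ofReal (2 * edge k) := by
    have hsub : layer k ∩ Iio 3 ⊆ Ioc (edge k) (edge k + 2 * edge k) := by
      rintro t ⟨⟨h1, h2⟩, h3⟩
      refine ⟨h1, ?_⟩
      rcases h2 with h2 | rfl
      · linarith
      · have h3 : t < 3 := h3
        simp only [Nat.cast_zero, edge_zero]; linarith
    refine (measure_mono hsub).trans (le_of_eq ?_)
    rw [Real.volume_Ioc, add_sub_cancel_left]
  have h1 : ∫⁻ t in layer k ∩ Iio 3, weight α t ≤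
      ∫⁻ _ in layer k ∩ Iio 3, ENNReal.ofReal (2 ^ |α| * (2 : ℝ) ^ (-((k : ℝ) * α))) :=
    setLIntegral_mono measurable_const fun t ht => weight_le_of_mem_layer α ht.1
  rw [setLIntegral_const] at h1
  refine h1.trans ((mul_le_mul_right hvol _).trans (le_of_eq ?_))
  rw [← ENNReal.ofReal_mul (by positivity), ← ENNReal.ofReal_mul (by positivity), edge_natCast]
  congr 1
  have : (2 : ℝ) ^ (-((k : ℝ) * (α + 1))) = 2 ^ (-((k : ℝ) * α)) * 2 ^ (-(k : ℝ)) := by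
    rw [← Real.rpow_add (by norm_num)]; congr 1; ring
  rw [this]; ring

theorem cubeOsc_rpow_le (f : Eucl d → ℂ) (Q : ℤ × (Fin d → ℤ)) {p : ℝ} (hp : 1 ≤ p) :
    cubeOsc f Q ^ p ≤ (neighborBound d : ℝ≥0∞) ^ (p - 1) *
      ∑' Q' : {Q' : ℤ × (Fin d → ℤ) // Neighbor Q Q'},
        ‖cubeAverage f Q - cubeAverage f Q'.1‖ₑ ^ p := by
  rw [tsum_neighbor Q (fun Q' => ‖cubeAverage f Q - cubeAverage f Q'‖ₑ ^ p)]
  refine (ENNReal.rpow_sum_le_const_mul_sum_rpow _ _ hp).trans ?_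
  gcongr
  exact card_neighbors_le Q

theorem tsum_ofReal_two_rpow_lt_top {β : ℝ} (hβ : 0 < β) :
    ∑' k : ℕ, ENNReal.ofReal ((2 : ℝ) ^ (-((k : ℝ) * β))) < ⊤ := by
  have hs : Summable fun k : ℕ => (2 : ℝ) ^ (-((k : ℝ) * β)) := by
    have h := summable_geometric_of_lt_one (r := (2 : ℝ) ^ (-β)) (by positivity)
      (Real.rpow_lt_one_of_one_lt_of_neg (by norm_num) (by linarith))
    refine h.congr fun k => ?_
    rw [← Real.rpow_natCast, ← Real.rpow_mul (by norm_num)]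
    congr 1; ring
  rw [← ENNReal.ofReal_tsum_of_nonneg (fun k => by positivity) hs]
  exact ENNReal.ofReal_lt_top

/-- A function which is dominated, on the Whitney box over each dyadic cube `Q`, by the averages of
`f` over `Q` and their oscillation at `Q`, belongs to `L^p(μ_α)`. -/
theorem exists_eLpNorm_le_besovNorm (d : ℕ) {p α : ℝ} (hp : 1 ≤ p) (hα : -1 < α) (A : ℝ≥0) :
    ∃ C : ℝ≥0, ∀ (f : Eucl d → ℂ), LocallyIntegrable f volume →
      ∀ {F : Type} [NormedAddCommGroup F] (u : Eucl (d + 1) → F),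
      AEStronglyMeasurable u (volume.restrict (halfSpace d)) →
      (∀ x ∈ halfSpace d, ∀ (k : ℕ) (m : Fin d → ℤ), horizontal x ∈ dyadicCube k m →
        x (Fin.last d) ∈ layer k → ‖u x‖ₑ ≤
          A * (2 ^ k * cubeOsc f ((k : ℤ), m) + ‖cubeAverage f ((k : ℤ), m)‖ₑ)) →
      (∀ x, 3 ≤ x (Fin.last d) → u x = 0) →
      eLpNorm u (ENNReal.ofReal p) (weightMeasure d α) ≤
        C * besovNorm (1 - (α + 1) / p) p p f := by
  have hp0 : 0 < p := by linarith
  set G : ℝ≥0∞ := ∑' k : ℕ, ENNReal.ofReal ((2 : ℝ) ^ (-((k : ℝ) * (α + 1))))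
  have hG : G ≠ ⊤ := (tsum_ofReal_two_rpow_lt_top (by linarith)).ne
  set c : ℝ≥0∞ := ENNReal.ofReal (2 ^ |α| * 2)
  set B : ℝ≥0∞ := (A : ℝ≥0∞) ^ p * 2 ^ (p - 1)
  set N : ℝ≥0∞ := (neighborBound d : ℝ≥0∞) ^ (p - 1)
  have hN : N ≠ ⊤ := ENNReal.rpow_ne_top_of_nonneg (by linarith) (by simp)
  have hB : B ≠ ⊤ := by finiteness
  have hD : (c * B * (N + G)) ^ (1 / p) ≠ ⊤ := by finiteness
  refine ⟨((c * B * (N + G)) ^ (1 / p)).toNNReal, fun f hf F _ u hu hub hu0 => ?_⟩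
  rw [ENNReal.coe_toNNReal hD, eLpNorm_eq_lintegral hp, besovNorm_self hp]
  refine rpow_inv_le_of_le_mul hp ?_
  rw [lintegral_weightMeasure (hu.enorm.pow_const p)]
  set H : ℕ → (Fin d → ℤ) → ℝ≥0∞ := fun k m =>
    (A * (2 ^ k * cubeOsc f ((k : ℤ), m) + ‖cubeAverage f ((k : ℤ), m)‖ₑ)) ^ p
  set T : ℕ → (Fin d → ℤ) → ℝ≥0∞ := fun k m =>
    ∑' Q' : {Q' : ℤ × (Fin d → ℤ) // Neighbor ((k : ℤ), m) Q'},
        ‖cubeAverage f ((k : ℤ), m) - cubeAverage f Q'.1‖ₑ ^ p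
  set S : ℝ≥0∞ := ∑' k : ℕ, ENNReal.ofReal ((2 : ℝ) ^ ((k : ℝ) * (1 - (α + 1) / p) * p)) *
        ∑' m : Fin d → ℤ, volume (dyadicCube (k : ℤ) m) * T k m with hS
  have hsub : Ioi (0 : ℝ) ⊆ (⋃ k, layer k ∩ Iio 3) ∪ Ici 3 := by
    intro t ht
    rcases lt_or_ge t 3 with h | h
    · obtain ⟨k, hk⟩ := exists_mem_layer ht
      exact Or.inl (mem_iUnion.2 ⟨k, hk, h⟩)
    · exact Or.inr h
  -- integrate over the layers, on each of which the bound for `u` does not depend on the height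
  have h1 : ∀ y : Eucl d, ∫⁻ t in Ioi (0 : ℝ), weight α t * ‖u (glue (y, t))‖ₑ ^ p ≤
      ∑' k : ℕ, c * ENNReal.ofReal ((2 : ℝ) ^ (-((k : ℝ) * (α + 1)))) * H k (cubeIndex k y) := by
    intro y
    refine (lintegral_mono_set hsub).trans ((lintegral_union_le _ _ _).trans ?_)
    have hz : ∫⁻ t in Ici (3 : ℝ), weight α t * ‖u (glue (y, t))‖ₑ ^ p = 0 := by
      rw [setLIntegral_congr_fun (g := fun _ => 0) measurableSet_Ici fun t ht => ?_]
      · simp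
      · simp only
        rw [hu0 _ (by rw [glue_last]; exact ht), enorm_zero, ENNReal.zero_rpow_of_pos hp0, mul_zero]
    rw [hz, add_zero]
    refine (lintegral_iUnion_le _ _).trans (ENNReal.tsum_le_tsum fun k => ?_)
    calc ∫⁻ t in layer k ∩ Iio 3, weight α t * ‖u (glue (y, t))‖ₑ ^ p
        ≤ ∫⁻ t in layer k ∩ Iio 3, weight α t * H k (cubeIndex k y) := by
          refine setLIntegral_mono' ((measurableSet_layer k).inter measurableSet_Iio) fun t ht => ?_
          refine mul_le_mul_right (ENNReal.rpow_le_rpow ?_ hp0.le) _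
          have ht0 : 0 < t := (edge_pos k).trans ht.1.1
          exact hub (glue (y, t)) ((glue_mem_halfSpace (y, t)).2 ht0) k _
            (by rw [horizontal_glue]; exact mem_dyadicCube_iff.2 rfl)
            (by rw [glue_last]; exact ht.1)
      _ = (∫⁻ t in layer k ∩ Iio 3, weight α t) * H k (cubeIndex k y) :=
          lintegral_mul_const _ (measurable_weight α)
      _ ≤ _ := by gcongr; exact setLIntegral_weight_layer_le α k
  have hmeas : ∀ k : ℕ, Measurable fun y : Eucl d => H k (cubeIndex k y) := fun k =>
    (Measurable.of_discrete (f := H k)).comp (measurable_cubeIndex (k : ℤ))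
  have hH : ∀ k m, H k m ≤ B * (2 ^ ((k : ℝ) * p) * (N * T k m) +
      ‖cubeAverage f ((k : ℤ), m)‖ₑ ^ p) := by
    intro k m
    simp only [H, B]
    rw [ENNReal.mul_rpow_of_nonneg _ _ hp0.le, mul_assoc]
    gcongr
    refine (ENNReal.rpow_add_le_mul_rpow_add_rpow _ _ hp).trans ?_
    gcongr
    rw [ENNReal.mul_rpow_of_nonneg _ _ hp0.le, ← ENNReal.rpow_natCast, ← ENNReal.rpow_mul]
    gcongr
    exact cubeOsc_rpow_le f _ hp
  have hL : ∀ k : ℕ, ∑' m : Fin d → ℤ, volume (dyadicCube k m) *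
      ‖cubeAverage f ((k : ℤ), m)‖ₑ ^ p ≤ eLpNorm f (ENNReal.ofReal p) volume ^ p := by
    intro k
    rw [← lintegral_eq_eLpNorm_rpow hp, ← tsum_lintegral_dyadicCube k]
    exact ENNReal.tsum_le_tsum fun m => enorm_cubeAverage_rpow_le hf hp k m
  have hlev : ∀ k : ℕ, ∫⁻ y : Eucl d, H k (cubeIndex k y) ≤
      B * (2 ^ ((k : ℝ) * p) * (N * ∑' m, volume (dyadicCube (k : ℤ) m) * T k m) +
        eLpNorm f (ENNReal.ofReal p) volume ^ p) := by
    intro k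
    rw [lintegral_cubeIndex]
    calc _ ≤ ∑' m, (B * (2 ^ ((k : ℝ) * p) * (N * (volume (dyadicCube (k : ℤ) m) * T k m)) +
          volume (dyadicCube (k : ℤ) m) * ‖cubeAverage f ((k : ℤ), m)‖ₑ ^ p)) := by
          refine ENNReal.tsum_le_tsum fun m => ?_
          refine (mul_le_mul_right (hH k m) _).trans (le_of_eq ?_)
          ring
      _ = B * (2 ^ ((k : ℝ) * p) * (N * ∑' m, volume (dyadicCube (k : ℤ) m) * T k m) +
          ∑' m, volume (dyadicCube (k : ℤ) m) * ‖cubeAverage f ((k : ℤ), m)‖ₑ ^ p) := by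
          rw [ENNReal.tsum_mul_left, ENNReal.tsum_add, ENNReal.tsum_mul_left,
            ENNReal.tsum_mul_left]
      _ ≤ _ := by gcongr; exact hL k
  have hexp : ∀ k : ℕ, ENNReal.ofReal ((2 : ℝ) ^ (-((k : ℝ) * (α + 1)))) * 2 ^ ((k : ℝ) * p) =
      ENNReal.ofReal ((2 : ℝ) ^ ((k : ℝ) * (1 - (α + 1) / p) * p)) := by
    intro k
    have : (2 : ℝ≥0∞) = ENNReal.ofReal 2 := by simp
    rw [this, ENNReal.ofReal_rpow_of_pos (by norm_num), ← ENNReal.ofReal_mul (by positivity),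
      ← Real.rpow_add (by norm_num)]
    congr 2
    field_simp
    ring
  calc ∫⁻ y : Eucl d, ∫⁻ t in Ioi (0 : ℝ), weight α t * ‖u (glue (y, t))‖ₑ ^ p
      ≤ ∫⁻ y : Eucl d, ∑' k : ℕ,
          c * ENNReal.ofReal ((2 : ℝ) ^ (-((k : ℝ) * (α + 1)))) * H k (cubeIndex k y) :=
        lintegral_mono h1
    _ = ∑' k : ℕ, c * ENNReal.ofReal ((2 : ℝ) ^ (-((k : ℝ) * (α + 1)))) *
          ∫⁻ y : Eucl d, H k (cubeIndex k y) := by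
        rw [lintegral_tsum fun k => ((hmeas k).const_mul _).aemeasurable]
        exact tsum_congr fun k => lintegral_const_mul _ (hmeas k)
    _ ≤ ∑' k : ℕ, c * B * (N * (ENNReal.ofReal ((2 : ℝ) ^ ((k : ℝ) * (1 - (α + 1) / p) * p)) *
          ∑' m, volume (dyadicCube (k : ℤ) m) * T k m) +
          ENNReal.ofReal ((2 : ℝ) ^ (-((k : ℝ) * (α + 1)))) *
            eLpNorm f (ENNReal.ofReal p) volume ^ p) := by
        refine ENNReal.tsum_le_tsum fun k => ?_
        refine (mul_le_mul_right (hlev k) _).trans (le_of_eq ?_)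
        rw [← hexp k]
        ring
    _ = c * B * (N * S + G * eLpNorm f (ENNReal.ofReal p) volume ^ p) := by
        rw [ENNReal.tsum_mul_left, ENNReal.tsum_add, ENNReal.tsum_mul_left, ENNReal.tsum_mul_right]
    _ ≤ c * B * ((N + G) * (eLpNorm f (ENNReal.ofReal p) volume ^ p + S)) := by
        gcongr
        calc _ ≤ N * S + G * eLpNorm f (ENNReal.ofReal p) volume ^ p +
              (N * eLpNorm f (ENNReal.ofReal p) volume ^ p + G * S) := le_self_add
          _ = _ := by ring
    _ ≤ c * B * (N + G) * (eLpNorm f (ENNReal.ofReal p) volume + S ^ (1 / p)) ^ p := by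
        rw [← mul_assoc]
        gcongr
        have hS' : S = (S ^ (1 / p)) ^ p := by
          rw [← ENNReal.rpow_mul, one_div_mul_cancel hp0.ne', ENNReal.rpow_one]
        conv_lhs => rw [hS']
        exact ENNReal.add_rpow_le_rpow_add _ _ hp

end ExtensionBound

/-! ### The extension operator -/

section ExtensionOperator

variable {d : ℕ} {ψ : ℕ → (Fin d → ℤ) → Eucl (d + 1) → ℝ}

theorem le_one_add_rpow {p : ℝ} (hp : 1 ≤ p) (a : ℝ≥0∞) : a ≤ 1 + a ^ p := by
  rcases le_or_gt a 1 with h | h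
  · exact h.trans le_self_add
  · calc a = a ^ (1 : ℝ) := (ENNReal.rpow_one a).symm
      _ ≤ a ^ p := ENNReal.rpow_le_rpow_of_exponent_le h.le hp
      _ ≤ _ := le_add_self

theorem closedBall_inter_halfSpace_subset (R : ℝ) :
    Metric.closedBall (0 : Eucl (d + 1)) R ∩ halfSpace d ⊆
      glue '' (Metric.closedBall (0 : Eucl d) R ×ˢ Ioo 0 (R + 1)) := by
  rintro x ⟨hx, hx0⟩
  refine ⟨(horizontal x, x (Fin.last d)), ⟨?_, hx0, ?_⟩, glue_horizontal x⟩
  all_goals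
    have h0 : (0 : Eucl (d + 1)) = glue (0, 0) := by
      have := glue_smul (d := d) 0 0 0
      simpa using this.symm
    have h1 := dist_glue_sq (horizontal x, x (Fin.last d)) (0, 0)
    rw [glue_horizontal, ← h0] at h1
    have h2 : dist x 0 ≤ R := hx
    have h3 : 0 ≤ R := dist_nonneg.trans h2
    have h4 : dist x 0 ^ 2 ≤ R ^ 2 := pow_le_pow_left₀ dist_nonneg h2 2
  · refine Metric.mem_closedBall.2 (abs_le_of_sq_le_sq' ?_ h3).2
    simp only at h1 ⊢
    nlinarith [sq_nonneg (dist (x (Fin.last d)) 0)]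
  · refine lt_of_le_of_lt (abs_le_of_sq_le_sq' ?_ h3).2 (lt_add_one R)
    simp only [Real.dist_eq, sub_zero, sq_abs] at h1 ⊢
    nlinarith [sq_nonneg (dist (horizontal x) 0)]

/-- Functions in `L^p(μ_α)` are integrable over the bounded subsets of the half-space; this is where
`α < p - 1` enters. -/
theorem locIntegrableHalf_of_eLpNorm_lt_top {F : Type*} [NormedAddCommGroup F] {p α : ℝ}
    (hp : 1 ≤ p) (hαp : α < p - 1) {u : Eucl (d + 1) → F}
    (hu : AEStronglyMeasurable u (volume.restrict (halfSpace d)))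
    (hup : eLpNorm u (ENNReal.ofReal p) (weightMeasure d α) < ⊤) : LocIntegrableHalf u := by
  have hp0 : 0 < p := by linarith
  obtain ⟨u', hm, he⟩ := hu
  suffices h : LocIntegrableHalf u' from h.congr he.symm
  rw [eLpNorm_congr_halfSpace he] at hup
  obtain ⟨C, hC⟩ := exists_hardy_unit d hp hαp
  have hI : ∫⁻ x, ‖u' x‖ₑ ^ p ∂(weightMeasure d α) < ⊤ := by
    rw [lintegral_eq_eLpNorm_rpow hp]; finiteness
  intro S hS
  obtain ⟨R, hR⟩ := hS.subset_closedBall 0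
  refine ⟨hm.aestronglyMeasurable, ?_⟩
  have hSR : S ∩ halfSpace d ⊆
      glue '' (Metric.closedBall (0 : Eucl d) R ×ˢ Ioo 0 (R + 1)) :=
    (inter_subset_inter_left _ hR).trans (closedBall_inter_halfSpace_subset R)
  refine (lintegral_mono_set hSR).trans_lt ?_
  rw [← lintegral_cylinder hm.enorm Metric.isClosed_closedBall.measurableSet measurableSet_Ioo]
  have hgm : Measurable fun z : Eucl d × ℝ => ‖u' (glue z)‖ₑ :=
    (hm.comp_measurable glue.measurable).enorm
  have hsub : Ioo (0 : ℝ) (R + 1) ⊆ Ioo 0 1 ∪ Ico 1 (R + 1) := by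
    intro t ht
    rcases lt_or_ge t 1 with h | h
    · exact Or.inl ⟨ht.1, h⟩
    · exact Or.inr ⟨h, ht.2⟩
  have h1 : ∀ y : Eucl d, ∫⁻ t in Ioo (0 : ℝ) (R + 1), ‖u' (glue (y, t))‖ₑ ≤
      (1 + ENNReal.ofReal R) + ((∫⁻ t in Ioo (0 : ℝ) 1, ‖u' (glue (y, t))‖ₑ) ^ p +
        ∫⁻ t in Ioi (0 : ℝ), weight α t * ‖u' (glue (y, t))‖ₑ ^ p) := by
    intro y
    have h2 : ∫⁻ t in Ico (1 : ℝ) (R + 1), ‖u' (glue (y, t))‖ₑ ≤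
        ENNReal.ofReal R + ∫⁻ t in Ioi (0 : ℝ), weight α t * ‖u' (glue (y, t))‖ₑ ^ p := by
      calc _ ≤ ∫⁻ t in Ico (1 : ℝ) (R + 1), (1 + weight α t * ‖u' (glue (y, t))‖ₑ ^ p) := by
            refine setLIntegral_mono' measurableSet_Ico fun t ht => ?_
            rw [weight_of_one_le ht.1, one_mul]
            exact le_one_add_rpow hp _
        _ = ENNReal.ofReal R +
              ∫⁻ t in Ico (1 : ℝ) (R + 1), weight α t * ‖u' (glue (y, t))‖ₑ ^ p := by
            rw [lintegral_add_left measurable_const, setLIntegral_const, Real.volume_Ico]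
            simp
        _ ≤ _ := by
            have hs : Ico (1 : ℝ) (R + 1) ⊆ Ioi 0 := fun t ht => lt_of_lt_of_le one_pos ht.1
            exact add_le_add le_rfl (lintegral_mono_set hs)
    refine (lintegral_mono_set hsub).trans ((lintegral_union_le _ _ _).trans ?_)
    refine (add_le_add (le_one_add_rpow hp _) h2).trans (le_of_eq ?_)
    ring
  refine (lintegral_mono h1).trans_lt ?_
  have hm1 : Measurable fun y : Eucl d => (∫⁻ t in Ioo (0 : ℝ) 1, ‖u' (glue (y, t))‖ₑ) ^ p :=
    hgm.lintegral_prod_right'.pow_const p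
  rw [lintegral_add_left measurable_const, lintegral_add_left hm1, setLIntegral_const]
  refine ENNReal.add_lt_top.2 ⟨?_, ENNReal.add_lt_top.2 ⟨?_, ?_⟩⟩
  · have : volume (Metric.closedBall (0 : Eucl d) R) < ⊤ := measure_closedBall_lt_top
    finiteness
  · refine (setLIntegral_le_lintegral _ _).trans_lt ((hC _ hm.enorm).trans_lt ?_)
    exact ENNReal.mul_lt_top ENNReal.coe_lt_top hI
  · refine (setLIntegral_le_lintegral _ _).trans_lt ?_
    rwa [← lintegral_weightMeasure (hm.enorm.pow_const p).aemeasurable]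

/-- The gradient of the Whitney extension. -/
noncomputable def extGrad (ψ : ℕ → (Fin d → ℤ) → Eucl (d + 1) → ℝ) (f : Eucl d → ℂ)
    (x : Eucl (d + 1)) : EuclideanSpace ℂ (Fin (d + 1)) :=
  WithLp.toLp 2 fun i => fderiv ℝ (whitneyExt ψ f) x (EuclideanSpace.single i (1 : ℝ))

theorem enorm_extGrad_le (f : Eucl d → ℂ) (x : Eucl (d + 1)) :
    ‖extGrad ψ f x‖ₑ ≤ (d + 1) * ‖fderiv ℝ (whitneyExt ψ f) x‖ₑ := by
  have h : ‖extGrad ψ f x‖ ≤ (d + 1) * ‖fderiv ℝ (whitneyExt ψ f) x‖ := by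
    rw [EuclideanSpace.norm_eq]
    refine Real.sqrt_le_iff.2 ⟨by positivity, ?_⟩
    have h1 : ∀ i ∈ Finset.univ, ‖(extGrad ψ f x) i‖ ^ 2 ≤ ‖fderiv ℝ (whitneyExt ψ f) x‖ ^ 2 := by
      intro i _
      refine pow_le_pow_left₀ (norm_nonneg _) ?_ 2
      refine ((fderiv ℝ (whitneyExt ψ f) x).le_opNorm _).trans (le_of_eq ?_)
      simp
    refine (Finset.sum_le_card_nsmul _ _ _ h1).trans ?_
    rw [Finset.card_univ, Fintype.card_fin, nsmul_eq_mul, mul_pow]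
    gcongr
    push_cast
    nlinarith [Nat.cast_nonneg (α := ℝ) d]
  have h2 := ENNReal.ofReal_le_ofReal h
  rw [ofReal_norm, ENNReal.ofReal_mul (by positivity), ofReal_norm] at h2
  refine h2.trans (le_of_eq ?_)
  congr 1
  rw [ENNReal.ofReal_add (by positivity) (by norm_num)]
  simp

theorem IsWhitneyFamily.continuousOn_whitneyExt (hψ : IsWhitneyFamily ψ) (f : Eucl d → ℂ) :
    ContinuousOn (whitneyExt ψ f) (halfSpace d) := fun _ hx =>
  (hψ.contDiffAt_whitneyExt f hx).continuousAt.continuousWithinAt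

theorem IsWhitneyFamily.continuousOn_fderiv (hψ : IsWhitneyFamily ψ) (f : Eucl d → ℂ) :
    ContinuousOn (fderiv ℝ (whitneyExt ψ f)) (halfSpace d) := fun _ hx =>
  ((hψ.contDiffAt_whitneyExt f hx).fderiv_right (m := 0) (by simp)).continuousAt.continuousWithinAt

theorem IsWhitneyFamily.continuousOn_extGrad (hψ : IsWhitneyFamily ψ) (f : Eucl d → ℂ) :
    ContinuousOn (extGrad ψ f) (halfSpace d) := by
  refine (PiLp.continuous_toLp 2 _).comp_continuousOn (continuousOn_pi.2 fun i => ?_)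
  exact (hψ.continuousOn_fderiv f).clm_apply continuousOn_const

/-- Integrability of a product in which one factor has compact support in the half-space. -/
theorem integrable_of_support_subset {F : Type*} [NormedAddCommGroup F] {K : Set (Eucl (d + 1))}
    (hK : IsCompact K) (hKh : K ⊆ halfSpace d) {u : Eucl (d + 1) → F}
    (hu : ContinuousOn u (halfSpace d)) (hs : ∀ x ∉ K, u x = 0) : Integrable u volume := by
  rw [← integrableOn_iff_integrable_of_support_subset (s := K)
    (fun x hx => by_contra fun h => hx (hs x h))]
  exact (hu.mono hKh).integrableOn_compact hK

theorem IsWhitneyFamily.isWeakGradient (hψ : IsWhitneyFamily ψ) (f : Eucl d → ℂ)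
    (hg : LocIntegrableHalf (extGrad ψ f)) :
    IsWeakGradient (whitneyExt ψ f) (extGrad ψ f) := by
  refine ⟨hg, fun φ h1 h2 h3 i => ?_⟩
  set v : Eucl (d + 1) := EuclideanSpace.single i (1 : ℝ)
  have hφ0 : ∀ x ∉ tsupport φ, φ x = 0 := fun x hx => image_eq_zero_of_notMem_tsupport hx
  have hφ0' : ∀ x ∉ tsupport φ, fderiv ℝ φ x v = 0 := fun x hx => by
    have : fderiv ℝ φ x = 0 := by
      by_contra h
      exact hx (support_fderiv_subset ℝ h)
    rw [this]; rfl
  have hφc : Continuous fun x => fderiv ℝ φ x v :=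
    (h1.continuous_fderiv (by simp)).clm_apply continuous_const
  have hE := hψ.continuousOn_whitneyExt f
  have hE' : ContinuousOn (fun x => fderiv ℝ (whitneyExt ψ f) x v) (halfSpace d) :=
    (hψ.continuousOn_fderiv f).clm_apply continuousOn_const
  have h := integral_smul_fderiv_eq_neg_fderiv_smul_of_integrable (μ := volume) (f := φ)
    (g := whitneyExt ψ f) (v := v)
    (integrable_of_support_subset h2 h3 (hφc.continuousOn.smul hE)
      fun x hx => by rw [hφ0' x hx, zero_smul])
    (integrable_of_support_subset h2 h3 (h1.continuous.continuousOn.smul hE')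
      fun x hx => by rw [hφ0 x hx, zero_smul])
    (integrable_of_support_subset h2 h3 (h1.continuous.continuousOn.smul hE)
      fun x hx => by rw [hφ0 x hx, zero_smul])
    (fun x _ => (h1.differentiable (by simp)) x)
    (fun x hx => (hψ.contDiffAt_whitneyExt f (h3 hx)).differentiableAt (by simp))
  rw [setIntegral_eq_integral_of_forall_compl_eq_zero
      (fun x hx => by rw [hφ0' x fun h => hx (h3 h), zero_smul]),
    setIntegral_eq_integral_of_forall_compl_eq_zero
      (fun x hx => by rw [hφ0 x fun h => hx (h3 h), zero_smul])]
  exact neg_eq_iff_eq_neg.1 h.symm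

/-- The Whitney extension is bounded; its weak gradient is the classical one. -/
theorem IsWhitneyFamily.exists_bounded (hψ : IsWhitneyFamily ψ) {p α : ℝ} (hp : 1 ≤ p)
    (hα : -1 < α) (hαp : α < p - 1) :
    ∃ C : ℝ≥0, ∀ f ∈ besovSpace d (1 - (α + 1) / p) p p,
      IsWeakGradient (whitneyExt ψ f) (extGrad ψ f) ∧
      whitneyExt ψ f ∈ sobolevSpace d p (weightMeasure d α) ∧
      sobolevNorm p (weightMeasure d α) (whitneyExt ψ f) ≤
        C * besovNorm (1 - (α + 1) / p) p p f := by
  obtain ⟨L, hL⟩ := hψ.lipschitz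
  set N : ℝ≥0 := ((neighborBound d : ℕ) : ℝ≥0)
  obtain ⟨C1, hC1⟩ := exists_eLpNorm_le_besovNorm d hp hα (1 + N)
  obtain ⟨C2, hC2⟩ := exists_eLpNorm_le_besovNorm d hp hα ((d + 1) * (2 * L) * (1 + N))
  refine ⟨C1 + C2, fun f hf => ?_⟩
  have hN : (neighborBound d : ℝ≥0∞) = N := by simp [N]
  have hm1 : AEStronglyMeasurable (whitneyExt ψ f) (volume.restrict (halfSpace d)) :=
    (hψ.continuousOn_whitneyExt f).aestronglyMeasurable measurableSet_halfSpace
  have hm2 : AEStronglyMeasurable (extGrad ψ f) (volume.restrict (halfSpace d)) :=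
    (hψ.continuousOn_extGrad f).aestronglyMeasurable measurableSet_halfSpace
  have key : ∀ a b c : ℝ≥0∞, c * a + N * b ≤ (1 + N) * (c * a + b) := by
    intro a b c
    calc c * a + N * b ≤ c * a + N * b + (N * (c * a) + b) := le_self_add
      _ = _ := by ring
  have b1 : eLpNorm (whitneyExt ψ f) (ENNReal.ofReal p) (weightMeasure d α) ≤
      C1 * besovNorm (1 - (α + 1) / p) p p f := by
    refine hC1 f hf.1 _ hm1 (fun x hx k m hxm hxk => ?_)
      (fun x hx => (hψ.whitneyExt_eventuallyEq_zero f hx).self_of_nhds)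
    refine (hψ.enorm_whitneyExt_le f hx hxm hxk).trans ?_
    rw [hN]
    push_cast
    have h2 : (1 : ℝ≥0∞) ≤ 2 ^ k := one_le_pow₀ (by norm_num)
    refine le_trans ?_ (key _ _ (2 ^ k))
    gcongr
    exact le_mul_of_one_le_left zero_le h2
  have b2 : eLpNorm (extGrad ψ f) (ENNReal.ofReal p) (weightMeasure d α) ≤
      C2 * besovNorm (1 - (α + 1) / p) p p f := by
    refine hC2 f hf.1 _ hm2 (fun x hx k m hxm hxk => ?_) (fun x hx => ?_)
    · refine (enorm_extGrad_le f x).trans ?_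
      have h2 : (1 : ℝ≥0∞) ≤ 2 ^ k := one_le_pow₀ (by norm_num)
      refine (mul_le_mul_right (hψ.enorm_fderiv_whitneyExt_le hL f hx hxm hxk) _).trans ?_
      rw [hN]
      push_cast
      rw [← mul_assoc, mul_assoc (((d : ℝ≥0∞) + 1) * (2 * (L : ℝ≥0∞)))]
      gcongr
      exact key _ _ _
    · have : fderiv ℝ (whitneyExt ψ f) x = 0 := by
        rw [(hψ.whitneyExt_eventuallyEq_zero f hx).fderiv_eq]
        exact fderiv_const_apply 0
      ext i
      simp [extGrad, this]
  have hfin : besovNorm (1 - (α + 1) / p) p p f < ⊤ := hf.2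
  have hw := hψ.isWeakGradient f (locIntegrableHalf_of_eLpNorm_lt_top hp hαp hm2
    (b2.trans_lt (ENNReal.mul_lt_top ENNReal.coe_lt_top hfin)))
  have b3 : sobolevNorm p (weightMeasure d α) (whitneyExt ψ f) ≤
      (C1 + C2 : ℝ≥0) * besovNorm (1 - (α + 1) / p) p p f := by
    rw [ENNReal.coe_add, add_mul]
    exact add_le_add b1 ((iInf₂_le _ hw).trans b2)
  refine ⟨hw, ⟨?_, b3.trans_lt (ENNReal.mul_lt_top ENNReal.coe_lt_top hfin)⟩, b3⟩
  exact locIntegrableHalf_of_eLpNorm_lt_top hp hαp hm1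
    (b1.trans_lt (ENNReal.mul_lt_top ENNReal.coe_lt_top hfin))

/-! ### The trace of the extension -/

/-- Close to the boundary the extension at `(y, t)` is a convex combination of averages over cubes
of size comparable to `t` and within distance comparable to `t` of `y`. Its deviation from `f y` is
therefore bounded by the mean deviation of `f` from `f y` over a ball of comparable radius. -/
theorem IsWhitneyFamily.enorm_whitneyExt_sub_le (hψ : IsWhitneyFamily ψ) {f : Eucl d → ℂ}
    (hf : LocallyIntegrable f volume) (y : Eucl d) {t : ℝ} (ht : 0 < t) (ht2 : t ≤ 2) :
    ‖whitneyExt ψ f (glue (y, t)) - f y‖ₑ ≤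
      (ENNReal.ofReal (12 * (d + 1)) ^ d * volume (Metric.ball (0 : Eucl d) 1)) *
      ((∫⁻ z in Metric.closedBall y (3 * (d + 1) * t), ‖f z - f y‖ₑ) /
        volume (Metric.closedBall y (3 * (d + 1) * t))) := by
  set x := glue (y, t)
  have hx : x ∈ halfSpace d := (glue_mem_halfSpace _).2 ht
  have hxt : x (Fin.last d) = t := glue_last _
  obtain ⟨F, hF⟩ := hψ.exists_finset hx
  have hF := hF.self_of_nhds
  have hsum := hψ.sum_eq_one_of_le_two hx (by rwa [hxt]) hF
  obtain ⟨k, hk1, hk2⟩ := exists_mem_Ioc_edge ht ht2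
  have hy : y ∈ dyadicCube k (cubeIndex k y) := mem_dyadicCube_iff.2 rfl
  set R : ℝ := 3 * (d + 1) * t
  have hR : 0 < R := by positivity
  have hek := edge_pos k
  set I := ∫⁻ z in Metric.closedBall y R, ‖f z - f y‖ₑ
  have hv0 : volume (Metric.closedBall y R) ≠ 0 := (Metric.measure_closedBall_pos _ _ hR).ne'
  have hv1 : volume (Metric.closedBall y R) ≠ ⊤ := measure_closedBall_lt_top.ne
  set B := (ENNReal.ofReal (edge k / 2) ^ d)⁻¹ * I
  have hB : B ≤ (ENNReal.ofReal (12 * (d + 1)) ^ d * volume (Metric.ball (0 : Eucl d) 1)) *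
      (I / volume (Metric.closedBall y R)) := by
    have he0 : ENNReal.ofReal (edge k / 2) ^ d ≠ 0 := pow_ne_zero _ (by simpa using hek)
    have he1 : ENNReal.ofReal (edge k / 2) ^ d ≠ ⊤ := ENNReal.pow_ne_top ENNReal.ofReal_ne_top
    have hvol : volume (Metric.closedBall y R) ≤ ENNReal.ofReal (edge k / 2) ^ d *
        (ENNReal.ofReal (12 * (d + 1)) ^ d * volume (Metric.ball (0 : Eucl d) 1)) := by
      rw [Measure.addHaar_closedBall _ _ hR.le, finrank_euclideanSpace_fin, ← mul_assoc,
        ENNReal.ofReal_pow hR.le, ← mul_pow, ← ENNReal.ofReal_mul (by positivity)]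
      gcongr
      have : (3 : ℝ) * (d + 1) * t ≤ 3 * (d + 1) * (2 * edge k) := by gcongr
      simp only [R]; linarith
    have h1 : I = volume (Metric.closedBall y R) * (I / volume (Metric.closedBall y R)) :=
      (ENNReal.mul_div_cancel hv0 hv1).symm
    calc B ≤ (ENNReal.ofReal (edge k / 2) ^ d)⁻¹ * ((ENNReal.ofReal (edge k / 2) ^ d *
        (ENNReal.ofReal (12 * (d + 1)) ^ d * volume (Metric.ball (0 : Eucl d) 1))) *
          (I / volume (Metric.closedBall y R))) := by
          refine mul_le_mul_right ?_ _
          conv_lhs => rw [h1]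
          exact mul_le_mul_left hvol _
      _ = _ := by
          rw [mul_assoc (ENNReal.ofReal (edge k / 2) ^ d), ← mul_assoc,
            ENNReal.inv_mul_cancel he0 he1, one_mul]
  refine le_trans ?_ hB
  have e1 : whitneyExt ψ f x - f y =
      ∑ Q ∈ F, ψ Q.1 Q.2 x • (cubeAverage f ((Q.1 : ℤ), Q.2) - f y) := by
    simp_rw [smul_sub]
    rw [Finset.sum_sub_distrib, ← Finset.sum_smul, hsum, one_smul, whitneyExt,
      finsum_eq_sum_of_tsupport hF]
  have hterm : ∀ Q ∈ F, ‖ψ Q.1 Q.2 x • (cubeAverage f ((Q.1 : ℤ), Q.2) - f y)‖ₑ ≤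
      ENNReal.ofReal (ψ Q.1 Q.2 x) * B := by
    intro Q _
    rw [enorm_smul, Real.enorm_of_nonneg (hψ.mem_Icc _ _ _).1]
    by_cases h0 : ψ Q.1 Q.2 x = 0
    · simp [h0]
    gcongr
    have hn : Neighbor ((k : ℤ), cubeIndex k y) ((Q.1 : ℤ), Q.2) :=
      hψ.neighbor_of_mem_tsupport (x := x) (by rwa [horizontal_glue])
        (by rw [hxt]; exact ⟨hk1, Or.inl hk2⟩) (subset_tsupport _ h0)
    have h1 := enorm_setAverage_sub_rpow_le (volume_dyadicCube_ne_zero Q.1 Q.2)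
      (volume_dyadicCube_ne_top Q.1 Q.2) (integrableOn_dyadicCube hf Q.1 Q.2) (f y) le_rfl
    simp only [ENNReal.rpow_one] at h1
    refine h1.trans (mul_le_mul' ?_ (lintegral_mono_set fun z hz => ?_))
    · rw [volume_dyadicCube, ENNReal.inv_le_inv]
      gcongr
      have := ((half_le_edge_div_iff (Q.1 : ℤ) k).2 (neighbor_iff.1 hn).1).2
      rw [div_le_iff₀ (edge_pos _)] at this
      linarith
    · refine Metric.mem_closedBall.2 ((dist_le_of_neighbor hn hy hz).trans ?_)
      simp only [R]
      have : (d : ℝ) ≤ d + 1 := by linarith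
      gcongr
  rw [e1]
  refine (enorm_sum_le _ _).trans ((Finset.sum_le_sum hterm).trans (le_of_eq ?_))
  rw [← Finset.sum_mul, ← ENNReal.ofReal_sum_of_nonneg fun Q _ => (hψ.mem_Icc _ _ _).1, hsum]
  simp

theorem IsWhitneyFamily.ae_tendsto_whitneyExt (hψ : IsWhitneyFamily ψ) {f : Eucl d → ℂ}
    (hf : LocallyIntegrable f volume) :
    ∀ᵐ y : Eucl d, Tendsto (fun t : ℝ => whitneyExt ψ f (glue (y, t))) (𝓝[>] 0) (𝓝 (f y)) := by
  filter_upwards [tendsto_lintegral_enorm_sub_div hf] with y hy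
  have h1 : Tendsto (fun t : ℝ => 3 * ((d : ℝ) + 1) * t) (𝓝[>] 0) (𝓝[>] 0) := by
    refine tendsto_nhdsWithin_iff.2 ⟨?_, ?_⟩
    · refine tendsto_nhdsWithin_of_tendsto_nhds ?_
      have : Continuous fun t : ℝ => 3 * ((d : ℝ) + 1) * t := by fun_prop
      simpa using this.tendsto 0
    · filter_upwards [self_mem_nhdsWithin] with t ht
      have ht : 0 < t := ht
      exact mem_Ioi.2 (by positivity)
  set K : ℝ≥0∞ := ENNReal.ofReal (12 * (d + 1)) ^ d * volume (Metric.ball (0 : Eucl d) 1)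
  have hK : K ≠ ⊤ := by
    have : volume (Metric.ball (0 : Eucl d) 1) ≠ ⊤ := measure_ball_lt_top.ne
    finiteness
  have h2 := ENNReal.Tendsto.const_mul (hy.comp h1) (Or.inr hK)
  rw [mul_zero] at h2
  rw [tendsto_iff_edist_tendsto_0]
  simp_rw [edist_eq_enorm_sub]
  refine tendsto_of_tendsto_of_tendsto_of_le_of_le' tendsto_const_nhds h2
    (Eventually.of_forall fun _ => zero_le) ?_
  filter_upwards [self_mem_nhdsWithin, nhdsWithin_le_nhds (Iio_mem_nhds (show (0 : ℝ) < 2 by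
    norm_num))] with t ht ht2
  exact hψ.enorm_whitneyExt_sub_le hf y ht (le_of_lt ht2)

/-- The trace of the extension of `f` is `f`. Almost everywhere, both values are limits of the
extension along the vertical line: the trace by absolute continuity, and `f` at its Lebesgue points.
-/
theorem IsWhitneyFamily.ae_trace_whitneyExt (hψ : IsWhitneyFamily ψ) {p α : ℝ} (hp : 1 ≤ p)
    (hα : -1 < α) {f : Eucl d → ℂ} (hf : LocallyIntegrable f volume)
    (hE : whitneyExt ψ f ∈ sobolevSpace d p (weightMeasure d α)) :
    ∀ᵐ y : Eucl d, trace (weightMeasure d α) (whitneyExt ψ f) y = f y := by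
  obtain ⟨g, hg⟩ := exists_weakGradient hE
  obtain ⟨f', g', H, e1, -, ht⟩ := exists_normalPair_hasTraceAt hp hα hE.1
    (eLpNorm_lt_top_of_mem_sobolevSpace hE) hg
  have e2 := Measure.ae_ae_of_ae_prod
    ((ae_halfSpace_iff (P := fun x => whitneyExt ψ f x = f' x)).1 e1)
  filter_upwards [ht, e2, H.ae_enorm_sub_bdry_le, H.ae_column_lt_top, hψ.ae_tendsto_whitneyExt hf]
    with y h1 h2 h3 h4 h5
  rw [h1.trace_eq]
  -- heights `t → 0` at which the extension is close to its trace
  have hex : ∀ n : ℕ, ∃ t : ℝ, t ∈ Ioo (0 : ℝ) (1 / ((n : ℝ) + 1)) ∧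
      ‖whitneyExt ψ f (glue (y, t)) - bdry f' g' y‖ₑ ≤ column g' (1 / ((n : ℝ) + 1)) y := by
    intro n
    have hpos : (0 : ℝ) < 1 / ((n : ℝ) + 1) := by positivity
    have hne : NeBot (ae (volume.restrict (Ioo (0 : ℝ) (1 / ((n : ℝ) + 1))))) := by
      rw [ae_neBot, Ne, Measure.restrict_eq_zero, Real.volume_Ioo]
      simpa using hpos
    have hle : ae (volume.restrict (Ioo (0 : ℝ) (1 / ((n : ℝ) + 1)))) ≤
        ae (volume.restrict (Ioi (0 : ℝ))) :=
      ae_mono (Measure.restrict_mono Ioo_subset_Ioi_self le_rfl)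
    have h2' : ∀ᵐ t ∂(volume.restrict (Ioo (0 : ℝ) (1 / ((n : ℝ) + 1)))),
        whitneyExt ψ f (glue (y, t)) = f' (glue (y, t)) := hle h2
    have h3' := h3.filter_mono hle
    obtain ⟨t, ⟨ha, hb⟩, hc⟩ :=
      ((h2'.and h3').and (ae_restrict_mem measurableSet_Ioo)).exists
    exact ⟨t, hc, by rw [ha]; exact hb _ hc.2⟩
  choose t ht1 ht2 using hex
  have ht0 : Tendsto t atTop (𝓝[>] 0) := by
    refine tendsto_nhdsWithin_iff.2 ⟨?_, Eventually.of_forall fun n => (ht1 n).1⟩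
    exact squeeze_zero (fun n => (ht1 n).1.le) (fun n => (ht1 n).2.le)
      tendsto_one_div_add_atTop_nhds_zero_nat
  refine tendsto_nhds_unique ?_ (h5.comp ht0)
  rw [tendsto_iff_edist_tendsto_0]
  simp_rw [edist_eq_enorm_sub]
  exact tendsto_of_tendsto_of_tendsto_of_le_of_le tendsto_const_nhds
    (tendsto_column_zero (h4 1)) (fun _ => zero_le) ht2

end ExtensionOperator

/-! ### Existence of Whitney families -/

section Existence

/-- A smooth monotone step which is `0` on `(-∞, -δ]` and `1` on `[δ, ∞)`. -/
noncomputable def smoothStep (δ u : ℝ) : ℝ := Real.smoothTransition ((u + δ) / (2 * δ))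

theorem contDiff_smoothStep (δ : ℝ) : ContDiff ℝ ∞ (smoothStep δ) :=
  Real.smoothTransition.contDiff.comp ((contDiff_id.add contDiff_const).div_const _)

variable {δ : ℝ}

theorem monotone_smoothStep (hδ : 0 < δ) : Monotone (smoothStep δ) := by
  intro a b hab
  refine Real.smoothTransition.monotone ?_
  gcongr

theorem smoothStep_nonneg (u : ℝ) : 0 ≤ smoothStep δ u := Real.smoothTransition.nonneg _

theorem smoothStep_le_one (u : ℝ) : smoothStep δ u ≤ 1 := Real.smoothTransition.le_one _

theorem smoothStep_eq_zero (hδ : 0 < δ) {u : ℝ} (hu : u ≤ -δ) : smoothStep δ u = 0 :=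
  Real.smoothTransition.zero_of_nonpos
    (div_nonpos_of_nonpos_of_nonneg (by linarith) (by positivity))

theorem smoothStep_eq_one (hδ : 0 < δ) {u : ℝ} (hu : δ ≤ u) : smoothStep δ u = 1 :=
  Real.smoothTransition.one_of_one_le (by rw [le_div_iff₀ (by positivity)]; linarith)

/-- The difference of two steps `smoothStep δ v ≤ smoothStep δ u` is bounded below if `0` separates
`v` from `u` and at least one of them is outside the transition interval. -/
theorem exists_pos_le_smoothStep_sub (hδ : 0 < δ) :
    ∃ c : ℝ, 0 < c ∧ ∀ u v : ℝ, 0 ≤ u → v ≤ 0 → (δ ≤ u ∨ v ≤ -δ) →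
      c ≤ smoothStep δ u - smoothStep δ v := by
  have h0 : (0 + δ) / (2 * δ) = 1 / 2 := by field_simp; ring
  have h1 : 0 < smoothStep δ 0 := by
    unfold smoothStep; rw [h0]; exact Real.smoothTransition.pos_of_pos (by norm_num)
  have h2 : smoothStep δ 0 < 1 := by
    unfold smoothStep; rw [h0]; exact Real.smoothTransition.lt_one_of_lt_one (by norm_num)
  refine ⟨min (smoothStep δ 0) (1 - smoothStep δ 0), lt_min h1 (by linarith), ?_⟩
  rintro u v hu hv (h | h)
  · rw [smoothStep_eq_one hδ h]
    exact (min_le_right _ _).trans (by linarith [monotone_smoothStep hδ hv])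
  · rw [smoothStep_eq_zero hδ h]
    exact (min_le_left _ _).trans (by linarith [monotone_smoothStep hδ hu])

/-- The vertical coordinate at which the bump functions of level `k` fade out, as a step in the
rescaled height. For `k ≥ 1` it matches the step at which the functions of level `k - 1` set in;
for `k = 0` it is postponed beyond the height `2`, the top of the Whitney boxes. -/
noncomputable def upperStep (δ : ℝ) : ℕ → ℝ → ℝ
  | 0, w => smoothStep δ (w - 2 - δ)
  | _ + 1, w => smoothStep δ (w / 2 - 1)

theorem contDiff_upperStep (δ : ℝ) (k : ℕ) : ContDiff ℝ ∞ (upperStep δ k) := by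
  cases k with
  | zero => exact (contDiff_smoothStep δ).comp ((contDiff_id.sub contDiff_const).sub contDiff_const)
  | succ k => exact (contDiff_smoothStep δ).comp ((contDiff_id.div_const _).sub contDiff_const)

theorem upperStep_nonneg (k : ℕ) (w : ℝ) : 0 ≤ upperStep δ k w := by
  cases k <;> exact smoothStep_nonneg _

theorem upperStep_eq_zero (hδ : 0 < δ) (hδ1 : δ ≤ 1 / 4) {k : ℕ} {w : ℝ} (hw : w ≤ 1 - δ) :
    upperStep δ k w = 0 := by
  cases k <;> exact smoothStep_eq_zero hδ (by linarith)

theorem upperStep_eq_one (hδ : 0 < δ) {k : ℕ} {w : ℝ} (hw : 2 + 2 * δ ≤ w) :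
    upperStep δ k w = 1 := by
  cases k <;> exact smoothStep_eq_one hδ (by linarith)

/-- The bump functions of one level set in below the height at which they fade out. -/
theorem upperStep_le (hδ : 0 < δ) (hδ1 : δ ≤ 1 / 4) {k : ℕ} {w : ℝ} :
    upperStep δ k w ≤ smoothStep δ (w - 1) := by
  rcases le_or_gt w (1 - δ) with h | h
  · rw [upperStep_eq_zero hδ hδ1 h]; exact smoothStep_nonneg _
  · cases k with
    | zero => exact monotone_smoothStep hδ (by linarith)
    | succ k =>
      exact monotone_smoothStep hδ (by linarith)

theorem norm_le_mul_of_forall {n : ℕ} {B : ℝ} (hB : 0 ≤ B) {x : Eucl n} (h : ∀ i, ‖x i‖ ≤ B) :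
    ‖x‖ ≤ n * B := by
  refine abs_le_of_sq_le_sq' ?_ (by positivity) |>.2
  rw [EuclideanSpace.norm_sq_eq]
  calc ∑ i, ‖x i‖ ^ 2 ≤ ∑ _i : Fin n, B ^ 2 :=
        Finset.sum_le_sum fun i _ => pow_le_pow_left₀ (norm_nonneg _) (h i) 2
    _ = n * B ^ 2 := by simp
    _ ≤ (n * B) ^ 2 := by
        rw [mul_pow]
        refine mul_le_mul_of_nonneg_right ?_ (sq_nonneg B)
        exact_mod_cast Nat.le_self_pow two_ne_zero n

variable {d : ℕ}

/-- The bump function of level `k` adapted to the Whitney box over `(0,1]ᵈ`, after rescaling all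
levels to size `1`. It depends on `k` only through the distinction between `k = 0` and `k ≥ 1`. -/
noncomputable def unitBump (δ : ℝ) (k : ℕ) (z : Eucl (d + 1)) : ℝ :=
  (∏ i : Fin d, (smoothStep δ (z i.castSucc) - smoothStep δ (z i.castSucc - 1))) *
    (smoothStep δ (z (Fin.last d) - 1) - upperStep δ k (z (Fin.last d)))

theorem unitBump_mem_Icc (hδ : 0 < δ) (hδ1 : δ ≤ 1 / 4) (k : ℕ) (z : Eucl (d + 1)) :
    unitBump δ k z ∈ Icc (0 : ℝ) 1 := by
  have h1 : ∀ i : Fin d, 0 ≤ smoothStep δ (z i.castSucc) - smoothStep δ (z i.castSucc - 1) :=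
    fun i => sub_nonneg.2 (monotone_smoothStep hδ (by linarith))
  have h2 : ∀ i : Fin d, smoothStep δ (z i.castSucc) - smoothStep δ (z i.castSucc - 1) ≤ 1 :=
    fun i => (sub_le_self _ (smoothStep_nonneg _)).trans (smoothStep_le_one _)
  have h3 : 0 ≤ smoothStep δ (z (Fin.last d) - 1) - upperStep δ k (z (Fin.last d)) :=
    sub_nonneg.2 (upperStep_le hδ hδ1)
  have h4 : smoothStep δ (z (Fin.last d) - 1) - upperStep δ k (z (Fin.last d)) ≤ 1 :=
    (sub_le_self _ (upperStep_nonneg _ _)).trans (smoothStep_le_one _)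
  exact ⟨mul_nonneg (Finset.prod_nonneg fun i _ => h1 i) h3,
    mul_le_one₀ (Finset.prod_le_one (fun i _ => h1 i) fun i _ => h2 i) h3 h4⟩

theorem unitBump_support (hδ : 0 < δ) (hδ1 : δ ≤ 1 / 4) {k : ℕ} {z : Eucl (d + 1)}
    (hz : unitBump δ k z ≠ 0) :
    (∀ i : Fin d, -δ ≤ z i.castSucc ∧ z i.castSucc ≤ 1 + δ) ∧
      1 - δ ≤ z (Fin.last d) ∧ z (Fin.last d) ≤ 2 + 2 * δ := by
  obtain ⟨h1, h2⟩ := mul_ne_zero_iff.1 hz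
  rw [Finset.prod_ne_zero_iff] at h1
  refine ⟨fun i => ?_, ?_, ?_⟩
  · by_contra! h
    refine h1 i (Finset.mem_univ i) ?_
    rcases lt_or_ge (z i.castSucc) (-δ) with h' | h'
    · rw [smoothStep_eq_zero hδ h'.le, smoothStep_eq_zero hδ (by linarith), sub_zero]
    · rw [smoothStep_eq_one hδ (by linarith [h h']), smoothStep_eq_one hδ (by linarith [h h']),
        sub_self]
  · by_contra! h
    exact h2 (by rw [smoothStep_eq_zero hδ (by linarith), upperStep_eq_zero hδ hδ1 h.le, sub_zero])
  · by_contra! h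
    exact h2 (by rw [smoothStep_eq_one hδ (by linarith), upperStep_eq_one hδ h.le, sub_self])

theorem contDiff_unitBump (δ : ℝ) (k : ℕ) : ContDiff ℝ ∞ (unitBump (d := d) δ k) := by
  have hc : ∀ i : Fin (d + 1), ContDiff ℝ ∞ fun z : Eucl (d + 1) => z i :=
    fun i => (EuclideanSpace.proj (𝕜 := ℝ) i).contDiff
  refine ContDiff.mul (contDiff_prod fun i _ => ?_) ?_
  · exact ((contDiff_smoothStep δ).comp (hc _)).sub
      ((contDiff_smoothStep δ).comp ((hc _).sub contDiff_const))
  · exact ((contDiff_smoothStep δ).comp ((hc _).sub contDiff_const)).sub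
      ((contDiff_upperStep δ k).comp (hc _))

theorem hasCompactSupport_unitBump (hδ : 0 < δ) (hδ1 : δ ≤ 1 / 4) (k : ℕ) :
    HasCompactSupport (unitBump (d := d) δ k) := by
  refine HasCompactSupport.intro
    (isCompact_closedBall (0 : Eucl (d + 1)) ((d + 1) * (2 + 2 * δ))) fun z hz => ?_
  by_contra h
  obtain ⟨h1, h2, h3⟩ := unitBump_support hδ hδ1 h
  refine hz ?_
  have hb : ∀ i : Fin (d + 1), ‖z i‖ ≤ 2 + 2 * δ := by
    refine Fin.lastCases ?_ fun i => ?_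
    · exact abs_le.2 ⟨by linarith, h3⟩
    · exact abs_le.2 ⟨by linarith [(h1 i).1], by linarith [(h1 i).2]⟩
  rw [mem_closedBall_zero_iff]
  exact_mod_cast norm_le_mul_of_forall (by positivity) hb

theorem exists_lipschitzWith_unitBump (d : ℕ) (hδ : 0 < δ) (hδ1 : δ ≤ 1 / 4) :
    ∃ C : ℝ≥0, ∀ k : ℕ, LipschitzWith C (unitBump (d := d) δ k) := by
  have h : ∀ k : ℕ, ∃ C : ℝ≥0, LipschitzWith C (unitBump (d := d) δ k) := fun k =>
    (contDiff_unitBump δ k).lipschitzWith_of_hasCompactSupport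
      (hasCompactSupport_unitBump hδ hδ1 k) (by simp)
  obtain ⟨C0, h0⟩ := h 0
  obtain ⟨C1, h1⟩ := h 1
  refine ⟨max C0 C1, fun k => ?_⟩
  cases k with
  | zero => exact h0.weaken (le_max_left _ _)
  | succ k => exact h1.weaken (le_max_right _ _)

theorem exists_pos_le_unitBump (d : ℕ) (hδ : 0 < δ) (hδ1 : δ ≤ 1 / 4) :
    ∃ c : ℝ, 0 < c ∧ ∀ (k : ℕ) (z : Eucl (d + 1)),
      (∀ i : Fin d, 0 < z i.castSucc ∧ z i.castSucc ≤ 1) →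
      1 < z (Fin.last d) → z (Fin.last d) ≤ 2 → c ≤ unitBump δ k z := by
  obtain ⟨c, hc, h⟩ := exists_pos_le_smoothStep_sub hδ
  refine ⟨c ^ d * c, by positivity, fun k z h1 h2 h3 => ?_⟩
  refine mul_le_mul ?_ ?_ hc.le (Finset.prod_nonneg fun i _ =>
    sub_nonneg.2 (monotone_smoothStep hδ (by linarith)))
  · calc c ^ d = ∏ _i : Fin d, c := by simp
      _ ≤ _ := Finset.prod_le_prod (fun _ _ => hc.le) fun i _ => ?_
    refine h _ _ (h1 i).1.le (by linarith [(h1 i).2]) ?_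
    by_contra! hn
    linarith [hn.1, hn.2]
  · cases k with
    | zero => exact h _ _ (by linarith) (by linarith) (Or.inr (by linarith))
    | succ k =>
      refine h _ _ (by linarith) (by linarith) ?_
      by_contra! hn
      linarith [hn.1, hn.2]

/-- The family obtained by transporting `unitBump` to all dyadic cubes by scaling and translation.
-/
noncomputable def whitneyBump (δ : ℝ) (k : ℕ) (m : Fin d → ℤ) (x : Eucl (d + 1)) : ℝ :=
  unitBump δ k ((2 : ℝ) ^ k • x - glue (WithLp.toLp 2 fun i => (m i : ℝ), 0))

theorem whitneyBump_coords (k : ℕ) (m : Fin d → ℤ) (x : Eucl (d + 1)) :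
    (∀ i : Fin d,
      ((2 : ℝ) ^ k • x - glue (WithLp.toLp 2 fun i => (m i : ℝ), 0)) i.castSucc =
        2 ^ k * x i.castSucc - m i) ∧
    ((2 : ℝ) ^ k • x - glue (WithLp.toLp 2 fun i => (m i : ℝ), 0)) (Fin.last d) =
      2 ^ k * x (Fin.last d) := by
  constructor
  · intro i
    simp [glue_castSucc]
  · simp [glue_last]

theorem edge_natCast_eq_inv (k : ℕ) : edge (k : ℤ) = ((2 : ℝ) ^ k)⁻¹ := by
  simp [edge]

theorem mem_whitneyBox_iff {k : ℕ} {m : Fin d → ℤ} {x : Eucl (d + 1)} :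
    x ∈ whitneyBox (k : ℤ) m ↔
      (∀ i : Fin d, 0 < 2 ^ k * x i.castSucc - m i ∧ 2 ^ k * x i.castSucc - m i ≤ 1) ∧
        1 < 2 ^ k * x (Fin.last d) ∧ 2 ^ k * x (Fin.last d) ≤ 2 := by
  have h2 : (0 : ℝ) < 2 ^ k := by positivity
  have e1 : ∀ a b : ℝ, ((2 : ℝ) ^ k)⁻¹ * a < b ↔ a < 2 ^ k * b := fun a b => by
    rw [inv_mul_lt_iff₀ h2]
  have e2 : ∀ a b : ℝ, b ≤ ((2 : ℝ) ^ k)⁻¹ * a ↔ 2 ^ k * b ≤ a := fun a b => by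
    rw [le_inv_mul_iff₀ h2]
  have h3 := e1 1 (x (Fin.last d))
  have h4 := e2 2 (x (Fin.last d))
  rw [mul_one] at h3
  rw [mul_comm] at h4
  simp only [whitneyBox, dyadicCube, horizontal, mem_ofPred_eq, edge_natCast_eq_inv, e1, e2, h3, h4]
  refine and_congr (forall_congr' fun i => ?_) Iff.rfl
  constructor <;> rintro ⟨h5, h6⟩ <;> constructor <;> linarith

theorem whitneyBump_tsupport_subset (hδ : 0 < δ) (hδd : 16 * (d + 1) * δ = 1) (k : ℕ)
    (m : Fin d → ℤ) :
    tsupport (whitneyBump δ k m) ⊆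
      Metric.thickening (edge (k : ℤ) / 4) (whitneyBox (k : ℤ) m) := by
  have hδ1 : δ ≤ 1 / 4 := by
    have : (0 : ℝ) ≤ d * δ := by positivity
    linarith
  have h2 : (0 : ℝ) < 2 ^ k := by positivity
  -- a closed box containing the support
  have hcl : tsupport (whitneyBump δ k m) ⊆
      {x | (∀ i : Fin d, -δ ≤ 2 ^ k * x i.castSucc - m i ∧ 2 ^ k * x i.castSucc - m i ≤ 1 + δ) ∧
        1 - δ ≤ 2 ^ k * x (Fin.last d) ∧ 2 ^ k * x (Fin.last d) ≤ 2 + 2 * δ} := by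
    refine closure_minimal (fun x hx => ?_) ?_
    · have h := unitBump_support hδ hδ1 hx
      simp only [(whitneyBump_coords k m x).1, (whitneyBump_coords k m x).2] at h
      exact h
    · simp only [ofPred_and, ofPred_forall]
      have hc : ∀ i : Fin (d + 1), Continuous fun z : Eucl (d + 1) => z i :=
        fun i => (EuclideanSpace.proj (𝕜 := ℝ) i).continuous
      refine (isClosed_iInter fun i => (isClosed_le ?_ ?_).inter (isClosed_le ?_ ?_)).inter
        ((isClosed_le ?_ ?_).inter (isClosed_le ?_ ?_)) <;>
      first
        | exact continuous_const
        | exact (continuous_const.mul (hc _)).sub continuous_const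
        | exact continuous_const.mul (hc _)
  refine hcl.trans fun x hx => ?_
  obtain ⟨h1, h3, h4⟩ := hx
  -- the coordinatewise projection to a slightly smaller closed box inside the Whitney box
  set z : Eucl (d + 1) := glue (WithLp.toLp 2 fun i =>
    (2 ^ k)⁻¹ * (m i + max δ (min (2 ^ k * x i.castSucc - m i) 1)),
    (2 ^ k)⁻¹ * max (1 + δ) (min (2 ^ k * x (Fin.last d)) 2)) with hz
  have z1 : ∀ i : Fin d, 2 ^ k * z i.castSucc =
      m i + max δ (min (2 ^ k * x i.castSucc - m i) 1) := fun i => by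
    rw [hz, glue_castSucc]; field_simp
  have z2 : 2 ^ k * z (Fin.last d) = max (1 + δ) (min (2 ^ k * x (Fin.last d)) 2) := by
    rw [hz, glue_last]; field_simp
  rw [Metric.mem_thickening_iff]
  refine ⟨z, mem_whitneyBox_iff.2 ⟨fun i => ?_, ?_, ?_⟩, ?_⟩
  · rw [z1, add_sub_cancel_left]
    exact ⟨lt_max_of_lt_left hδ, max_le (by linarith) (min_le_right _ _)⟩
  · rw [z2]; exact lt_max_of_lt_left (by linarith)
  · rw [z2]; exact max_le (by linarith) (min_le_right _ _)
  have hb : ∀ i, ‖((2 : ℝ) ^ k • (x - z)) i‖ ≤ 2 * δ := by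
    refine Fin.lastCases ?_ fun i => ?_
    · have e : ((2 : ℝ) ^ k • (x - z)) (Fin.last d) =
          2 ^ k * x (Fin.last d) - 2 ^ k * z (Fin.last d) := by simp [mul_sub]
      rw [e, z2, Real.norm_eq_abs, abs_le]
      rcases max_cases (1 + δ) (min (2 ^ k * x (Fin.last d)) 2) with h | h <;>
      rcases min_cases (2 ^ k * x (Fin.last d)) 2 with h' | h' <;> constructor <;> linarith
    · have e : ((2 : ℝ) ^ k • (x - z)) i.castSucc =
          2 ^ k * x i.castSucc - 2 ^ k * z i.castSucc := by simp [mul_sub]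
      rw [e, z1, Real.norm_eq_abs, abs_le]
      have := h1 i
      rcases max_cases δ (min (2 ^ k * x i.castSucc - m i) 1) with h | h <;>
      rcases min_cases (2 ^ k * x i.castSucc - m i) 1 with h' | h' <;> constructor <;> linarith
  have hn := norm_le_mul_of_forall (by positivity) hb
  rw [norm_smul, Real.norm_of_nonneg h2.le] at hn
  rw [dist_eq_norm, edge_natCast_eq_inv, div_eq_mul_inv, lt_inv_mul_iff₀ h2]
  push_cast at hn
  linarith

/-- Both in the horizontal and in the vertical variables the sum of the bump functions telescopes.
-/
theorem finsum_whitneyBump (hδ : 0 < δ) (hδ1 : δ ≤ 1 / 4) {x : Eucl (d + 1)}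
    (hx0 : 0 < x (Fin.last d)) (hx2 : x (Fin.last d) ≤ 2) :
    ∑ᶠ Q : ℕ × (Fin d → ℤ), whitneyBump δ Q.1 Q.2 x = 1 := by
  set t := x (Fin.last d) with ht
  -- levels beyond `n` vanish at height `t`
  obtain ⟨n, hn⟩ : ∃ n : ℕ, 2 / t < 2 ^ n := pow_unbounded_of_one_lt _ one_lt_two
  rw [div_lt_iff₀ hx0] at hn
  obtain ⟨M, hM⟩ : ∃ M : ℕ, 2 ^ n * ‖x‖ + 2 < M := exists_nat_gt _
  have hval : ∀ (k : ℕ) (m : Fin d → ℤ), whitneyBump δ k m x =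
      (∏ i : Fin d, (smoothStep δ (2 ^ k * x i.castSucc - m i) -
        smoothStep δ (2 ^ k * x i.castSucc - m i - 1))) *
      (smoothStep δ (2 ^ k * t - 1) - upperStep δ k (2 ^ k * t)) := fun k m => by
    simp only [whitneyBump, unitBump, (whitneyBump_coords k m x).1,
      (whitneyBump_coords k m x).2, ht]
  have hxi : ∀ k ≤ n, ∀ i : Fin d, |2 ^ k * x i.castSucc| + 2 < M := fun k hk i => by
    refine lt_of_le_of_lt ?_ hM
    rw [abs_mul, abs_of_pos (by positivity)]
    gcongr
    · exact one_le_two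
    · exact PiLp.norm_apply_le x i.castSucc
  set J : Finset ℤ := Finset.Ico (-(M : ℤ)) M with hJ
  have hsupp : (Function.support fun Q : ℕ × (Fin d → ℤ) => whitneyBump δ Q.1 Q.2 x) ⊆
      ((Finset.range (n + 1) ×ˢ Fintype.piFinset fun _ : Fin d => J : Finset _) :
        Set (ℕ × (Fin d → ℤ))) := by
    rintro ⟨k, m⟩ hQ
    have hS := unitBump_support hδ hδ1 hQ
    simp only [(whitneyBump_coords k m x).1, (whitneyBump_coords k m x).2] at hS
    obtain ⟨h1, -, h3⟩ := hS
    have hk : k ≤ n := by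
      by_contra! hk
      have : (2 : ℝ) ^ (n + 1) ≤ 2 ^ k := pow_le_pow_right₀ one_le_two hk
      have := mul_le_mul_of_nonneg_right this hx0.le
      rw [pow_succ] at this
      linarith
    simp only [Finset.coe_product, mem_prod, Finset.mem_coe, Finset.mem_range, Fintype.mem_piFinset,
      hJ, Finset.mem_Ico]
    refine ⟨by omega, fun i => ?_⟩
    obtain ⟨h5, h6⟩ := abs_lt.1 (lt_sub_iff_add_lt.2 (hxi k hk i))
    have h7 := h1 i
    constructor
    · have : (-(M : ℝ)) ≤ m i := by linarith
      exact_mod_cast this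
    · have : (m i : ℝ) < M := by linarith
      exact_mod_cast this
  rw [finsum_eq_sum_of_support_subset _ hsupp, Finset.sum_product]
  have htel : ∀ (a : ℝ) (N : ℕ), ∑ j ∈ Finset.Ico (-(M : ℤ)) (-M + N),
      (smoothStep δ (a - j) - smoothStep δ (a - j - 1)) =
        smoothStep δ (a + M) - smoothStep δ (a + M - N) := by
    intro a N
    induction N with
    | zero => simp
    | succ N ih =>
      have e : Finset.Ico (-(M : ℤ)) (-M + (N + 1 : ℕ)) =
          insert (-(M : ℤ) + N) (Finset.Ico (-(M : ℤ)) (-M + N)) := by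
        ext j; simp only [Finset.mem_insert, Finset.mem_Ico]; omega
      rw [e, Finset.sum_insert (by simp), ih]
      push_cast
      ring_nf
  have hone : ∀ k ≤ n, ∀ i : Fin d, ∑ j ∈ J,
      (smoothStep δ (2 ^ k * x i.castSucc - j) - smoothStep δ (2 ^ k * x i.castSucc - j - 1)) =
        1 := by
    intro k hk i
    have e : (M : ℤ) = -M + (M + M : ℕ) := by push_cast; ring
    obtain ⟨h5, h6⟩ := abs_lt.1 (lt_sub_iff_add_lt.2 (hxi k hk i))
    rw [hJ]
    nth_rw 2 [e]
    rw [htel, smoothStep_eq_one hδ (by linarith),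
      smoothStep_eq_zero hδ (by push_cast; linarith), sub_zero]
  have hlevel : ∀ k ∈ Finset.range (n + 1),
      ∑ m ∈ Fintype.piFinset (fun _ : Fin d => J), whitneyBump δ k m x =
        smoothStep δ (2 ^ k * t - 1) - upperStep δ k (2 ^ k * t) := by
    intro k hk
    simp only [hval]
    rw [← Finset.sum_mul, ← Finset.prod_univ_sum (fun _ : Fin d => J) fun i j =>
      smoothStep δ (2 ^ k * x i.castSucc - j) - smoothStep δ (2 ^ k * x i.castSucc - j - 1),
      Finset.prod_eq_one fun i _ => hone k (Nat.lt_succ_iff.1 (Finset.mem_range.1 hk)) i, one_mul]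
  rw [Finset.sum_congr rfl hlevel]
  have hvert : ∀ N : ℕ, ∑ k ∈ Finset.range (N + 1),
      (smoothStep δ (2 ^ k * t - 1) - upperStep δ k (2 ^ k * t)) =
        smoothStep δ (2 ^ N * t - 1) := by
    intro N
    induction N with
    | zero =>
      simp only [zero_add, Finset.range_one, Finset.sum_singleton, pow_zero, one_mul, upperStep]
      rw [smoothStep_eq_zero hδ (u := t - 2 - δ) (by linarith), sub_zero]
    | succ N ih =>
      rw [Finset.sum_range_succ, ih, upperStep, pow_succ]
      ring_nf
  rw [hvert, smoothStep_eq_one hδ (by linarith)]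

theorem exists_isWhitneyFamily (d : ℕ) :
    ∃ ψ : ℕ → (Fin d → ℤ) → Eucl (d + 1) → ℝ, IsWhitneyFamily ψ := by
  -- an overhang of at most `2 * δ` in each of the `d + 1` coordinates is admissible
  obtain ⟨δ, hδ, hδd⟩ : ∃ δ : ℝ, 0 < δ ∧ 16 * (d + 1) * δ = 1 :=
    ⟨1 / (16 * (d + 1)), by positivity, by field_simp⟩
  have hδ1 : δ ≤ 1 / 4 := by
    have : (0 : ℝ) ≤ d * δ := by positivity
    linarith
  refine ⟨whitneyBump δ, ?_, ?_, ?_, ?_, whitneyBump_tsupport_subset hδ hδd, ?_⟩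
  · intro k m
    exact (contDiff_unitBump δ k).comp ((contDiff_id.const_smul _).sub contDiff_const)
  · exact fun k m x => unitBump_mem_Icc hδ hδ1 k _
  · obtain ⟨C, hC⟩ := exists_lipschitzWith_unitBump d hδ hδ1
    refine ⟨C, fun k m => (hC k).comp (LipschitzWith.of_dist_le_mul fun x y => ?_)⟩
    rw [dist_sub_right, dist_smul₀]
    simp
  · obtain ⟨c, hc, h⟩ := exists_pos_le_unitBump d hδ hδ1
    refine ⟨c, hc, fun k m x hx => ?_⟩
    rw [mem_whitneyBox_iff] at hx
    obtain ⟨e1, e2⟩ := whitneyBump_coords k m x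
    exact h k _ (fun i => by rw [e1]; exact hx.1 i) (by rw [e2]; exact hx.2.1)
      (by rw [e2]; exact hx.2.2)
  · intro x hx
    obtain ⟨⟨k, m⟩, hx⟩ := mem_iUnion.1 hx
    have h := (mem_whitneyBox_iff.1 hx).2
    have h2 : (1 : ℝ) ≤ 2 ^ k := one_le_pow₀ one_le_two
    have h0 : 0 < x (Fin.last d) := by
      by_contra! hn
      linarith [mul_nonpos_of_nonneg_of_nonpos (zero_le_one.trans h2) hn]
    exact finsum_whitneyBump hδ hδ1 h0 (by nlinarith [h.2])

end Existence

end WhitneyTrace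

theorem mainTheorem2 (d : ℕ) (hd : 1 ≤ d) (p α : ℝ) (hp : 1 ≤ p) (hα : -1 < α)
    (hαp : α < p - 1) :
    (∃ ψ : ℕ → (Fin d → ℤ) → WhitneyTrace.Eucl (d + 1) → ℝ, WhitneyTrace.IsWhitneyFamily ψ) ∧
    ∀ ψ : ℕ → (Fin d → ℤ) → WhitneyTrace.Eucl (d + 1) → ℝ, WhitneyTrace.IsWhitneyFamily ψ →
      WhitneyTrace.IsWhitneyTraceExtensionPair ψ
        (WhitneyTrace.besovSpace d (1 - (α + 1) / p) p p)
        (WhitneyTrace.besovNorm (1 - (α + 1) / p) p p)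
        (WhitneyTrace.sobolevSpace d p (WhitneyTrace.weightMeasure d α))
        (WhitneyTrace.sobolevNorm p (WhitneyTrace.weightMeasure d α))
        (WhitneyTrace.weightMeasure d α) := by
  refine ⟨WhitneyTrace.exists_isWhitneyFamily d, fun ψ hψ => ?_⟩
  obtain ⟨CE, hCE⟩ := hψ.exists_bounded hp hα hαp
  obtain ⟨CR, hCR⟩ := WhitneyTrace.exists_besovNorm_trace_le d hp hα hαp
  exact
    { ext_linear := fun f hf g hg a b x hx => hψ.whitneyExt_linear hf.1 hg.1 a b hx
      ext_bounded := ⟨CE, fun f hf => (hCE f hf).2⟩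
      trace_exists := fun f hf => WhitneyTrace.ae_exists_hasTraceAt hp hα hf
      trace_linear := fun f hf g hg a b => WhitneyTrace.ae_trace_linear hp hα hf hg a b
      trace_bounded := ⟨CR, hCR⟩
      trace_ext := fun f hf => hψ.ae_trace_whitneyExt hp hα hf.1 (hCE f hf).2.1 }
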